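/- Let $\alpha\in\mathbb R$, and let $K_1,K_2\in C([0,1])$ satisfy $K_1(x)<0<K_2(x)$ for all $x\in[0,1]$ and have distributional second derivatives in $L^2([0,1])$. Let $f,\sigma:[0,1]\times\mathbb R\to\mathbb R$ be bounded, with $f$ measurable, $\sigma$ continuous in both variables, and suppose there are constants $C,m>0$ such that $$|f(x,y)-f(x,\hat y)|+|\sigma(x,y)-\sigma(x,\hat y)|\le C|y-\hat y|,\qquad |\sigma(x,y)|\ge m\qquad (x\in[0,1],\ y,\hat y\in\mathbb R).$$ Let $E=\{z\in C([0,1]):K_1\le z\le K_2\}$, with the metric of the maximum norm. For $t_1<t_2$, $\dot h\in L^2([0,1]\times[t_1,t_2])$ and $v\in C([t_1,t_2];E)$, write $v=u^h$ on $[t_1,t_2]$ if there are finite (positive) Borel measures $\eta,\xi$ on $[0,1]\times[t_1,t_2]$ such that $(v,\eta,\xi)$ solves, with initial value $v(t_1)$, the reflected equation $$\partial_t v=\partial_{xx}v-\alpha v+f(x,v)+\sigma(x,v)\dot h+\eta-\xi,\qquad \partial_xv(0,t)=\partial_xv(1,t)=0,$$ in the following sense: for all $t\in[t_1,t_2]$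 and all $\phi\in C^\infty([0,1])$ with $\phi'(0)=\phi'(1)=0$, $$(v(t),\phi)-\int_{t_1}^t(v(s),\phi'')\,ds+\alpha\int_{t_1}^t(v(s),\phi)\,ds-\int_{t_1}^t(f(\cdot,v(s)),\phi)\,ds-\int_{t_1}^t(\sigma(\cdot,v(s))\dot h(\cdot,s),\phi)\,ds$$ $$=(v(t_1),\phi)+\int_{[0,1]\times[t_1,t]}\phi(x)\,\eta(dx,ds)-\int_{[0,1]\times[t_1,t]}\phi(x)\,\xi(dx,ds),$$ where $(\cdot,\cdot)$ is the inner product of $L^2([0,1])$, and $$\int_{[0,1]\times[t_1,t_2]}(v-K_1)\,d\eta=\int_{[0,1]\times[t_1,t_2]}(K_2-v)\,d\xi=0 .$$ Set $$I_{t_1}^{t_2}(v)=\inf\Big\{\tfrac12\|\dot h\|^2_{L^2([0,1]\times[t_1,t_2])}:\ v=u^h\text{ on }[t_1,t_2]\Big\}\in[0,\infty]\qquad(\inf\emptyset=\infty),$$ and define the quasipotential $J:E\to[0,\infty]$ by $$J(z)=\inf\big\{I_0^t(v):\ t>0,\ v\in C([0,t];E),\ v(0)=0,\ v(t)=z\big\}.$$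 **Proposition 4.2.** The quasipotential $J:E\to[0,\infty]$ is lower semicontinuous, and for every $r\ge0$ the level set $\{z\in E: J(z)\le r\}$ is a compact subset of $E$. -/

import Mathlib

open MeasureTheory Set
open scoped ContDiff ENNReal NNReal

noncomputable section

namespace ReflectedSPDE

/-- The distributional second derivative of `K` on `(0,1)` belongs to `L²([0,1])`. -/
def HasL2SecondDeriv (K : C(unitInterval, ℝ)) : Prop :=
  ∃ g : unitInterval → ℝ, MemLp g 2 volume ∧
    ∀ φ : ℝ → ℝ, ContDiff ℝ ∞ φ → HasCompactSupport φ → tsupport φ ⊆ Ioo (0 : ℝ) 1 →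
      ∫ x : unitInterval, K x * deriv (deriv φ) (x : ℝ) = ∫ x : unitInterval, g x * φ (x : ℝ)

/-- The space `E` of continuous functions on `[0,1]` lying between the two walls; as a subtype of
`C([0,1])` it carries the metric of the maximum norm. -/
def wallSpace (K₁ K₂ : C(unitInterval, ℝ)) : Set C(unitInterval, ℝ) :=
  {z | ∀ x, K₁ x ≤ z x ∧ z x ≤ K₂ x}

/-- The space-time strip `[t₁,t] × [0,1]`, with time as the first coordinate. -/
def strip (t₁ t : ℝ) : Set (ℝ × unitInterval) := Icc t₁ t ×ˢ univ

/-- The triple `(v, η, ξ)` solves, on the time interval `[t₁,t₂]` and with initial value `v t₁`,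
the reflected equation `∂ₜv = ∂ₓₓv - α v + f(x,v) + σ(x,v) h + η - ξ`, `K₁ ≤ v ≤ K₂`, with Neumann
boundary conditions. Here `h` is the (density of the) control. Every smooth function on `[0,1]`
extends to a smooth function on `ℝ`, so test functions are taken on `ℝ`. -/
structure IsSkeletonSolution (α : ℝ) (f σ : unitInterval → ℝ → ℝ) (K₁ K₂ : C(unitInterval, ℝ))
    (t₁ t₂ : ℝ) (h : ℝ × unitInterval → ℝ) (v : ℝ → C(unitInterval, ℝ))
    (η ξ : Measure (ℝ × unitInterval)) : Prop where
  continuousOn : ContinuousOn v (Icc t₁ t₂)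
  mem_wallSpace : ∀ t ∈ Icc t₁ t₂, v t ∈ wallSpace K₁ K₂
  eta_finite : η (strip t₁ t₂) < ⊤
  xi_finite : ξ (strip t₁ t₂) < ⊤
  weak_form : ∀ t ∈ Icc t₁ t₂, ∀ φ : ℝ → ℝ, ContDiff ℝ ∞ φ → deriv φ 0 = 0 → deriv φ 1 = 0 →
    (∫ x : unitInterval, v t x * φ x)
        - (∫ p in strip t₁ t, v p.1 p.2 * deriv (deriv φ) p.2)
        + α * (∫ p in strip t₁ t, v p.1 p.2 * φ p.2)
        - (∫ p in strip t₁ t, f p.2 (v p.1 p.2) * φ p.2)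
        - (∫ p in strip t₁ t, σ p.2 (v p.1 p.2) * h p * φ p.2)
      = (∫ x : unitInterval, v t₁ x * φ x)
        + (∫ p in strip t₁ t, φ p.2 ∂η) - (∫ p in strip t₁ t, φ p.2 ∂ξ)
  eta_support : ∫ p in strip t₁ t₂, (v p.1 p.2 - K₁ p.2) ∂η = 0
  xi_support : ∫ p in strip t₁ t₂, (K₂ p.2 - v p.1 p.2) ∂ξ = 0

/-- `v = u^h` on `[t₁,t₂]`: the control `h` is square integrable on `[t₁,t₂] × [0,1]` and `v` is the
first component of a solution of the skeleton equation driven by `h`. -/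
def IsDrivenBy (α : ℝ) (f σ : unitInterval → ℝ → ℝ) (K₁ K₂ : C(unitInterval, ℝ))
    (t₁ t₂ : ℝ) (h : ℝ × unitInterval → ℝ) (v : ℝ → C(unitInterval, ℝ)) : Prop :=
  MemLp h 2 (volume.restrict (strip t₁ t₂)) ∧
    ∃ η ξ : Measure (ℝ × unitInterval), IsSkeletonSolution α f σ K₁ K₂ t₁ t₂ h v η ξ

/-- The path-space rate functional: the infimum of `½ ‖h‖²` in `L²([t₁,t₂] × [0,1])` over the
controls `h` with `v = u^h`; it is `∞` when there is no such control. -/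
def rateFunctional (α : ℝ) (f σ : unitInterval → ℝ → ℝ) (K₁ K₂ : C(unitInterval, ℝ))
    (t₁ t₂ : ℝ) (v : ℝ → C(unitInterval, ℝ)) : ℝ≥0∞ :=
  ⨅ (h : ℝ × unitInterval → ℝ) (_ : IsDrivenBy α f σ K₁ K₂ t₁ t₂ h v),
    ENNReal.ofReal ((1 / 2) * ∫ p in strip t₁ t₂, (h p) ^ 2)

/-- The quasipotential `J : E → [0,∞]`: the infimum of the rate functional over all `t > 0` and all
paths `v ∈ C([0,t]; E)` from `0` to `z`. (Only the values of `v` on `[0,t]` matter.) -/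
def quasipotential (α : ℝ) (f σ : unitInterval → ℝ → ℝ) (K₁ K₂ : C(unitInterval, ℝ))
    (z : wallSpace K₁ K₂) : ℝ≥0∞ :=
  ⨅ (t : ℝ) (_ : 0 < t) (v : ℝ → C(unitInterval, ℝ))
    (_ : ContinuousOn v (Icc 0 t)) (_ : ∀ s ∈ Icc 0 t, v s ∈ wallSpace K₁ K₂)
    (_ : v 0 = 0) (_ : v t = z),
    rateFunctional α f σ K₁ K₂ 0 t v

end ReflectedSPDE

end

/-!
The argument rests on a reformulation of the reflected equation that never mentions the reflection
measures. Let `Φ` be the Dirichlet energy `½ ∫ (u')²`, restricted to the functions between the walls.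
A path `v` with total forcing `g = -α v + f(·,v) + σ(·,v) h` solves the equation exactly if it
is the gradient flow of `Φ` with forcing `g`, in the form of the *evolution variational inequality*
`½ |v t - x|² - ½ |v s - x|² + ∫ₛᵗ Φ(v) ≤ (t - s) Φ(x) + ∫ₛᵗ (g, v - x)` for all competitors `x`
of finite energy (`IsEVI`). Since `|σ|` is bounded below, forcing and control determine each other,
so the cost is a function of the path and its forcing. The two halves of the equivalence are

* `IsDrivenBy.isEVI`: test with cosines, sum over the modes, and pass to Cesàro means. The Fejér
  means converge uniformly, hence against the reflection measures, whose supports give the right sign;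
* `IsEVI.isDrivenBy`: testing with `x = v s + ε φ` over short intervals shows that the residual of the
  equation increases in time when localized away from the upper wall, and decreases away from the
  lower one. Such a monotone family of functionals is the distribution function of a measure
  (`exists_measure_of_increments`), which is carried by the contact set.

The energy of a path of bounded cost is bounded after an arbitrarily short time
(`IsEVI.exists_energyLE`), by a bound depending only on that time and the cost, and between the
walls the sublevel sets of the energy are compact in the maximum norm. So final states of
quasipotential at most `r` form a relatively compact set. To identify the limit `y` of such states
`z n`, take paths to `z n` of cost at most `r + ε`, extended backwards by resting at `0` so that
they last longer than a fixed time. On a final piece of that fixed duration they converge uniformly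
along an ultrafilter (`exists_uniform_limit`) and their controls converge weakly, and the
variational inequality passes to the limit path `w` (`isEVI_of_tendsto`), whose cost on the piece
is at most the limit of the costs.

It remains to replace the last piece of one of the paths by that of `w`, which requires a cheap
connection from `v n s` to the nearby state `w s` at some time `s`. At a suitable `s` the energy
has a subgradient at `w s` (`IsEVI.exists_isSubgradient`), that is, some forcing `ζ` in `L²` keeps
it at rest. An implicit Euler scheme with the feedback `(w s - u) / (τ - t)` then steers `v n s` to
`w s` in time `τ` with forcing of size `‖ζ‖ + |v n s - w s| / τ` (`exists_connecting_path`), at a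
cost of order `τ` once `|v n s - w s| ≤ τ`. Concatenating the three pieces gives `J y ≤ r + ε`. The
level sets are therefore compact, and lower semicontinuity follows, because they are closed.
-/

noncomputable section

namespace ReflectedSPDE

open Filter Topology

/-! ### Cosine expansions and Fejér means -/

/-- The inclusion of `C([0,1])` into `L²([0,1])`. -/
def toL2 : C(unitInterval, ℝ) →L[ℝ] Lp ℝ 2 (volume : Measure unitInterval) :=
  ContinuousMap.toLp 2 volume ℝ

lemma integrable_of_continuous {u : unitInterval → ℝ} (hu : Continuous u) :
    Integrable u volume :=
  hu.integrable_of_hasCompactSupport (HasCompactSupport.of_compactSpace u)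

lemma inner_toL2 (u v : C(unitInterval, ℝ)) :
    inner ℝ (toL2 u) (toL2 v) = ∫ x : unitInterval, u x * v x := by
  rw [toL2, ContinuousMap.inner_toLp]
  simp [mul_comm]

lemma norm_toL2_sq (u : C(unitInterval, ℝ)) :
    ‖toL2 u‖ ^ 2 = ∫ x : unitInterval, u x ^ 2 := by
  rw [← real_inner_self_eq_norm_sq, inner_toL2]
  simp [sq]

lemma norm_toL2_le (u : C(unitInterval, ℝ)) : ‖toL2 u‖ ≤ ‖u‖ := by
  have h1 : ‖toL2 u‖ ^ 2 ≤ ‖u‖ ^ 2 := by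
    rw [norm_toL2_sq]
    calc ∫ x : unitInterval, u x ^ 2 ≤ ∫ x : unitInterval, ‖u‖ ^ 2 := by
          refine integral_mono (integrable_of_continuous (by fun_prop)) (by simp) fun x => ?_
          have := u.norm_coe_le_norm x
          rw [← sq_abs (u x)]
          exact pow_le_pow_left₀ (abs_nonneg _) this 2
      _ = ‖u‖ ^ 2 := by simp
  exact le_of_sq_le_sq h1 (norm_nonneg _)

lemma integral_unitInterval (f : ℝ → ℝ) :
    ∫ x : unitInterval, f x = ∫ x in (0 : ℝ)..1, f x := by
  rw [intervalIntegral.integral_of_le zero_le_one, ← integral_Icc_eq_integral_Ioc]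
  exact integral_subtype measurableSet_Icc f

/-- The function `x ↦ cos (k π x)` on `[0,1]`. -/
def cosMode (k : ℕ) : C(unitInterval, ℝ) :=
  ⟨fun x => Real.cos (k * Real.pi * x), by fun_prop⟩

/-- The `k`-th cosine coefficient of a continuous function, as a continuous linear functional. -/
def cosCoeff (k : ℕ) : C(unitInterval, ℝ) →L[ℝ] ℝ :=
  (innerSL ℝ (toL2 (cosMode k))).comp toL2

/-- The weight of the `k`-th cosine mode in a cosine expansion. -/
def cosWeight (k : ℕ) : ℝ := if k = 0 then 1 else 2

/-- The partial sums of the cosine expansion. -/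
def partialSum (M : ℕ) : C(unitInterval, ℝ) →L[ℝ] C(unitInterval, ℝ) :=
  ∑ k ∈ Finset.range (M + 1), cosWeight k • (cosCoeff k).smulRight (cosMode k)

/-- The Fejér means: the Cesàro means of the partial sums of the cosine expansion. -/
def fejerMean (N : ℕ) : C(unitInterval, ℝ) →L[ℝ] C(unitInterval, ℝ) :=
  (N : ℝ)⁻¹ • ∑ M ∈ Finset.range N, partialSum M

lemma cosMode_apply (k : ℕ) (x : unitInterval) :
    cosMode k x = Real.cos (k * Real.pi * x) := rfl

lemma cosCoeff_eq_inner (k : ℕ) (u : C(unitInterval, ℝ)) :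
    cosCoeff k u = inner ℝ (toL2 (cosMode k)) (toL2 u) := rfl

lemma cosCoeff_apply (k : ℕ) (u : C(unitInterval, ℝ)) :
    cosCoeff k u = ∫ x : unitInterval, u x * Real.cos (k * Real.pi * x) := by
  rw [cosCoeff_eq_inner, inner_toL2]
  simp [cosMode_apply, mul_comm]

lemma cosWeight_pos (k : ℕ) : 0 < cosWeight k := by
  unfold cosWeight; split_ifs <;> norm_num

lemma partialSum_apply (M : ℕ) (u : C(unitInterval, ℝ)) :
    partialSum M u = ∑ k ∈ Finset.range (M + 1), (cosWeight k * cosCoeff k u) • cosMode k := by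
  simp [partialSum, smul_smul]

lemma fejerMean_apply (N : ℕ) (u : C(unitInterval, ℝ)) :
    fejerMean N u = (N : ℝ)⁻¹ • ∑ M ∈ Finset.range N, partialSum M u := by
  simp [fejerMean]

lemma integral_cos_int (m : ℤ) :
    ∫ x : unitInterval, Real.cos (m * Real.pi * x) = if m = 0 then 1 else 0 := by
  rw [integral_unitInterval (fun x => Real.cos (m * Real.pi * x))]
  split_ifs with h
  · simp [h]
  · have hm : (m : ℝ) * Real.pi ≠ 0 :=
      mul_ne_zero (by exact_mod_cast h) Real.pi_ne_zero
    rw [intervalIntegral.integral_comp_mul_left (fun y => Real.cos y) hm]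
    simp [integral_cos, Real.sin_int_mul_pi]

lemma cosCoeff_cosMode (j k : ℕ) :
    cosCoeff j (cosMode k) = if j = k then (cosWeight k)⁻¹ else 0 := by
  rw [cosCoeff_apply]
  have h1 : ∀ x : unitInterval, cosMode k x * Real.cos (j * Real.pi * x)
      = (1 / 2) * (Real.cos (((k : ℤ) - (j : ℤ) : ℤ) * Real.pi * x)
        + Real.cos (((k : ℤ) + (j : ℤ) : ℤ) * Real.pi * x)) := by
    intro x
    have e1 : (((k : ℤ) - (j : ℤ) : ℤ) : ℝ) * Real.pi * x
      = k * Real.pi * x - j * Real.pi * x := by push_cast; ring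
    have e2 : (((k : ℤ) + (j : ℤ) : ℤ) : ℝ) * Real.pi * x
      = k * Real.pi * x + j * Real.pi * x := by push_cast; ring
    rw [cosMode_apply, e1, e2, Real.cos_sub, Real.cos_add]; ring
  simp_rw [h1]
  rw [integral_const_mul, integral_add (integrable_of_continuous (by fun_prop))
    (integrable_of_continuous (by fun_prop)), integral_cos_int, integral_cos_int]
  unfold cosWeight
  by_cases hjk : j = k
  · subst hjk
    by_cases hj : j = 0
    · simp [hj]; norm_num
    · have : ¬ ((j : ℤ) + j = 0) := by omega
      simp [hj, this]
  · have h2 : ¬ ((k : ℤ) - j = 0) := by omega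
    have h3 : ¬ ((k : ℤ) + j = 0) := by omega
    simp [hjk, h2, h3]

lemma partialSum_cosMode {M m : ℕ} (h : m ≤ M) : partialSum M (cosMode m) = cosMode m := by
  rw [partialSum_apply, Finset.sum_eq_single m]
  · simp [cosCoeff_cosMode, (cosWeight_pos m).ne']
  · intro b _ hb
    simp [cosCoeff_cosMode, hb]
  · intro hm
    simp at hm; omega

lemma fejerMean_cosMode (m : ℕ) :
    Tendsto (fun N => fejerMean N (cosMode m)) atTop (𝓝 (cosMode m)) := by
  simp_rw [fejerMean_apply]
  apply Filter.Tendsto.cesaro_smul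
  exact tendsto_const_nhds.congr' ((eventually_ge_atTop m).mono
    fun M hM => (partialSum_cosMode hM).symm)

/-- The Dirichlet kernel sums to the Fejér kernel, which is a sum of two squares. -/
lemma sum_dirichlet_eq (N : ℕ) (θ : ℝ) :
    ∑ M ∈ Finset.range N, ∑ k ∈ Finset.range (M + 1), cosWeight k * Real.cos (k * θ)
      = (∑ j ∈ Finset.range N, Real.cos (j * θ)) ^ 2
        + (∑ j ∈ Finset.range N, Real.sin (j * θ)) ^ 2 := by
  induction N with
  | zero => simp
  | succ N ih =>
    rw [Finset.sum_range_succ, ih, Finset.sum_range_succ (fun j : ℕ => Real.cos (j * θ)),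
      Finset.sum_range_succ (fun j : ℕ => Real.sin (j * θ))]
    have h1 : ∑ k ∈ Finset.range (N + 1), cosWeight k * Real.cos (k * θ)
        = 1 + 2 * ∑ k ∈ Finset.range N, Real.cos ((k + 1 : ℕ) * θ) := by
      rw [Finset.sum_range_succ', Finset.mul_sum]
      simp [cosWeight, add_comm]
    have h2 : ∑ k ∈ Finset.range N, Real.cos ((k + 1 : ℕ) * θ)
        = Real.cos (N * θ) * (∑ j ∈ Finset.range N, Real.cos (j * θ))
          + Real.sin (N * θ) * (∑ j ∈ Finset.range N, Real.sin (j * θ)) := by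
      rw [← Finset.sum_range_reflect, Finset.mul_sum, Finset.mul_sum, ← Finset.sum_add_distrib]
      refine Finset.sum_congr rfl fun j hj => ?_
      have hj' := Finset.mem_range.1 hj
      have : ((N - 1 - j + 1 : ℕ) : ℝ) * θ = N * θ - j * θ := by
        have : N - 1 - j + 1 = N - j := by omega
        rw [this, Nat.cast_sub hj'.le]; ring
      rw [this, Real.cos_sub]
    rw [h1, h2]
    have := Real.sin_sq_add_cos_sq (N * θ)
    linear_combination this.symm

/-- The kernel of the Fejér mean. -/
def fejerKernel (N : ℕ) (x y : unitInterval) : ℝ :=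
  (N : ℝ)⁻¹ * ∑ M ∈ Finset.range N, ∑ k ∈ Finset.range (M + 1),
    cosWeight k * (cosMode k x * cosMode k y)

lemma fejerKernel_nonneg (N : ℕ) (x y : unitInterval) : 0 ≤ fejerKernel N x y := by
  have h : ∀ k : ℕ, cosWeight k * (cosMode k x * cosMode k y)
      = (1 / 2) * (cosWeight k * Real.cos (k * (Real.pi * x - Real.pi * y)))
        + (1 / 2) * (cosWeight k * Real.cos (k * (Real.pi * x + Real.pi * y))) := by
    intro k
    rw [cosMode_apply, cosMode_apply, mul_sub, mul_add, Real.cos_sub, Real.cos_add,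
      mul_assoc, mul_assoc]
    ring
  unfold fejerKernel
  simp_rw [h, Finset.sum_add_distrib, ← Finset.mul_sum]
  rw [sum_dirichlet_eq, sum_dirichlet_eq]
  positivity

lemma fejerMean_eq_integral (N : ℕ) (u : C(unitInterval, ℝ)) (x : unitInterval) :
    fejerMean N u x = ∫ y : unitInterval, u y * fejerKernel N x y := by
  have h : ∀ y, u y * fejerKernel N x y = (N : ℝ)⁻¹ * ∑ M ∈ Finset.range N,
      ∑ k ∈ Finset.range (M + 1), cosWeight k * cosMode k x * (u y * cosMode k y) := by
    intro y
    rw [fejerKernel, mul_left_comm, Finset.mul_sum]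
    congr 1
    refine Finset.sum_congr rfl fun M _ => ?_
    rw [Finset.mul_sum]
    refine Finset.sum_congr rfl fun k _ => ?_
    ring
  simp_rw [h]
  rw [integral_const_mul, integral_finsetSum _
    (fun M _ => integrable_of_continuous (by fun_prop))]
  simp_rw [fun M => integral_finsetSum (μ := (volume : Measure unitInterval))
    (Finset.range (M + 1))
    (f := fun k y => cosWeight k * cosMode k x * (u y * cosMode k y))
    (fun k _ => integrable_of_continuous (by fun_prop)), integral_const_mul]
  rw [fejerMean_apply]
  simp only [partialSum_apply, ContinuousMap.smul_apply, ContinuousMap.sum_apply, smul_eq_mul]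
  congr 1
  refine Finset.sum_congr rfl fun M _ => Finset.sum_congr rfl fun k _ => ?_
  rw [cosCoeff_apply]
  simp only [cosMode_apply]
  ring

lemma continuous_fejerKernel (N : ℕ) (x : unitInterval) : Continuous (fejerKernel N x) := by
  unfold fejerKernel; fun_prop

lemma norm_fejerMean_le (N : ℕ) (u : C(unitInterval, ℝ)) : ‖fejerMean N u‖ ≤ ‖u‖ := by
  rcases Nat.eq_zero_or_pos N with rfl | hN
  · simp [fejerMean_apply]
  rw [ContinuousMap.norm_le _ (norm_nonneg _)]
  intro x
  have hone : ∫ y : unitInterval, fejerKernel N x y = 1 := by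
    have h1 := fejerMean_eq_integral N (cosMode 0) x
    have h2 : fejerMean N (cosMode 0) = cosMode 0 := by
      rw [fejerMean_apply, Finset.sum_congr rfl fun M _ => partialSum_cosMode (Nat.zero_le M)]
      rw [Finset.sum_const, Finset.card_range, ← Nat.cast_smul_eq_nsmul ℝ, smul_smul,
        inv_mul_cancel₀ (by positivity), one_smul]
    rw [h2] at h1
    simpa [cosMode_apply] using h1.symm
  rw [fejerMean_eq_integral]
  calc ‖∫ y : unitInterval, u y * fejerKernel N x y‖
      ≤ ∫ y : unitInterval, ‖u y * fejerKernel N x y‖ := norm_integral_le_integral_norm _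
    _ ≤ ∫ y : unitInterval, ‖u‖ * fejerKernel N x y := by
        have := continuous_fejerKernel N x
        refine integral_mono (integrable_of_continuous (by fun_prop))
          (integrable_of_continuous (by fun_prop)) fun y => ?_
        simp only [norm_mul]
        rw [Real.norm_of_nonneg (fejerKernel_nonneg N x y)]
        exact mul_le_mul_of_nonneg_right (u.norm_coe_le_norm y) (fejerKernel_nonneg N x y)
    _ = ‖u‖ := by rw [integral_const_mul, hone, mul_one]

lemma cosMode_mul (j k : ℕ) (h : k ≤ j) :
    cosMode j * cosMode k = (1 / 2 : ℝ) • (cosMode (j - k) + cosMode (j + k)) := by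
  ext x
  have e1 : (((j - k : ℕ) : ℝ)) * Real.pi * x = j * Real.pi * x - k * Real.pi * x := by
    rw [Nat.cast_sub h]; ring
  have e2 : (((j + k : ℕ) : ℝ)) * Real.pi * x = j * Real.pi * x + k * Real.pi * x := by
    push_cast; ring
  simp only [ContinuousMap.mul_apply, ContinuousMap.smul_apply, ContinuousMap.add_apply,
    cosMode_apply, e1, e2, Real.cos_sub, Real.cos_add, smul_eq_mul]
  ring

lemma dense_span_cosMode :
    (Submodule.span ℝ (range cosMode)).topologicalClosure = ⊤ := by
  have hmul : ∀ p q, p ∈ Submodule.span ℝ (range cosMode) →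
      q ∈ Submodule.span ℝ (range cosMode) → p * q ∈ Submodule.span ℝ (range cosMode) := by
    intro p q hp hq
    have := Submodule.mul_mem_mul hp hq
    rw [Submodule.span_mul_span] at this
    refine Submodule.span_le.2 ?_ this
    rintro _ ⟨_, ⟨j, rfl⟩, _, ⟨k, rfl⟩, rfl⟩
    have key : ∀ j k : ℕ, k ≤ j →
        cosMode j * cosMode k ∈ Submodule.span ℝ (range cosMode) := by
      intro j k h
      rw [cosMode_mul j k h]
      exact Submodule.smul_mem _ _ (Submodule.add_mem _
        (Submodule.subset_span ⟨_, rfl⟩) (Submodule.subset_span ⟨_, rfl⟩))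
    rcases le_total k j with h | h
    · exact key j k h
    · change cosMode j * cosMode k ∈ _
      rw [mul_comm]; exact key k j h
  have hone : (1 : C(unitInterval, ℝ)) ∈ Submodule.span ℝ (range cosMode) := by
    have : (1 : C(unitInterval, ℝ)) = cosMode 0 := by
      ext x; simp [cosMode_apply]
    rw [this]
    exact Submodule.subset_span ⟨_, rfl⟩
  let A : Subalgebra ℝ C(unitInterval, ℝ) :=
    (Submodule.span ℝ (range cosMode)).toSubalgebra hone hmul
  have hsep : A.SeparatesPoints := by
    intro x y hxy
    refine ⟨cosMode 1, ⟨cosMode 1, Submodule.subset_span ⟨1, rfl⟩, rfl⟩, fun h => hxy ?_⟩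
    simp only [cosMode_apply, Nat.cast_one, one_mul] at h
    have hpi := Real.pi_pos
    have h2 := Real.injOn_cos (x₁ := Real.pi * x) (x₂ := Real.pi * y)
      ⟨by have := x.2.1; positivity, by nlinarith [x.2.2]⟩
      ⟨by have := y.2.1; positivity, by nlinarith [y.2.2]⟩ h
    exact Subtype.ext (mul_left_cancel₀ hpi.ne' h2)
  have := ContinuousMap.subalgebra_topologicalClosure_eq_top_of_separatesPoints A hsep
  rw [SetLike.ext'_iff] at this ⊢
  simpa [A] using this

/-- Fejér's theorem for cosine expansions. -/
theorem tendsto_fejerMean (u : C(unitInterval, ℝ)) :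
    Tendsto (fun N => fejerMean N u) atTop (𝓝 u) := by
  rw [Metric.tendsto_atTop]
  intro ε hε
  have hu : u ∈ (Submodule.span ℝ (range cosMode)).topologicalClosure := by
    rw [dense_span_cosMode]; trivial
  rw [← SetLike.mem_coe, Submodule.topologicalClosure_coe, Metric.mem_closure_iff] at hu
  obtain ⟨p, hp, hup⟩ := hu (ε / 3) (by positivity)
  have hpt : Tendsto (fun N => fejerMean N p) atTop (𝓝 p) := by
    clear hup
    induction hp using Submodule.span_induction with
    | mem _ h => obtain ⟨m, rfl⟩ := h; exact fejerMean_cosMode m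
    | zero => simp
    | add p q _ _ hp hq => simpa using hp.add hq
    | smul c p _ hp => simpa using hp.const_smul c
  obtain ⟨N₀, hN₀⟩ := Metric.tendsto_atTop.1 hpt (ε / 3) (by positivity)
  refine ⟨N₀, fun N hN => ?_⟩
  have h1 : dist (fejerMean N u) (fejerMean N p) ≤ dist u p := by
    rw [dist_eq_norm, dist_eq_norm, ← map_sub]; exact norm_fejerMean_le _ _
  have h2 := hN₀ N hN
  have h3 := dist_triangle4 (fejerMean N u) (fejerMean N p) p u
  rw [dist_comm p u] at h3
  linarith

lemma toL2_injective : Function.Injective toL2 := by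
  refine (injective_iff_map_eq_zero toL2).2 fun u hu => ?_
  refine tendsto_nhds_unique (tendsto_fejerMean u) ?_
  have : ∀ N, fejerMean N u = 0 := fun N => by
    simp [fejerMean_apply, partialSum_apply, cosCoeff_eq_inner, hu]
  simp [this]

/-! ### The Dirichlet energy -/

/-- The Dirichlet energy `½ ∫ |u'|²` of the `M`-th partial sum of the cosine expansion of `u`. -/
def partialEnergy (M : ℕ) (u : C(unitInterval, ℝ)) : ℝ :=
  ∑ k ∈ Finset.range (M + 1), (Real.pi * k) ^ 2 * cosCoeff k u ^ 2

/-- The Dirichlet energy `½ ∫ |u'|²` of `u` is at most `E`. -/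
def EnergyLE (u : C(unitInterval, ℝ)) (E : ℝ) : Prop := ∀ M, partialEnergy M u ≤ E

lemma partialEnergy_nonneg (M : ℕ) (u : C(unitInterval, ℝ)) : 0 ≤ partialEnergy M u :=
  Finset.sum_nonneg fun _ _ => by positivity

lemma partialEnergy_mono (u : C(unitInterval, ℝ)) : Monotone fun M => partialEnergy M u := by
  intro M N h
  refine Finset.sum_le_sum_of_subset_of_nonneg (fun k hk => ?_) fun _ _ _ => by positivity
  simp only [Finset.mem_range] at hk ⊢
  omega

lemma continuous_partialEnergy (M : ℕ) : Continuous (partialEnergy M) := by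
  unfold partialEnergy; fun_prop

lemma EnergyLE.nonneg {u : C(unitInterval, ℝ)} {E : ℝ} (h : EnergyLE u E) : 0 ≤ E :=
  (partialEnergy_nonneg 0 u).trans (h 0)

lemma EnergyLE.mono {u : C(unitInterval, ℝ)} {E E' : ℝ} (h : EnergyLE u E) (hE : E ≤ E') :
    EnergyLE u E' := fun M => (h M).trans hE

lemma energyLE_zero : EnergyLE 0 0 := fun M => by simp [partialEnergy]

@[simp] lemma partialEnergy_neg (M : ℕ) (u : C(unitInterval, ℝ)) :
    partialEnergy M (-u) = partialEnergy M u := by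
  simp [partialEnergy]

lemma EnergyLE.neg {u : C(unitInterval, ℝ)} {E : ℝ} (h : EnergyLE u E) : EnergyLE (-u) E :=
  fun M => by simpa using h M

lemma EnergyLE.convex {u v : C(unitInterval, ℝ)} {E E' θ : ℝ} (hu : EnergyLE u E)
    (hv : EnergyLE v E') (h0 : 0 ≤ θ) (h1 : θ ≤ 1) :
    EnergyLE (u + θ • (v - u)) ((1 - θ) * E + θ * E') := by
  intro M
  have h : partialEnergy M (u + θ • (v - u))
      ≤ (1 - θ) * partialEnergy M u + θ * partialEnergy M v := by
    unfold partialEnergy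
    rw [Finset.mul_sum, Finset.mul_sum, ← Finset.sum_add_distrib]
    refine Finset.sum_le_sum fun k _ => ?_
    simp only [map_add, map_smul, map_sub, smul_eq_mul]
    have : 0 ≤ (Real.pi * k) ^ 2 * (θ * (1 - θ) * (cosCoeff k u - cosCoeff k v) ^ 2) := by
      have : 0 ≤ 1 - θ := by linarith
      positivity
    nlinarith
  have h2 : 0 ≤ 1 - θ := by linarith
  exact h.trans (add_le_add (mul_le_mul_of_nonneg_left (hu M) h2)
    (mul_le_mul_of_nonneg_left (hv M) h0))

/-- A lower bound valid for all late terms of a sequence passes to the limit of its Cesàro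
means. -/
lemma le_of_tendsto_cesaro {a : ℕ → ℝ} {c l : ℝ} {K : ℕ} (h : ∀ M, K ≤ M → c ≤ a M)
    (hl : Tendsto (fun N : ℕ => (N : ℝ)⁻¹ * ∑ M ∈ Finset.range N, a M) atTop (𝓝 l)) : c ≤ l := by
  have h1 : Tendsto (fun M => min c (a M)) atTop (𝓝 c) :=
    tendsto_const_nhds.congr' ((eventually_ge_atTop K).mono fun M hM => (min_eq_left (h M hM)).symm)
  refine le_of_tendsto_of_tendsto' h1.cesaro hl fun N => ?_
  exact mul_le_mul_of_nonneg_left (Finset.sum_le_sum fun M _ => min_le_right _ _) (by positivity)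

lemma tendsto_cesaro_inner (u v : C(unitInterval, ℝ)) :
    Tendsto (fun N : ℕ => (N : ℝ)⁻¹ * ∑ M ∈ Finset.range N,
      inner ℝ (toL2 u) (toL2 (partialSum M v))) atTop (𝓝 (inner ℝ (toL2 u) (toL2 v))) := by
  have h : Tendsto (fun N => inner ℝ (toL2 u) (toL2 (fejerMean N v))) atTop
      (𝓝 (inner ℝ (toL2 u) (toL2 v))) :=
    ((innerSL ℝ (toL2 u)).continuous.comp toL2.continuous).continuousAt.tendsto.comp
      (tendsto_fejerMean v)
  refine h.congr fun N => ?_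
  rw [fejerMean_apply, map_smul, inner_smul_right, map_sum, inner_sum]

lemma inner_partialSum (M : ℕ) (u v : C(unitInterval, ℝ)) :
    inner ℝ (toL2 u) (toL2 (partialSum M v))
      = ∑ k ∈ Finset.range (M + 1), cosWeight k * (cosCoeff k u * cosCoeff k v) := by
  rw [partialSum_apply, map_sum, inner_sum]
  refine Finset.sum_congr rfl fun k _ => ?_
  rw [map_smul, inner_smul_right, real_inner_comm, ← cosCoeff_eq_inner]
  ring

/-- The restriction to `[0,1]` of a continuous function on `ℝ`. -/
def restrictUnit (φ : ℝ → ℝ) (hφ : Continuous φ) : C(unitInterval, ℝ) := ⟨fun x => φ x, by fun_prop⟩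

@[simp] lemma restrictUnit_apply (φ : ℝ → ℝ) (hφ : Continuous φ) (x : unitInterval) :
    restrictUnit φ hφ x = φ x := rfl

/-- Smooth functions satisfying the Neumann boundary conditions: the test functions of the weak
formulation. -/
structure IsNeumann (φ : ℝ → ℝ) : Prop where
  contDiff : ContDiff ℝ ∞ φ
  deriv_zero : deriv φ 0 = 0
  deriv_one : deriv φ 1 = 0

namespace IsNeumann

variable {φ ψ : ℝ → ℝ}

lemma continuous (h : IsNeumann φ) : Continuous φ := h.contDiff.continuous

lemma differentiable (h : IsNeumann φ) : Differentiable ℝ φ :=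
  h.contDiff.differentiable (by simp)

lemma contDiff_deriv (h : IsNeumann φ) : ContDiff ℝ ∞ (deriv φ) :=
  (contDiff_infty_iff_deriv.1 h.contDiff).2

lemma continuous_deriv2 (h : IsNeumann φ) : Continuous (deriv (deriv φ)) :=
  (contDiff_infty_iff_deriv.1 h.contDiff_deriv).2.continuous

lemma mul (h : IsNeumann φ) (h' : IsNeumann ψ) : IsNeumann fun x => φ x * ψ x := by
  have hd : ∀ x, deriv (fun x => φ x * ψ x) x = deriv φ x * ψ x + φ x * deriv ψ x := fun x =>
    deriv_fun_mul (h.differentiable x) (h'.differentiable x)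
  exact ⟨h.contDiff.mul h'.contDiff, by simp [hd, h.deriv_zero, h'.deriv_zero],
    by simp [hd, h.deriv_one, h'.deriv_one]⟩

lemma add (h : IsNeumann φ) (h' : IsNeumann ψ) : IsNeumann fun x => φ x + ψ x := by
  have hd : ∀ x, deriv (fun x => φ x + ψ x) x = deriv φ x + deriv ψ x := fun x =>
    deriv_fun_add (h.differentiable x) (h'.differentiable x)
  exact ⟨h.contDiff.add h'.contDiff, by simp [hd, h.deriv_zero, h'.deriv_zero],
    by simp [hd, h.deriv_one, h'.deriv_one]⟩

lemma const (c : ℝ) : IsNeumann fun _ => c := ⟨contDiff_const, by simp, by simp⟩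

lemma const_mul (h : IsNeumann φ) (c : ℝ) : IsNeumann fun x => c * φ x := (const c).mul h

lemma comp (h : IsNeumann φ) {S : ℝ → ℝ} (hS : ContDiff ℝ ∞ S) : IsNeumann fun x => S (φ x) := by
  have hd : ∀ x, deriv (fun x => S (φ x)) x = deriv S (φ x) * deriv φ x := fun x =>
    deriv_comp x (hS.differentiable (by simp) _) (h.differentiable x)
  exact ⟨hS.comp h.contDiff, by simp [hd, h.deriv_zero], by simp [hd, h.deriv_one]⟩

end IsNeumann

lemma isNeumann_cos (k : ℕ) : IsNeumann fun x => Real.cos (k * Real.pi * x) := by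
  have hd : ∀ x, deriv (fun x => Real.cos (k * Real.pi * x)) x
      = -Real.sin (k * Real.pi * x) * (k * Real.pi) := fun x => by
    have := (Real.hasDerivAt_cos (k * Real.pi * x)).comp x
      ((hasDerivAt_id x).const_mul (k * Real.pi))
    simpa [Function.comp_def] using this.deriv
  refine ⟨by fun_prop, by simp [hd], by simp [hd, Real.sin_nat_mul_pi]⟩

lemma deriv2_cos (k : ℕ) (x : ℝ) : deriv (deriv fun x => Real.cos (k * Real.pi * x)) x
    = -(Real.pi * k) ^ 2 * Real.cos (k * Real.pi * x) := by
  have hd : deriv (fun x => Real.cos (k * Real.pi * x))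
      = fun x => -(k * Real.pi) * Real.sin (k * Real.pi * x) := by
    funext x
    have := (Real.hasDerivAt_cos (k * Real.pi * x)).comp x
      ((hasDerivAt_id x).const_mul (k * Real.pi))
    have := this.deriv
    simp only [Function.comp_def] at this
    rw [this]; ring
  rw [hd]
  have := ((Real.hasDerivAt_sin (k * Real.pi * x)).comp x
      ((hasDerivAt_id x).const_mul (k * Real.pi))).const_mul (-(k * Real.pi))
  have := this.deriv
  simp only [Function.comp_def] at this
  rw [this]; ring

lemma cosCoeff_deriv2 {φ : ℝ → ℝ} (h : IsNeumann φ) (k : ℕ) :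
    cosCoeff k (restrictUnit _ h.continuous_deriv2)
      = -(Real.pi * k) ^ 2 * cosCoeff k (restrictUnit φ h.continuous) := by
  rw [cosCoeff_apply, cosCoeff_apply]
  simp only [restrictUnit_apply]
  rw [integral_unitInterval (fun x => deriv (deriv φ) x * Real.cos (k * Real.pi * x)),
    integral_unitInterval (fun x => φ x * Real.cos (k * Real.pi * x))]
  set c : ℝ := k * Real.pi with hc
  have hcos : ∀ x, HasDerivAt (fun x => Real.cos (c * x)) (-(c * Real.sin (c * x))) x := fun x => by
    have := (Real.hasDerivAt_cos (c * x)).comp x ((hasDerivAt_id x).const_mul c)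
    refine this.congr_deriv ?_
    ring
  have hsin : ∀ x, HasDerivAt (fun x => Real.sin (c * x)) (c * Real.cos (c * x)) x := fun x => by
    have := (Real.hasDerivAt_sin (c * x)).comp x ((hasDerivAt_id x).const_mul c)
    refine this.congr_deriv ?_
    ring
  have hφ : ∀ x, HasDerivAt φ (deriv φ x) x := fun x => (h.differentiable x).hasDerivAt
  have hφ' : ∀ x, HasDerivAt (deriv φ) (deriv (deriv φ) x) x := fun x =>
    (h.contDiff_deriv.differentiable (by simp) x).hasDerivAt
  have c1 := h.contDiff_deriv.continuous
  have c2 := h.continuous_deriv2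
  have c0 := h.continuous
  have e1 := intervalIntegral.integral_deriv_mul_eq_sub (a := 0) (b := 1)
    (fun x _ => hφ' x) (fun x _ => hcos x)
    (c2.intervalIntegrable _ _) (Continuous.intervalIntegrable (by fun_prop) _ _)
  have e2 := intervalIntegral.integral_deriv_mul_eq_sub (a := 0) (b := 1)
    (fun x _ => hφ x) (fun x _ => hsin x)
    (c1.intervalIntegrable _ _) (Continuous.intervalIntegrable (by fun_prop) _ _)
  have hs1 : Real.sin (c * 1) = 0 := by rw [mul_one, hc]; exact Real.sin_nat_mul_pi k
  rw [h.deriv_zero, h.deriv_one] at e1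
  rw [hs1] at e2
  rw [intervalIntegral.integral_add (Continuous.intervalIntegrable (by fun_prop) _ _)
    (Continuous.intervalIntegrable (by fun_prop) _ _)] at e1 e2
  have e3 : ∫ x in (0 : ℝ)..1, deriv φ x * -(c * Real.sin (c * x))
      = -c * ∫ x in (0 : ℝ)..1, deriv φ x * Real.sin (c * x) := by
    rw [← intervalIntegral.integral_const_mul]; congr 1; funext x; ring
  have e4 : ∫ x in (0 : ℝ)..1, φ x * (c * Real.cos (c * x))
      = c * ∫ x in (0 : ℝ)..1, φ x * Real.cos (c * x) := by
    rw [← intervalIntegral.integral_const_mul]; congr 1; funext x; ring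
  rw [e3] at e1
  rw [e4] at e2
  simp at e1 e2
  have : (Real.pi * k) ^ 2 = c ^ 2 := by rw [hc]; ring
  rw [this]
  linear_combination e1 + c * e2

/-- The effect on the Dirichlet energy of a perturbation by a test function. -/
lemma EnergyLE.add_test {u : C(unitInterval, ℝ)} {E : ℝ} (hu : EnergyLE u E) {φ : ℝ → ℝ}
    (h : IsNeumann φ) (ε : ℝ) :
    EnergyLE (u + ε • restrictUnit φ h.continuous)
      (E - ε * (∫ x : unitInterval, u x * deriv (deriv φ) x)
        - ε ^ 2 / 2 * ∫ x : unitInterval, φ x * deriv (deriv φ) x) := by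
  intro K
  set p := restrictUnit φ h.continuous with hp
  set q := restrictUnit _ h.continuous_deriv2 with hq
  -- Integration by parts in terms of the partial sums, which are finite sums of modes.
  have hcross : ∀ (M : ℕ) (v : C(unitInterval, ℝ)), inner ℝ (toL2 v) (toL2 (partialSum M q))
      = -2 * ∑ k ∈ Finset.range (M + 1), (Real.pi * k) ^ 2 * (cosCoeff k v * cosCoeff k p) := by
    intro M v
    rw [inner_partialSum, Finset.mul_sum]
    refine Finset.sum_congr rfl fun k _ => ?_
    rw [hq, cosCoeff_deriv2 h, ← hp]
    rcases Nat.eq_zero_or_pos k with rfl | hk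
    · simp
    · have : cosWeight k = 2 := by simp [cosWeight, hk.ne']
      rw [this]; ring
  have hM : ∀ M, partialEnergy M (u + ε • p) ≤ E - ε * inner ℝ (toL2 u) (toL2 (partialSum M q))
      - ε ^ 2 / 2 * inner ℝ (toL2 p) (toL2 (partialSum M q)) := by
    intro M
    have : partialEnergy M (u + ε • p) = partialEnergy M u
        - ε * inner ℝ (toL2 u) (toL2 (partialSum M q))
        - ε ^ 2 / 2 * inner ℝ (toL2 p) (toL2 (partialSum M q)) := by
      rw [hcross, hcross]
      unfold partialEnergy
      simp only [Finset.mul_sum]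
      rw [← Finset.sum_sub_distrib, ← Finset.sum_sub_distrib]
      refine Finset.sum_congr rfl fun k _ => ?_
      simp only [map_add, map_smul, smul_eq_mul]
      ring
    rw [this]
    linarith [hu M]
  -- The right-hand sides converge in the sense of Cesàro, the left-hand sides increase with `M`.
  have hlim : Tendsto (fun N : ℕ => (N : ℝ)⁻¹ * ∑ M ∈ Finset.range N,
      (E - ε * inner ℝ (toL2 u) (toL2 (partialSum M q))
      - ε ^ 2 / 2 * inner ℝ (toL2 p) (toL2 (partialSum M q)))) atTop
      (𝓝 (E - ε * inner ℝ (toL2 u) (toL2 q) - ε ^ 2 / 2 * inner ℝ (toL2 p) (toL2 q))) := by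
    have hc : Tendsto (fun N : ℕ => (N : ℝ)⁻¹ * ∑ M ∈ Finset.range N, E) atTop (𝓝 E) :=
      (tendsto_const_nhds (x := E)).cesaro
    refine ((hc.sub ((tendsto_cesaro_inner u q).const_mul ε)).sub
      ((tendsto_cesaro_inner p q).const_mul (ε ^ 2 / 2))).congr fun N => ?_
    rw [Finset.sum_sub_distrib, Finset.sum_sub_distrib, ← Finset.mul_sum, ← Finset.mul_sum]
    ring
  have := le_of_tendsto_cesaro (K := K) (c := partialEnergy K (u + ε • p))
    (fun M hKM => (partialEnergy_mono _ hKM).trans (hM M)) hlim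
  rwa [inner_toL2, inner_toL2] at this

/-- Functions of finite energy are Hölder continuous. -/
lemma exists_holder : ∃ D : ℝ, 0 ≤ D ∧ ∀ (u : C(unitInterval, ℝ)) (E : ℝ), EnergyLE u E →
    ∀ x y : unitInterval, |u x - u y| ≤ √(E * (D * √|(x : ℝ) - y|)) := by
  have hsum : Summable fun k : ℕ => √(k : ℝ) / (k : ℝ) ^ 2 := by
    have h := Real.summable_one_div_nat_rpow.2 (show (1 : ℝ) < 3 / 2 by norm_num)
    refine h.congr fun k => ?_
    rcases Nat.eq_zero_or_pos k with rfl | hk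
    · simp
    · have hk' : (0 : ℝ) < k := by exact_mod_cast hk
      rw [Real.sqrt_eq_rpow, ← Real.rpow_natCast, ← Real.rpow_sub hk', one_div,
        ← Real.rpow_neg hk'.le]
      norm_num
  set S := ∑' k : ℕ, √(k : ℝ) / (k : ℝ) ^ 2
  have hS : 0 ≤ S := tsum_nonneg fun k => by positivity
  refine ⟨16 * √Real.pi / Real.pi ^ 2 * S, by positivity, fun u E hu x y => ?_⟩
  set δ := |(x : ℝ) - y| with hδ
  have hδ0 : 0 ≤ δ := abs_nonneg _
  have hpi := Real.pi_pos
  -- The bound `|cos a - cos b|² ≤ 4 |a - b|^{1/2}` leaves a convergent series.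
  have hcos : ∀ k : ℕ, (cosMode k x - cosMode k y) ^ 2 ≤ 4 * (√k * (√Real.pi * √δ)) := by
    intro k
    have h1 : |cosMode k x - cosMode k y| ≤ k * (Real.pi * δ) := by
      have := Real.abs_cos_sub_cos_le (k * Real.pi * x) (k * Real.pi * y)
      rw [← mul_sub, abs_mul, abs_of_nonneg (by positivity : 0 ≤ (k : ℝ) * Real.pi)] at this
      rw [← mul_assoc]
      exact this
    have h2 : |cosMode k x - cosMode k y| ≤ 2 := by
      refine (abs_sub _ _).trans ?_
      have := Real.abs_cos_le_one (k * Real.pi * x)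
      have := Real.abs_cos_le_one (k * Real.pi * y)
      rw [cosMode_apply, cosMode_apply]; linarith
    rw [← Real.sqrt_mul hpi.le, ← Real.sqrt_mul (by positivity), ← sq_abs]
    set t := (k : ℝ) * (Real.pi * δ)
    have ht : 0 ≤ t := by positivity
    have hst := Real.sq_sqrt ht
    have hs0 := Real.sqrt_nonneg t
    have ha := abs_nonneg (cosMode k x - cosMode k y)
    rcases le_total 1 t with h | h
    · have : 1 ≤ √t := Real.one_le_sqrt.2 h
      nlinarith
    · have : √t ≤ 1 := Real.sqrt_le_one.2 h
      have h3 : |cosMode k x - cosMode k y| ^ 2 ≤ t ^ 2 := pow_le_pow_left₀ ha h1 2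
      nlinarith [mul_nonneg hs0 hs0]
  have hpart : ∀ M, |partialSum M u x - partialSum M u y|
      ≤ √(E * (16 * √Real.pi / Real.pi ^ 2 * S * √δ)) := by
    intro M
    apply Real.le_sqrt_of_sq_le
    rw [sq_abs]
    have h1 : partialSum M u x - partialSum M u y = ∑ k ∈ Finset.range (M + 1),
        (Real.pi * k * cosCoeff k u)
          * (cosWeight k * (cosMode k x - cosMode k y) / (Real.pi * k)) := by
      rw [partialSum_apply]
      simp only [ContinuousMap.sum_apply, ContinuousMap.smul_apply, smul_eq_mul]
      rw [← Finset.sum_sub_distrib]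
      refine Finset.sum_congr rfl fun k _ => ?_
      rcases Nat.eq_zero_or_pos k with rfl | hk
      · simp [cosMode_apply]
      · have hk' : (k : ℝ) ≠ 0 := by exact_mod_cast hk.ne'
        field_simp
    rw [h1]
    refine (Finset.sum_mul_sq_le_sq_mul_sq _ _ _).trans ?_
    refine mul_le_mul ?_ ?_ (Finset.sum_nonneg fun _ _ => by positivity) hu.nonneg
    · refine le_trans (le_of_eq ?_) (hu M)
      exact Finset.sum_congr rfl fun k _ => by ring
    · have h2 : ∀ k ∈ Finset.range (M + 1),
          (cosWeight k * (cosMode k x - cosMode k y) / (Real.pi * k)) ^ 2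
          ≤ 16 * √Real.pi / Real.pi ^ 2 * √δ * (√k / (k : ℝ) ^ 2) := by
        intro k _
        rcases Nat.eq_zero_or_pos k with rfl | hk
        · simp
        · have hk' : (0 : ℝ) < k := by exact_mod_cast hk
          have hw : cosWeight k = 2 := by simp [cosWeight, hk.ne']
          rw [hw, div_pow, mul_pow, mul_pow]
          have : 16 * √Real.pi / Real.pi ^ 2 * √δ * (√k / (k : ℝ) ^ 2)
            = (4 * (4 * (√k * (√Real.pi * √δ)))) / (Real.pi ^ 2 * (k : ℝ) ^ 2) := by
            field_simp
            ring
          rw [this]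
          gcongr
          · norm_num
          · exact hcos k
      refine (Finset.sum_le_sum h2).trans ?_
      rw [← Finset.mul_sum]
      have h3 : ∑ k ∈ Finset.range (M + 1), √(k : ℝ) / (k : ℝ) ^ 2 ≤ S :=
        hsum.sum_le_tsum _ fun k _ => by positivity
      calc _ ≤ 16 * √Real.pi / Real.pi ^ 2 * √δ * S := by gcongr
        _ = _ := by ring
  have hlim : Tendsto (fun N => |fejerMean N u x - fejerMean N u y|) atTop (𝓝 |u x - u y|) := by
    have h := tendsto_fejerMean u
    have hx : Tendsto (fun N => fejerMean N u x) atTop (𝓝 (u x)) :=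
      ((continuous_eval_const (F := C(unitInterval, ℝ)) x).tendsto u).comp h
    have hy : Tendsto (fun N => fejerMean N u y) atTop (𝓝 (u y)) :=
      ((continuous_eval_const (F := C(unitInterval, ℝ)) y).tendsto u).comp h
    exact (hx.sub hy).abs
  refine le_of_tendsto' hlim fun N => ?_
  rcases Nat.eq_zero_or_pos N with rfl | hN
  · simp [fejerMean_apply]
  have hN' : (0 : ℝ) < N := by exact_mod_cast hN
  rw [fejerMean_apply]
  simp only [ContinuousMap.sum_apply, ContinuousMap.smul_apply, smul_eq_mul]
  rw [← mul_sub, ← Finset.sum_sub_distrib, abs_mul, abs_of_pos (inv_pos.2 hN'),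
    inv_mul_le_iff₀ hN']
  refine (Finset.abs_sum_le_sum_abs _ _).trans ((Finset.sum_le_sum fun M _ => hpart M).trans ?_)
  simp

variable {K₁ K₂ : C(unitInterval, ℝ)}

lemma isClosed_wallSpace : IsClosed (wallSpace K₁ K₂) := by
  have : wallSpace K₁ K₂ = ⋂ x : unitInterval,
      {z : C(unitInterval, ℝ) | K₁ x ≤ z x} ∩ {z | z x ≤ K₂ x} := by
    ext z; simp [wallSpace]
  rw [this]
  refine isClosed_iInter fun x => ?_
  have := continuous_eval_const (F := C(unitInterval, ℝ)) x
  exact (isClosed_le continuous_const this).inter (isClosed_le this continuous_const)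

lemma isClosed_energyLE (E : ℝ) : IsClosed {u | EnergyLE u E} := by
  simp only [EnergyLE, ofPred_forall]
  exact isClosed_iInter fun M => isClosed_le (continuous_partialEnergy M) continuous_const

/-- Functions between the walls with bounded energy form a compact subset of `C([0,1])`. -/
lemma isCompact_energyLE (E : ℝ) : IsCompact {u | u ∈ wallSpace K₁ K₂ ∧ EnergyLE u E} := by
  obtain ⟨D, hD, hold⟩ := exists_holder
  have hclosed : IsClosed {u | u ∈ wallSpace K₁ K₂ ∧ EnergyLE u E} :=
    isClosed_wallSpace.inter (isClosed_energyLE E)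
  let e := (ContinuousMap.isometryEquivBoundedOfCompact unitInterval ℝ).toHomeomorph
  rw [← e.isCompact_image]
  refine BoundedContinuousFunction.arzela_ascoli₂ (Icc (-(‖K₁‖ + ‖K₂‖)) (‖K₁‖ + ‖K₂‖))
    isCompact_Icc _ (e.isClosedMap _ hclosed) ?_ ?_
  · rintro _ x ⟨u, ⟨hu, -⟩, rfl⟩
    have h1 := K₁.norm_coe_le_norm x
    have h2 := K₂.norm_coe_le_norm x
    rw [Real.norm_eq_abs, abs_le] at h1 h2
    have := hu x
    change u x ∈ _
    constructor <;> linarith [norm_nonneg K₁, norm_nonneg K₂]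
  · refine Metric.equicontinuous_of_continuity_modulus
      (fun d => √(E * (D * √d))) ?_ _ ?_
    · have : Continuous fun d : ℝ => √(E * (D * √d)) := by fun_prop
      simpa using this.tendsto 0
    · rintro x y ⟨_, u, ⟨-, hu⟩, rfl⟩
      exact hold u E hu x y

/-- On a compact set of continuous functions the `L²` distance controls the uniform distance. -/
lemma exists_norm_lt_of_toL2 {S : Set C(unitInterval, ℝ)} (hS : IsCompact S) {ε : ℝ}
    (hε : 0 < ε) :
    ∃ δ > 0, ∀ u ∈ S, ∀ v ∈ S, ‖toL2 (u - v)‖ < δ → ‖u - v‖ < ε := by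
  set A : Set (C(unitInterval, ℝ) × C(unitInterval, ℝ)) := (S ×ˢ S) ∩ {p | ε ≤ ‖p.1 - p.2‖}
  have hA : IsCompact A := (hS.prod hS).inter_right (isClosed_le (by fun_prop) (by fun_prop))
  rcases A.eq_empty_or_nonempty with h | h
  · refine ⟨1, one_pos, fun u hu v hv _ => ?_⟩
    by_contra hc
    have : (u, v) ∈ A := ⟨⟨hu, hv⟩, not_lt.1 hc⟩
    rw [h] at this; exact this
  · obtain ⟨⟨u₀, v₀⟩, hmem, hmin⟩ := hA.exists_isMinOn h
      (f := fun p => ‖toL2 (p.1 - p.2)‖) (by fun_prop)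
    refine ⟨‖toL2 (u₀ - v₀)‖, ?_, fun u hu v hv huv => ?_⟩
    · rw [gt_iff_lt, norm_pos_iff]
      intro h0
      have : u₀ - v₀ = 0 := toL2_injective (by rw [h0, map_zero])
      have h2 : ε ≤ ‖u₀ - v₀‖ := hmem.2
      rw [this, norm_zero] at h2
      linarith
    · by_contra hc
      have : ‖toL2 (u₀ - v₀)‖ ≤ ‖toL2 (u - v)‖ :=
        isMinOn_iff.1 hmin (u, v) ⟨⟨hu, hv⟩, not_lt.1 hc⟩
      linarith

/-! ### From the weak formulation to an evolution variational inequality -/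

/-- The space-time slab `(s,t] × [0,1]`. -/
def slab (s t : ℝ) : Set (ℝ × unitInterval) := Ioc s t ×ˢ univ

lemma measurableSet_slab (s t : ℝ) : MeasurableSet (slab s t) :=
  measurableSet_Ioc.prod MeasurableSet.univ

lemma measurableSet_strip (s t : ℝ) : MeasurableSet (strip s t) :=
  measurableSet_Icc.prod MeasurableSet.univ

lemma isCompact_strip (s t : ℝ) : IsCompact (strip s t) := isCompact_Icc.prod isCompact_univ

lemma slab_subset_strip {a b s t : ℝ} (hs : a ≤ s) (ht : t ≤ b) : slab s t ⊆ strip a b :=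
  fun _ hp => ⟨⟨hs.trans hp.1.1.le, hp.1.2.trans ht⟩, trivial⟩

lemma strip_subset_strip {a b s t : ℝ} (hs : a ≤ s) (ht : t ≤ b) : strip s t ⊆ strip a b :=
  fun _ hp => ⟨⟨hs.trans hp.1.1, hp.1.2.trans ht⟩, trivial⟩

lemma setIntegral_slab_add {ν : Measure (ℝ × unitInterval)} {q : ℝ × unitInterval → ℝ}
    {r s t : ℝ} (hrs : r ≤ s) (hst : s ≤ t) (hq : IntegrableOn q (slab r t) ν) :
    ∫ p in slab r t, q p ∂ν = (∫ p in slab r s, q p ∂ν) + ∫ p in slab s t, q p ∂ν := by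
  have h : slab r t = slab r s ∪ slab s t := by
    rw [slab, slab, slab, ← union_prod, Ioc_union_Ioc_eq_Ioc hrs hst]
  have hd : Disjoint (slab r s) (slab s t) := by
    rw [Set.disjoint_left]
    intro p hp hp'
    exact absurd hp.1.2 (not_le.2 hp'.1.1)
  rw [h] at hq ⊢
  exact setIntegral_union hd (measurableSet_slab s t) hq.left_of_union hq.right_of_union

lemma setIntegral_strip_add {ν : Measure (ℝ × unitInterval)} {q : ℝ × unitInterval → ℝ}
    {a s t : ℝ} (has : a ≤ s) (hst : s ≤ t) (hq : IntegrableOn q (strip a t) ν) :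
    ∫ p in strip a t, q p ∂ν = (∫ p in strip a s, q p ∂ν) + ∫ p in slab s t, q p ∂ν := by
  have h : strip a t = strip a s ∪ slab s t := by
    rw [slab, strip, strip, ← union_prod, Icc_union_Ioc_eq_Icc has hst]
  have hd : Disjoint (strip a s) (slab s t) := by
    rw [Set.disjoint_left]
    intro p hp hp'
    exact absurd hp.1.2 (not_le.2 hp'.1.1)
  rw [h] at hq ⊢
  exact setIntegral_union hd (measurableSet_slab s t) hq.left_of_union hq.right_of_union

lemma continuousOn_eval {a b : ℝ} {v : ℝ → C(unitInterval, ℝ)} (hv : ContinuousOn v (Icc a b)) :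
    ContinuousOn (fun p : ℝ × unitInterval => v p.1 p.2) (strip a b) :=
  (hv.comp continuousOn_fst fun _ hp => hp.1).eval continuousOn_snd

lemma integrableOn_strip_of_continuousOn {ν : Measure (ℝ × unitInterval)}
    {q : ℝ × unitInterval → ℝ} {a b : ℝ} (hν : ν (strip a b) < ⊤)
    (hq : ContinuousOn q (strip a b)) : IntegrableOn q (strip a b) ν := by
  have h1 : IntegrableOn (fun _ => (1 : ℝ)) (strip a b) ν := integrableOn_const hν.ne
  simpa using h1.mul_continuousOn hq (isCompact_strip a b)

lemma volume_strip_lt_top (a b : ℝ) :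
    (volume : Measure (ℝ × unitInterval)) (strip a b) < ⊤ :=
  (isCompact_strip a b).measure_lt_top

/-- A function that does not increase over short intervals does not increase. -/
lemma le_of_locally_le {α : ℝ → ℝ} {a b ρ : ℝ} (hρ : 0 < ρ)
    (h : ∀ s t, a ≤ s → s ≤ t → t ≤ b → t - s < ρ → α t ≤ α s) {s t : ℝ} (has : a ≤ s)
    (hst : s ≤ t) (htb : t ≤ b) : α t ≤ α s := by
  obtain ⟨n, hn⟩ := exists_nat_gt ((t - s) / ρ)
  have hn0 : (0 : ℝ) < n := lt_of_le_of_lt (div_nonneg (by linarith) hρ.le) hn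
  have hstep : (t - s) / n < ρ := by
    rw [div_lt_iff₀ hρ] at hn
    rw [div_lt_iff₀ hn0]; linarith
  have hpos : 0 ≤ (t - s) / n := div_nonneg (by linarith) hn0.le
  have key : ∀ i : ℕ, i ≤ n → α (s + i * ((t - s) / n)) ≤ α s := by
    intro i
    induction i with
    | zero => simp
    | succ i ih =>
      intro hi
      refine (h (s + i * ((t - s) / n)) _ ?_ ?_ ?_ ?_).trans (ih (by omega))
      · have : 0 ≤ i * ((t - s) / n) := by positivity
        linarith
      · push_cast; linarith
      · have h1 : ((i + 1 : ℕ) : ℝ) * ((t - s) / n) ≤ n * ((t - s) / n) :=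
          mul_le_mul_of_nonneg_right (by exact_mod_cast hi) hpos
        have h2 : (n : ℝ) * ((t - s) / n) = t - s := by field_simp
        linarith
      · push_cast; linarith
  have := key n le_rfl
  rwa [show s + n * ((t - s) / n) = t by field_simp; ring] at this

/-- The chain rule for the square of a continuous function whose increments are integrals over
slabs. -/
lemma half_sq_sub_le {ι : Type*} [Fintype ι] {ν : ι → Measure (ℝ × unitInterval)}
    {q : ι → ℝ × unitInterval → ℝ} {y : ℝ → ℝ} {a b : ℝ} (hy : ContinuousOn y (Icc a b))
    (hq : ∀ i, IntegrableOn (q i) (strip a b) (ν i))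
    (hinc : ∀ s t, a ≤ s → s ≤ t → t ≤ b → y t - y s = ∑ i, ∫ p in slab s t, q i p ∂(ν i))
    {s t : ℝ} (has : a ≤ s) (hst : s ≤ t) (htb : t ≤ b) :
    y t ^ 2 / 2 - y s ^ 2 / 2 ≤ ∑ i, ∫ p in slab s t, y p.1 * q i p ∂(ν i) := by
  have hyc : ContinuousOn (fun p : ℝ × unitInterval => y p.1) (strip a b) :=
    hy.comp continuousOn_fst fun _ hp => hp.1
  have hyq : ∀ i, IntegrableOn (fun p => y p.1 * q i p) (strip a b) (ν i) := fun i =>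
    (hq i).continuousOn_mul hyc (isCompact_strip a b)
  have habs : ∀ i, IntegrableOn (fun p => |q i p|) (strip a b) (ν i) := fun i => (hq i).abs
  set C := ∑ i, ∫ p in slab s t, |q i p| ∂(ν i)
  have key : ∀ ε > 0, y t ^ 2 / 2 - y s ^ 2 / 2
      ≤ (∑ i, ∫ p in slab s t, y p.1 * q i p ∂(ν i)) + ε * C := by
    intro ε hε
    obtain ⟨ρ, hρ, hosc⟩ := Metric.uniformContinuousOn_iff.1
      (isCompact_Icc.uniformContinuousOn_of_continuous hy) ε hε
    let α : ℝ → ℝ := fun t => y t ^ 2 / 2 - (∑ i, ∫ p in slab a t, y p.1 * q i p ∂(ν i))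
      - ε * ∑ i, ∫ p in slab a t, |q i p| ∂(ν i)
    have hα : ∀ s t, a ≤ s → s ≤ t → t ≤ b → α t - α s = y t ^ 2 / 2 - y s ^ 2 / 2
        - (∑ i, ∫ p in slab s t, y p.1 * q i p ∂(ν i))
        - ε * ∑ i, ∫ p in slab s t, |q i p| ∂(ν i) := by
      intro s t has hst htb
      have h1 : ∀ i, ∫ p in slab a t, y p.1 * q i p ∂(ν i)
          = (∫ p in slab a s, y p.1 * q i p ∂(ν i)) + ∫ p in slab s t, y p.1 * q i p ∂(ν i) :=
        fun i => setIntegral_slab_add has hst ((hyq i).mono_set (slab_subset_strip le_rfl htb))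
      have h2 : ∀ i, ∫ p in slab a t, |q i p| ∂(ν i)
          = (∫ p in slab a s, |q i p| ∂(ν i)) + ∫ p in slab s t, |q i p| ∂(ν i) :=
        fun i => setIntegral_slab_add has hst ((habs i).mono_set (slab_subset_strip le_rfl htb))
      simp only [α]
      simp_rw [h1, h2, Finset.sum_add_distrib]
      ring
    have hloc : ∀ s t, a ≤ s → s ≤ t → t ≤ b → t - s < ρ → α t ≤ α s := by
      intro s t has hst htb hts
      have h1 := hα s t has hst htb
      -- On a short interval `y t` in front of the increment may be replaced by the integrand `y`,
      -- at the price of the oscillation `ε` of `y` times the total variation.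
      have h2 : y t ^ 2 / 2 - y s ^ 2 / 2 ≤ y t * (y t - y s) := by
        nlinarith [sq_nonneg (y t - y s)]
      rw [hinc s t has hst htb] at h2
      have h3 : ∀ i, y t * ∫ p in slab s t, q i p ∂(ν i)
          ≤ (∫ p in slab s t, y p.1 * q i p ∂(ν i)) + ε * ∫ p in slab s t, |q i p| ∂(ν i) := by
        intro i
        have hsub := slab_subset_strip has htb
        rw [← integral_const_mul, ← integral_const_mul,
          ← integral_add ((hyq i).mono_set hsub) (((habs i).mono_set hsub).const_mul ε)]
        refine setIntegral_mono_on (((hq i).mono_set hsub).const_mul _)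
          (((hyq i).mono_set hsub).add (((habs i).mono_set hsub).const_mul ε))
          (measurableSet_slab s t) fun p hp => ?_
        have h4 : |y t - y p.1| < ε := by
          have := hosc t ⟨has.trans hst, htb⟩ p.1 ⟨has.trans hp.1.1.le, hp.1.2.trans htb⟩ (by
            rw [Real.dist_eq, abs_of_nonneg (by linarith [hp.1.2])]
            linarith [hp.1.1])
          rwa [Real.dist_eq] at this
        have h5 : (y t - y p.1) * q i p ≤ ε * |q i p| := by
          refine (le_abs_self _).trans ?_
          rw [abs_mul]
          exact mul_le_mul_of_nonneg_right h4.le (abs_nonneg _)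
        linarith
      have h6 := Finset.sum_le_sum fun i (_ : i ∈ Finset.univ) => h3 i
      rw [Finset.sum_add_distrib, ← Finset.mul_sum, ← Finset.mul_sum] at h6
      linarith
    have := le_of_locally_le hρ hloc has hst htb
    have := hα s t has hst htb
    linarith
  refine le_of_forall_pos_le_add fun δ hδ => ?_
  have hC : 0 ≤ C := Finset.sum_nonneg fun i _ => integral_nonneg fun p => abs_nonneg _
  have := key (δ / (C + 1)) (by positivity)
  have h2 : δ / (C + 1) * C ≤ δ := by
    rw [div_mul_eq_mul_div, div_le_iff₀ (by positivity)]; nlinarith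
  linarith

/-- Evolution variational inequality: the path `v` in `E` is the gradient flow of the Dirichlet
energy constrained by the walls, with forcing `g`. The time integral of the energy is bounded
through the energies of all the partial sums, which keeps the integrand continuous. -/
structure IsEVI (K₁ K₂ : C(unitInterval, ℝ)) (a b : ℝ) (v : ℝ → C(unitInterval, ℝ))
    (g : ℝ × unitInterval → ℝ) : Prop where
  continuousOn : ContinuousOn v (Icc a b)
  mem_wallSpace : ∀ t ∈ Icc a b, v t ∈ wallSpace K₁ K₂
  memLp : MemLp g 2 (volume.restrict (strip a b))
  evi : ∀ x ∈ wallSpace K₁ K₂, ∀ E, EnergyLE x E → ∀ s t, a ≤ s → s ≤ t → t ≤ b → ∀ K,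
    ‖toL2 (v t - x)‖ ^ 2 / 2 - ‖toL2 (v s - x)‖ ^ 2 / 2 + ∫ r in s..t, partialEnergy K (v r)
      ≤ (t - s) * E + ∫ p in slab s t, g p * (v p.1 p.2 - x p.2)

lemma MemLp.integrableOn_strip {g : ℝ × unitInterval → ℝ} {a b : ℝ}
    (hg : MemLp g 2 (volume.restrict (strip a b))) : IntegrableOn g (strip a b) := by
  have : IsFiniteMeasure ((volume : Measure (ℝ × unitInterval)).restrict (strip a b)) :=
    ⟨by simpa using volume_strip_lt_top a b⟩
  exact hg.integrable one_le_two

section Cesaro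

variable {ν : Measure (ℝ × unitInterval)} {q : ℝ × unitInterval → ℝ} {a b s t : ℝ}
  {v : ℝ → C(unitInterval, ℝ)}

lemma integrableOn_mul_eval (hq : IntegrableOn q (strip a b) ν) (hv : ContinuousOn v (Icc a b))
    (hs : a ≤ s) (ht : t ≤ b) : IntegrableOn (fun p => q p * v p.1 p.2) (slab s t) ν :=
  (hq.mul_continuousOn (continuousOn_eval hv) (isCompact_strip a b)).mono_set
    (slab_subset_strip hs ht)

/-- Uniform convergence of the Fejér means, integrated against an arbitrary measure. -/
lemma tendsto_cesaro_integral (hq : IntegrableOn q (strip a b) ν) (hv : ContinuousOn v (Icc a b))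
    (hs : a ≤ s) (ht : t ≤ b) :
    Tendsto (fun N : ℕ => (N : ℝ)⁻¹ * ∑ M ∈ Finset.range N,
      ∫ p in slab s t, q p * partialSum M (v p.1) p.2 ∂ν) atTop
      (𝓝 (∫ p in slab s t, q p * v p.1 p.2 ∂ν)) := by
  have hvM : ∀ M, ContinuousOn (fun r => partialSum M (v r)) (Icc a b) := fun M =>
    (partialSum M).continuous.comp_continuousOn hv
  have hvN : ∀ N, ContinuousOn (fun r => fejerMean N (v r)) (Icc a b) := fun N =>
    (fejerMean N).continuous.comp_continuousOn hv
  have h1 : ∀ N : ℕ, (N : ℝ)⁻¹ * ∑ M ∈ Finset.range N,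
      ∫ p in slab s t, q p * partialSum M (v p.1) p.2 ∂ν
      = ∫ p in slab s t, q p * fejerMean N (v p.1) p.2 ∂ν := by
    intro N
    rw [← integral_finsetSum _ fun M _ => integrableOn_mul_eval hq (hvM M) hs ht,
      ← integral_const_mul]
    congr 1
    funext p
    simp only [fejerMean_apply, ContinuousMap.smul_apply, ContinuousMap.sum_apply, smul_eq_mul,
      Finset.mul_sum]
    exact Finset.sum_congr rfl fun M _ => by ring
  simp_rw [h1]
  obtain ⟨C, hC⟩ := isCompact_Icc.exists_bound_of_continuousOn hv
  refine tendsto_integral_of_dominated_convergence (fun p => |q p| * C)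
    (fun N => (integrableOn_mul_eval hq (hvN N) hs ht).aestronglyMeasurable)
    ((hq.mono_set (slab_subset_strip hs ht)).abs.mul_const C) (fun N => ?_) ?_
  · refine (ae_restrict_mem (measurableSet_slab s t)).mono fun p hp => ?_
    rw [norm_mul, Real.norm_eq_abs]
    refine mul_le_mul_of_nonneg_left ?_ (abs_nonneg _)
    exact ((ContinuousMap.norm_coe_le_norm _ _).trans (norm_fejerMean_le _ _)).trans
      (hC _ ⟨hs.trans hp.1.1.le, hp.1.2.trans ht⟩)
  · refine Eventually.of_forall fun p => Tendsto.const_mul _ ?_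
    exact ((continuous_eval_const (F := C(unitInterval, ℝ)) p.2).tendsto _).comp
      (tendsto_fejerMean (v p.1))

end Cesaro

lemma setIntegral_slab_eq {q : ℝ × unitInterval → ℝ} {s t : ℝ} (hst : s ≤ t)
    (hq : IntegrableOn q (slab s t)) :
    ∫ p in slab s t, q p = ∫ r in s..t, ∫ x : unitInterval, q (r, x) := by
  rw [slab, Measure.volume_eq_prod] at *
  rw [setIntegral_prod _ hq, intervalIntegral.integral_of_le hst]
  simp

/-- The abstract form of the passage from the weak formulation to the variational inequality. -/
theorem isEVI_of_increments {K₁ K₂ : C(unitInterval, ℝ)} {a b : ℝ} {v : ℝ → C(unitInterval, ℝ)}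
    {g : ℝ × unitInterval → ℝ} {η ξ : Measure (ℝ × unitInterval)}
    (hv : ContinuousOn v (Icc a b)) (hwall : ∀ t ∈ Icc a b, v t ∈ wallSpace K₁ K₂)
    (hg : MemLp g 2 (volume.restrict (strip a b)))
    (hη : η (strip a b) < ⊤) (hξ : ξ (strip a b) < ⊤)
    (hinc : ∀ s t, a ≤ s → s ≤ t → t ≤ b → ∀ φ, IsNeumann φ →
      (∫ x : unitInterval, v t x * φ x) - (∫ x : unitInterval, v s x * φ x)
        = (∫ p in slab s t, (v p.1 p.2 * deriv (deriv φ) p.2 + g p * φ p.2))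
          + (∫ p in slab s t, φ p.2 ∂η) - ∫ p in slab s t, φ p.2 ∂ξ)
    (hηs : ∫ p in strip a b, (v p.1 p.2 - K₁ p.2) ∂η = 0)
    (hξs : ∫ p in strip a b, (K₂ p.2 - v p.1 p.2) ∂ξ = 0) : IsEVI K₁ K₂ a b v g := by
  refine ⟨hv, hwall, hg, fun x hx E hE s t has hst htb K => ?_⟩
  have hg1 := MemLp.integrableOn_strip hg
  have h1vol : IntegrableOn (fun _ => (1 : ℝ)) (strip a b)
    (volume : Measure (ℝ × unitInterval)) := integrableOn_const (volume_strip_lt_top a b).ne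
  have h1η : IntegrableOn (fun _ => (1 : ℝ)) (strip a b) η := integrableOn_const hη.ne
  have h1ξ : IntegrableOn (fun _ => (1 : ℝ)) (strip a b) ξ := integrableOn_const hξ.ne
  have hvx : ContinuousOn (fun r => v r - x) (Icc a b) := hv.sub continuousOn_const
  have hvk : ∀ k, ContinuousOn (fun r => cosCoeff k (v r)) (Icc a b) := fun k =>
    (cosCoeff k).continuous.comp_continuousOn hv
  have hyk : ∀ k, ContinuousOn (fun r => cosCoeff k (v r - x)) (Icc a b) := fun k =>
    (cosCoeff k).continuous.comp_continuousOn hvx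
  have hst' : Icc s t ⊆ Icc a b := Icc_subset_Icc has htb
  have hint : ∀ M, IntervalIntegrable (fun r => partialEnergy M (v r)) volume s t := fun M =>
    ContinuousOn.intervalIntegrable (by
      rw [uIcc_of_le hst]
      exact ((continuous_partialEnergy M).comp_continuousOn hv).mono hst')
  -- The inequality for the square of a single cosine coefficient.
  have hmode : ∀ k : ℕ, cosCoeff k (v t - x) ^ 2 / 2 - cosCoeff k (v s - x) ^ 2 / 2
      ≤ -(Real.pi * k) ^ 2 * (∫ r in s..t, cosCoeff k (v r - x) * cosCoeff k (v r))
        + (∫ p in slab s t, g p * (cosCoeff k (v p.1 - x) * cosMode k p.2))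
        + (∫ p in slab s t, 1 * (cosCoeff k (v p.1 - x) * cosMode k p.2) ∂η)
        - ∫ p in slab s t, 1 * (cosCoeff k (v p.1 - x) * cosMode k p.2) ∂ξ := by
    intro k
    have hcm : ContinuousOn (fun p : ℝ × unitInterval => cosMode k p.2) (strip a b) := by fun_prop
    have hvc : ContinuousOn (fun p : ℝ × unitInterval => v p.1 p.2 * cosMode k p.2)
      (strip a b) := (continuousOn_eval hv).mul hcm
    let ν : Fin 4 → Measure (ℝ × unitInterval) := ![volume, volume, η, ξ]
    let q : Fin 4 → ℝ × unitInterval → ℝ := ![fun p => -(Real.pi * k) ^ 2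
      * (v p.1 p.2 * cosMode k p.2), fun p => g p * cosMode k p.2, fun p => cosMode k p.2,
      fun p => -cosMode k p.2]
    have hq : ∀ i, IntegrableOn (q i) (strip a b) (ν i) := by
      intro i
      fin_cases i
      · exact (integrableOn_strip_of_continuousOn (volume_strip_lt_top a b) hvc).const_mul _
      · exact hg1.mul_continuousOn hcm (isCompact_strip a b)
      · exact integrableOn_strip_of_continuousOn hη hcm
      · exact (integrableOn_strip_of_continuousOn hξ hcm).neg
    have hinc' : ∀ s t, a ≤ s → s ≤ t → t ≤ b → cosCoeff k (v t - x) - cosCoeff k (v s - x)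
        = ∑ i, ∫ p in slab s t, q i p ∂(ν i) := by
      intro s t has hst htb
      have hsub := slab_subset_strip has htb
      have h1 := hinc s t has hst htb _ (isNeumann_cos k)
      rw [← cosCoeff_apply, ← cosCoeff_apply] at h1
      rw [map_sub, map_sub, sub_sub_sub_cancel_right, h1]
      have h2 : ∫ p in slab s t, (v p.1 p.2 * deriv (deriv fun x => Real.cos (k * Real.pi * x)) p.2
          + g p * Real.cos (k * Real.pi * p.2))
          = (∫ p in slab s t, q 0 p ∂(ν 0)) + ∫ p in slab s t, q 1 p ∂(ν 1) := by
        refine Eq.trans ?_ (integral_add ((hq 0).mono_set hsub) ((hq 1).mono_set hsub))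
        congr 1
        funext p
        simp only [q, deriv2_cos]
        simp [cosMode_apply]
        ring
      rw [h2]
      simp only [Fin.sum_univ_four]
      have h3 : ∫ p in slab s t, q 3 p ∂(ν 3) = -∫ p in slab s t, cosMode k p.2 ∂ξ :=
        integral_neg _
      rw [h3]
      rfl
    have h := half_sq_sub_le (hyk k) hq hinc' has hst htb
    refine h.trans (le_of_eq ?_)
    simp only [Fin.sum_univ_four]
    have e0 : ∫ p in slab s t, cosCoeff k (v p.1 - x) * q 0 p ∂(ν 0)
        = -(Real.pi * k) ^ 2 * (∫ r in s..t, cosCoeff k (v r - x) * cosCoeff k (v r)) := by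
      have hi : IntegrableOn (fun p : ℝ × unitInterval =>
          cosCoeff k (v p.1 - x) * (v p.1 p.2 * cosMode k p.2)) (slab s t) := by
        refine IntegrableOn.mono_set (integrableOn_strip_of_continuousOn
          (volume_strip_lt_top a b) ?_) (slab_subset_strip has htb)
        exact ContinuousOn.mul ((hyk k).comp continuousOn_fst fun _ hp => hp.1) hvc
      have : ∀ p, cosCoeff k (v p.1 - x) * q 0 p
        = -(Real.pi * k) ^ 2 * (cosCoeff k (v p.1 - x) * (v p.1 p.2 * cosMode k p.2)) := by
        intro p; simp only [q]; simp; ring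
      simp_rw [this]
      rw [integral_const_mul]
      congr 1
      change ∫ p in slab s t, _ = _
      rw [setIntegral_slab_eq hst hi]
      simp only [integral_const_mul]
      congr 1
      funext r
      rw [cosCoeff_apply k (v r)]
      rfl
    have e3 : ∫ p in slab s t, cosCoeff k (v p.1 - x) * q 3 p ∂(ν 3)
        = -∫ p in slab s t, 1 * (cosCoeff k (v p.1 - x) * cosMode k p.2) ∂ξ := by
      rw [← integral_neg]
      congr 1
      funext p
      simp [q]
    rw [e0, e3]
    have e1 : ∫ p in slab s t, cosCoeff k (v p.1 - x) * q 1 p ∂(ν 1)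
        = ∫ p in slab s t, g p * (cosCoeff k (v p.1 - x) * cosMode k p.2) := by
      congr 1
      funext p
      simp [q]; ring
    have e2 : ∫ p in slab s t, cosCoeff k (v p.1 - x) * q 2 p ∂(ν 2)
        = ∫ p in slab s t, 1 * (cosCoeff k (v p.1 - x) * cosMode k p.2) ∂η := by
      congr 1
      funext p
      simp [q]
    rw [e1, e2]
    ring
  -- The inequality for the partial sums.
  have hsum : ∀ M, inner ℝ (toL2 (v t - x)) (toL2 (partialSum M (v t - x))) / 2
      - inner ℝ (toL2 (v s - x)) (toL2 (partialSum M (v s - x))) / 2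
      ≤ ((t - s) * E - ∫ r in s..t, partialEnergy M (v r))
        + (∫ p in slab s t, g p * partialSum M (v p.1 - x) p.2)
        + (∫ p in slab s t, 1 * partialSum M (v p.1 - x) p.2 ∂η)
        - ∫ p in slab s t, 1 * partialSum M (v p.1 - x) p.2 ∂ξ := by
    intro M
    have hpart : ∀ {ν : Measure (ℝ × unitInterval)} {q : ℝ × unitInterval → ℝ},
        IntegrableOn q (strip a b) ν → ∫ p in slab s t, q p * partialSum M (v p.1 - x) p.2 ∂ν
        = ∑ k ∈ Finset.range (M + 1), cosWeight k *
          ∫ p in slab s t, q p * (cosCoeff k (v p.1 - x) * cosMode k p.2) ∂ν := by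
      intro ν q hq
      simp_rw [← integral_const_mul]
      rw [← integral_finsetSum]
      · congr 1
        funext p
        simp only [partialSum_apply, ContinuousMap.smul_apply, ContinuousMap.sum_apply,
          smul_eq_mul, Finset.mul_sum]
        exact Finset.sum_congr rfl fun k _ => by ring
      · intro k _
        refine Integrable.const_mul ?_ _
        exact integrableOn_mul_eval (v := fun r => cosCoeff k (v r - x) • cosMode k) hq
          ((hyk k).smul continuousOn_const) has htb
    have hen : ∑ k ∈ Finset.range (M + 1), cosWeight k * (-(Real.pi * k) ^ 2
        * (∫ r in s..t, cosCoeff k (v r - x) * cosCoeff k (v r)))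
        ≤ (t - s) * E - ∫ r in s..t, partialEnergy M (v r) := by
      have h1 : (t - s) * E - ∫ r in s..t, partialEnergy M (v r)
          = ∫ r in s..t, (E - partialEnergy M (v r)) := by
        rw [intervalIntegral.integral_sub (by simp) (hint M)]; simp
      have hcc : ∀ k, IntervalIntegrable (fun r => cosCoeff k (v r - x) * cosCoeff k (v r))
          volume s t := fun k => ContinuousOn.intervalIntegrable (by
        rw [uIcc_of_le hst]
        exact ((hyk k).mul (hvk k)).mono hst')
      rw [h1]
      simp_rw [← intervalIntegral.integral_const_mul]
      rw [← intervalIntegral.integral_finsetSum]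
      · refine intervalIntegral.integral_mono_on hst ?_ ?_ fun r hr => ?_
        · simpa only [Finset.sum_apply, Finset.sum_fn] using
            IntervalIntegrable.sum (Finset.range (M + 1)) fun k _ =>
              ((hcc k).const_mul _).const_mul _
        · exact (intervalIntegrable_const).sub (hint M)
        · have h2 : ∑ k ∈ Finset.range (M + 1), cosWeight k * (-(Real.pi * k) ^ 2
              * (cosCoeff k (v r - x) * cosCoeff k (v r)))
              ≤ partialEnergy M x - partialEnergy M (v r) := by
            unfold partialEnergy
            rw [← Finset.sum_sub_distrib]
            refine Finset.sum_le_sum fun k _ => ?_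
            rcases Nat.eq_zero_or_pos k with rfl | hk
            · simp
            · have hw : cosWeight k = 2 := by simp [cosWeight, hk.ne']
              rw [hw, map_sub]
              nlinarith [mul_nonneg (sq_nonneg (Real.pi * k))
                (sq_nonneg (cosCoeff k (v r) - cosCoeff k x))]
          linarith [hE M]
      · exact fun k _ => ((hcc k).const_mul _).const_mul _
    rw [inner_partialSum, inner_partialSum, hpart hg1, hpart h1η, hpart h1ξ]
    have h3 := Finset.sum_le_sum fun k (_ : k ∈ Finset.range (M + 1)) =>
      mul_le_mul_of_nonneg_left (hmode k) (cosWeight_pos k).le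
    simp only [mul_add, mul_sub, Finset.sum_add_distrib, Finset.sum_sub_distrib] at h3
    have h4 : ∀ r, (∑ k ∈ Finset.range (M + 1), cosWeight k * (cosCoeff k (v r - x)
        * cosCoeff k (v r - x))) / 2
        = ∑ k ∈ Finset.range (M + 1), cosWeight k * (cosCoeff k (v r - x) ^ 2 / 2) := by
      intro r
      rw [Finset.sum_div]
      exact Finset.sum_congr rfl fun k _ => by ring
    rw [h4, h4]
    linarith
  -- The partial sums themselves need not converge uniformly, as the measures require; their
  -- Cesàro means, which are Fejér means, do.
  have hKM : ∀ M, K ≤ M → (∫ r in s..t, partialEnergy K (v r))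
      ≤ (t - s) * E + (∫ p in slab s t, g p * partialSum M (v p.1 - x) p.2)
        + (∫ p in slab s t, 1 * partialSum M (v p.1 - x) p.2 ∂η)
        - (∫ p in slab s t, 1 * partialSum M (v p.1 - x) p.2 ∂ξ)
        - (1 / 2) * inner ℝ (toL2 (v t - x)) (toL2 (partialSum M (v t - x)))
        + (1 / 2) * inner ℝ (toL2 (v s - x)) (toL2 (partialSum M (v s - x))) := by
    intro M hM
    have h1 : (∫ r in s..t, partialEnergy K (v r)) ≤ ∫ r in s..t, partialEnergy M (v r) :=
      intervalIntegral.integral_mono_on hst (hint K) (hint M) fun r _ => partialEnergy_mono _ hM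
    linarith [hsum M]
  have hlim := ((((((tendsto_const_nhds (x := (t - s) * E)).cesaro).add
    (tendsto_cesaro_integral hg1 hvx has htb)).add
    (tendsto_cesaro_integral h1η hvx has htb)).sub
    (tendsto_cesaro_integral h1ξ hvx has htb)).sub
    ((tendsto_cesaro_inner (v t - x) (v t - x)).const_mul (1 / 2))).add
    ((tendsto_cesaro_inner (v s - x) (v s - x)).const_mul (1 / 2))
  have hfin := le_of_tendsto_cesaro hKM (hlim.congr fun N => by
    simp only [Finset.sum_add_distrib, Finset.sum_sub_distrib, ← Finset.mul_sum]
    ring)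
  rw [real_inner_self_eq_norm_sq, real_inner_self_eq_norm_sq] at hfin
  -- The reflection measures only act where they do not increase the distance to `x`.
  have hsub := slab_subset_strip has htb
  have hηle : ∫ p in slab s t, 1 * (v p.1 - x) p.2 ∂η ≤ 0 := by
    have hc := (continuousOn_eval hv).sub
      (show ContinuousOn (fun p : ℝ × unitInterval => K₁ p.2) (strip a b) by fun_prop)
    have h0 := (setIntegral_eq_zero_iff_of_nonneg_ae (μ := η) ((ae_restrict_mem
      (measurableSet_strip a b)).mono fun p hp => sub_nonneg.2 (hwall p.1 hp.1 p.2).1)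
      (integrableOn_strip_of_continuousOn hη hc)).1 hηs
    refine integral_nonpos_of_ae ?_
    filter_upwards [ae_restrict_of_ae_restrict_of_subset hsub h0] with p hp
    have h1 := (hx p.2).1
    have h2 : v p.1 p.2 - K₁ p.2 = 0 := hp
    simp only [ContinuousMap.sub_apply, Pi.zero_apply, one_mul]
    linarith
  have hξle : 0 ≤ ∫ p in slab s t, 1 * (v p.1 - x) p.2 ∂ξ := by
    have hc := (show ContinuousOn (fun p : ℝ × unitInterval => K₂ p.2) (strip a b) by
      fun_prop).sub (continuousOn_eval hv)
    have h0 := (setIntegral_eq_zero_iff_of_nonneg_ae (μ := ξ) ((ae_restrict_mem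
      (measurableSet_strip a b)).mono fun p hp => sub_nonneg.2 (hwall p.1 hp.1 p.2).2)
      (integrableOn_strip_of_continuousOn hξ hc)).1 hξs
    refine integral_nonneg_of_ae ?_
    filter_upwards [ae_restrict_of_ae_restrict_of_subset hsub h0] with p hp
    have h1 := (hx p.2).2
    have h2 : K₂ p.2 - v p.1 p.2 = 0 := hp
    simp only [ContinuousMap.sub_apply, Pi.zero_apply, one_mul]
    linarith
  have hgc : ∫ p in slab s t, g p * (v p.1 - x) p.2
    = ∫ p in slab s t, g p * (v p.1 p.2 - x p.2) := rfl
  linarith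

/-! ### The energy along a path -/

/-- The Dirichlet energy `½ ∫ |u'|²`; the value is `0` when the energy is infinite. -/
def energy (u : C(unitInterval, ℝ)) : ℝ := (⨆ M, ENNReal.ofReal (partialEnergy M u)).toReal

lemma energy_nonneg (u : C(unitInterval, ℝ)) : 0 ≤ energy u := ENNReal.toReal_nonneg

lemma EnergyLE.energy_le {u : C(unitInterval, ℝ)} {E : ℝ} (h : EnergyLE u E) : energy u ≤ E :=
  ENNReal.toReal_le_of_le_ofReal h.nonneg (iSup_le fun M => ENNReal.ofReal_le_ofReal (h M))

lemma energyLE_energy_of_ne_top {u : C(unitInterval, ℝ)}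
    (h : (⨆ M, ENNReal.ofReal (partialEnergy M u)) ≠ ⊤) : EnergyLE u (energy u) := by
  intro M
  have := ENNReal.toReal_mono h (le_iSup (fun M => ENNReal.ofReal (partialEnergy M u)) M)
  rwa [ENNReal.toReal_ofReal (partialEnergy_nonneg M u)] at this

lemma EnergyLE.energyLE_energy {u : C(unitInterval, ℝ)} {E : ℝ} (h : EnergyLE u E) :
    EnergyLE u (energy u) :=
  energyLE_energy_of_ne_top (ne_top_of_le_ne_top ENNReal.ofReal_ne_top
    (iSup_le fun M => ENNReal.ofReal_le_ofReal (h M)))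

section

variable {K₁ K₂ : C(unitInterval, ℝ)} {a b : ℝ} {v : ℝ → C(unitInterval, ℝ)}
  {g : ℝ × unitInterval → ℝ}

/-- The energy is integrable in time, and the variational inequality holds with the energy itself
in place of the partial energies: monotone convergence. -/
lemma IsEVI.energy_integrable (h : IsEVI K₁ K₂ a b v g)
    (h0 : (0 : C(unitInterval, ℝ)) ∈ wallSpace K₁ K₂) (hab : a ≤ b) :
    IntervalIntegrable (fun r => energy (v r)) volume a b ∧
      (∀ᵐ r ∂volume.restrict (Ioc a b), EnergyLE (v r) (energy (v r))) ∧
      ∀ x ∈ wallSpace K₁ K₂, ∀ E, EnergyLE x E → ∀ s t, a ≤ s → s ≤ t → t ≤ b →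
        ‖toL2 (v t - x)‖ ^ 2 / 2 - ‖toL2 (v s - x)‖ ^ 2 / 2 + ∫ r in s..t, energy (v r)
          ≤ (t - s) * E + ∫ p in slab s t, g p * (v p.1 p.2 - x p.2) := by
  have hcont : ∀ M, ContinuousOn (fun r => partialEnergy M (v r)) (Icc a b) := fun M =>
    (continuous_partialEnergy M).comp_continuousOn h.continuousOn
  have hmeas : ∀ M, ∀ s t, a ≤ s → t ≤ b → AEMeasurable
      (fun r => ENNReal.ofReal (partialEnergy M (v r))) (volume.restrict (Ioc s t)) :=
    fun M s t hs ht => (((hcont M).mono (Ioc_subset_Icc_self.trans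
      (Icc_subset_Icc hs ht))).aemeasurable measurableSet_Ioc).ennreal_ofReal
  have hlint : ∀ s t, a ≤ s → s ≤ t → t ≤ b → ∀ R, (∀ K, ∫ r in s..t, partialEnergy K (v r) ≤ R) →
      ∫⁻ r in Ioc s t, ⨆ M, ENNReal.ofReal (partialEnergy M (v r)) ≤ ENNReal.ofReal R := by
    intro s t hs hst ht R hR
    rw [lintegral_iSup' (fun M => hmeas M s t hs ht) (Eventually.of_forall fun r M N hMN =>
      ENNReal.ofReal_le_ofReal (partialEnergy_mono _ hMN))]
    refine iSup_le fun M => ?_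
    rw [← ofReal_integral_eq_lintegral_ofReal]
    · refine ENNReal.ofReal_le_ofReal ?_
      have := hR M
      rwa [intervalIntegral.integral_of_le hst] at this
    · exact (((hcont M).mono (Icc_subset_Icc hs ht)).integrableOn_Icc).mono_set
        Ioc_subset_Icc_self
    · exact Eventually.of_forall fun r => partialEnergy_nonneg M _
  have hfin : ∫⁻ r in Ioc a b, ⨆ M, ENNReal.ofReal (partialEnergy M (v r)) ≠ ⊤ := by
    refine ne_top_of_le_ne_top ENNReal.ofReal_ne_top (hlint a b le_rfl hab le_rfl
      (‖toL2 (v a - 0)‖ ^ 2 / 2 - ‖toL2 (v b - 0)‖ ^ 2 / 2 + ((b - a) * 0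
        + ∫ p in slab a b, g p * (v p.1 p.2 - (0 : C(unitInterval, ℝ)) p.2))) fun K => ?_)
    linarith [h.evi 0 h0 0 energyLE_zero a b le_rfl hab le_rfl K]
  have hsup : AEMeasurable (fun r => ⨆ M, ENNReal.ofReal (partialEnergy M (v r)))
      (volume.restrict (Ioc a b)) := AEMeasurable.iSup fun M => hmeas M a b le_rfl le_rfl
  have hint : IntegrableOn (fun r => energy (v r)) (Ioc a b) :=
    integrable_toReal_of_lintegral_ne_top hsup hfin
  refine ⟨(intervalIntegrable_iff_integrableOn_Ioc_of_le hab).2 hint, ?_, ?_⟩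
  · filter_upwards [ae_lt_top' hsup hfin] with r hr
    exact energyLE_energy_of_ne_top hr.ne
  · intro x hx E hE s t has hst htb
    set R := (t - s) * E + (∫ p in slab s t, g p * (v p.1 p.2 - x p.2))
      - ‖toL2 (v t - x)‖ ^ 2 / 2 + ‖toL2 (v s - x)‖ ^ 2 / 2 with hR
    have hle : ∀ K, ∫ r in s..t, partialEnergy K (v r) ≤ R := fun K => by
      linarith [h.evi x hx E hE s t has hst htb K]
    have hR0 : 0 ≤ R := (intervalIntegral.integral_nonneg hst
      fun r _ => partialEnergy_nonneg 0 _).trans (hle 0)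
    have h1 : ∫ r in s..t, energy (v r) ≤ R := by
      rw [intervalIntegral.integral_of_le hst]
      have hsub : Ioc s t ⊆ Ioc a b := Ioc_subset_Ioc has htb
      have hsup' := hsup.mono_measure (Measure.restrict_mono hsub le_rfl)
      have hl := hlint s t has hst htb R hle
      rw [show ∫ r in Ioc s t, energy (v r) = _ from integral_toReal hsup'
        (ae_lt_top' hsup' (ne_top_of_le_ne_top ENNReal.ofReal_ne_top hl))]
      exact ENNReal.toReal_le_of_le_ofReal hR0 hl
    linarith

end

/-! ### A difference quotient criterion -/

lemma le_sub_of_diffQuot_of_continuous {Z G : ℝ → ℝ} {c d ρ : ℝ} (hZ : Continuous Z) (hcd : c ≤ d)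
    (hG : IntervalIntegrable G volume c d) (hρ : 0 < ρ)
    (h : ∀ h, 0 < h → h < ρ → ∀ᵐ s ∂volume.restrict (Ioc c d), Z s + h * G s ≤ Z (s + h)) :
    ∫ s in c..d, G s ≤ Z d - Z c := by
  have hlim : Tendsto (fun h : ℝ => h⁻¹ • ((∫ s in c..d + h, Z s) - ∫ s in c..d, Z s)
      - h⁻¹ • ((∫ s in c..c + h, Z s) - ∫ s in c..c, Z s)) (𝓝[>] 0) (𝓝 (Z d - Z c)) := by
    have hd : ∀ x, HasDerivAt (fun t => ∫ s in c..t, Z s) (Z x) x := fun x =>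
      intervalIntegral.integral_hasDerivAt_right (hZ.intervalIntegrable _ _)
        hZ.aestronglyMeasurable.stronglyMeasurableAtFilter hZ.continuousAt
    exact (hd d).tendsto_slope_zero_right.sub (hd c).tendsto_slope_zero_right
  refine ge_of_tendsto hlim ?_
  filter_upwards [Ioo_mem_nhdsGT hρ] with h' hh
  have hh0 : 0 < h' := hh.1
  have hi : ∀ x y, IntervalIntegrable Z volume x y := fun x y => hZ.intervalIntegrable x y
  have hZh : Continuous fun s => Z (s + h') := by fun_prop
  have h1 : ∫ s in c..d, (Z s + h' * G s) ≤ ∫ s in c..d, Z (s + h') := by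
    refine intervalIntegral.integral_mono_ae_restrict hcd ((hi _ _).add (hG.const_mul h'))
      (hZh.intervalIntegrable _ _) ?_
    rw [← restrict_Ioc_eq_restrict_Icc]
    exact h h' hh0 hh.2
  rw [intervalIntegral.integral_add (hi _ _) (hG.const_mul h'),
    intervalIntegral.integral_const_mul, intervalIntegral.integral_comp_add_right] at h1
  have h2 := intervalIntegral.integral_add_adjacent_intervals (hi c (c + h')) (hi (c + h') (d + h'))
  rw [intervalIntegral.integral_same, sub_zero, ← smul_sub, smul_eq_mul, ← div_eq_inv_mul,
    le_div_iff₀ hh0]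
  linarith

/-- If the forward difference quotients of a continuous function `Z` dominate an integrable
function `G`, then the increment of `Z` dominates the integral of `G`. -/
lemma le_sub_of_diffQuot {Z G : ℝ → ℝ} {c d ρ : ℝ} (hZ : ContinuousOn Z (Icc c d)) (hcd : c ≤ d)
    (hG : IntervalIntegrable G volume c d) (hρ : 0 < ρ)
    (h : ∀ h, 0 < h → h < ρ → ∀ᵐ s ∂volume.restrict (Ioc c d), s + h ≤ d →
      Z s + h * G s ≤ Z (s + h)) :
    ∫ s in c..d, G s ≤ Z d - Z c := by
  rcases hcd.eq_or_lt with rfl | hlt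
  · simp
  set Y : ℝ → ℝ := IccExtend hcd ((Icc c d).domRestrict Z) with hY
  have hYc : Continuous Y := hZ.domRestrict.Icc_extend'
  have hYZ : ∀ s ∈ Icc c d, Y s = Z s := fun s hs => by rw [hY, IccExtend_of_mem _ _ hs]; rfl
  have hprim : ContinuousOn (fun t => ∫ s in c..t, G s) (Icc c d) := by
    have := intervalIntegral.continuousOn_primitive_interval'
      (f := G) (μ := volume) (b₁ := c) (b₂ := d) (a := c) hG left_mem_uIcc
    rwa [uIcc_of_le hcd] at this
  have key : ∀ d' ∈ Ioo c d, ∫ s in c..d', G s ≤ Z d' - Z c := by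
    intro d' hd'
    rw [← hYZ d' (Ioo_subset_Icc_self hd'), ← hYZ c (left_mem_Icc.2 hcd)]
    refine le_sub_of_diffQuot_of_continuous hYc hd'.1.le (hG.mono_set ?_)
      (ρ := min ρ (d - d')) (lt_min hρ (by linarith [hd'.2])) fun h' h0 h1 => ?_
    · rw [uIcc_of_le hcd, uIcc_of_le hd'.1.le]; exact Icc_subset_Icc le_rfl hd'.2.le
    · have h2 := h h' h0 (h1.trans_le (min_le_left _ _))
      have h3 := ae_restrict_of_ae_restrict_of_subset
        (Ioc_subset_Ioc (le_refl c) hd'.2.le) h2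
      filter_upwards [h3, ae_restrict_mem measurableSet_Ioc] with s hs hsm
      have h4 : s + h' ≤ d := by linarith [h1.trans_le (min_le_right _ _), hsm.2]
      rw [hYZ s ⟨hsm.1.le, by linarith⟩, hYZ (s + h') ⟨by linarith [hsm.1], h4⟩]
      exact hs h4
  have hne : (𝓝[Ioo c d] d).NeBot := by
    rw [← mem_closure_iff_nhdsWithin_neBot, closure_Ioo hlt.ne]
    exact right_mem_Icc.2 hcd
  have t1 := (hprim d (right_mem_Icc.2 hcd)).mono_left (nhdsWithin_mono d Ioo_subset_Icc_self)
  have t2 := ((hZ d (right_mem_Icc.2 hcd)).mono_left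
    (nhdsWithin_mono d Ioo_subset_Icc_self)).sub_const (Z c)
  exact le_of_tendsto_of_tendsto t1 t2 (eventually_mem_nhdsWithin.mono fun d' hd' => key d' hd')

lemma continuousOn_setIntegral_slab {q : ℝ × unitInterval → ℝ} {a b : ℝ} (hab : a ≤ b)
    (hq : IntegrableOn q (strip a b)) :
    ContinuousOn (fun t => ∫ p in slab a t, q p) (Icc a b) := by
  have h1 : IntegrableOn q (slab a b) := hq.mono_set (slab_subset_strip le_rfl le_rfl)
  have h2 : IntegrableOn (fun r => ∫ x : unitInterval, q (r, x)) (Ioc a b) := by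
    rw [slab, Measure.volume_eq_prod] at h1
    rw [IntegrableOn, ← Measure.prod_restrict, Measure.restrict_univ] at h1
    exact h1.integral_prod_left
  have h3 := intervalIntegral.continuousOn_primitive_interval' (μ := volume) (a := a)
    ((intervalIntegrable_iff_integrableOn_Ioc_of_le hab).2 h2) left_mem_uIcc
  rw [uIcc_of_le hab] at h3
  refine h3.congr fun t ht => ?_
  exact setIntegral_slab_eq ht.1 (h1.mono_set (prod_mono (Ioc_subset_Ioc le_rfl ht.2) subset_rfl))

/-! ### The residual of the equation -/

/-- The residual, tested against `φ` and integrated up to time `t`, of the unconstrained equation.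
For a solution this is the total action of the reflection terms on `φ`. -/
def residual (a : ℝ) (v : ℝ → C(unitInterval, ℝ)) (g : ℝ × unitInterval → ℝ) (φ : ℝ → ℝ)
    (t : ℝ) : ℝ :=
  (∫ x : unitInterval, v t x * φ x)
    - ∫ p in slab a t, (v p.1 p.2 * deriv (deriv φ) p.2 + g p * φ p.2)

section

variable {K₁ K₂ : C(unitInterval, ℝ)} {a b : ℝ} {v : ℝ → C(unitInterval, ℝ)}
  {g : ℝ × unitInterval → ℝ}

lemma integrableOn_residual (hv : ContinuousOn v (Icc a b)) (hg : IntegrableOn g (strip a b))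
    {φ : ℝ → ℝ} (hφ : IsNeumann φ) :
    IntegrableOn (fun p => v p.1 p.2 * deriv (deriv φ) p.2 + g p * φ p.2) (strip a b) := by
  have h1 := hφ.continuous
  have h2 := hφ.continuous_deriv2
  refine IntegrableOn.add ?_ ?_
  · exact integrableOn_strip_of_continuousOn (volume_strip_lt_top a b)
      ((continuousOn_eval hv).mul (by fun_prop))
  · exact hg.mul_continuousOn (by fun_prop) (isCompact_strip a b)

lemma integral_mul_eq_inner (u : C(unitInterval, ℝ)) {φ : ℝ → ℝ} (hφ : Continuous φ) :
    ∫ x : unitInterval, u x * φ x = inner ℝ (toL2 (restrictUnit φ hφ)) (toL2 u) := by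
  rw [inner_toL2]; simp [mul_comm]

lemma continuousOn_residual (hab : a ≤ b) (hv : ContinuousOn v (Icc a b))
    (hg : IntegrableOn g (strip a b)) {φ : ℝ → ℝ} (hφ : IsNeumann φ) :
    ContinuousOn (residual a v g φ) (Icc a b) := by
  refine ContinuousOn.sub ?_ (continuousOn_setIntegral_slab hab (integrableOn_residual hv hg hφ))
  simp_rw [integral_mul_eq_inner _ hφ.continuous]
  exact ((innerSL ℝ (toL2 _)).continuous.comp toL2.continuous).comp_continuousOn hv

lemma residual_add (hv : ContinuousOn v (Icc a b)) (hg : IntegrableOn g (strip a b))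
    {φ ψ : ℝ → ℝ} (hφ : IsNeumann φ) (hψ : IsNeumann ψ) {t : ℝ} (ht : t ≤ b) :
    residual a v g (fun x => φ x + ψ x) t = residual a v g φ t + residual a v g ψ t := by
  have hd : deriv (deriv fun x => φ x + ψ x) = fun x => deriv (deriv φ) x + deriv (deriv ψ) x := by
    have h1 : deriv (fun x => φ x + ψ x) = fun x => deriv φ x + deriv ψ x := funext fun x =>
      deriv_fun_add (hφ.differentiable x) (hψ.differentiable x)
    rw [h1]
    exact funext fun x => deriv_fun_add (hφ.contDiff_deriv.differentiable (by simp) x)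
      (hψ.contDiff_deriv.differentiable (by simp) x)
  have c1 := hφ.continuous
  have c2 := hψ.continuous
  have hsub := slab_subset_strip (le_refl a) ht
  unfold residual
  rw [hd]
  have e1 : ∫ x : unitInterval, v t x * (φ x + ψ x)
      = (∫ x : unitInterval, v t x * φ x) + ∫ x : unitInterval, v t x * ψ x := by
    simp_rw [mul_add]
    exact integral_add (integrable_of_continuous (by fun_prop))
      (integrable_of_continuous (by fun_prop))
  have e2 := integral_add ((integrableOn_residual hv hg hφ).mono_set hsub)
    ((integrableOn_residual hv hg hψ).mono_set hsub)
  have e3 : (fun p : ℝ × unitInterval => v p.1 p.2 * (deriv (deriv φ) p.2 + deriv (deriv ψ) p.2)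
      + g p * (φ p.2 + ψ p.2)) = fun p => (v p.1 p.2 * deriv (deriv φ) p.2 + g p * φ p.2)
      + (v p.1 p.2 * deriv (deriv ψ) p.2 + g p * ψ p.2) := by
    funext p; ring
  rw [e1, e3, e2]
  ring

lemma residual_const_mul {φ : ℝ → ℝ} (hφ : IsNeumann φ) (c t : ℝ) :
    residual a v g (fun x => c * φ x) t = c * residual a v g φ t := by
  have hd : deriv (deriv fun x => c * φ x) = fun x => c * deriv (deriv φ) x := by
    have h1 : deriv (fun x => c * φ x) = fun x => c * deriv φ x := funext fun x =>
      deriv_const_mul c (hφ.differentiable x)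
    rw [h1]
    exact funext fun x => deriv_const_mul c (hφ.contDiff_deriv.differentiable (by simp) x)
  unfold residual
  rw [hd]
  have e1 : ∫ x : unitInterval, v t x * (c * φ x) = c * ∫ x : unitInterval, v t x * φ x := by
    rw [← integral_const_mul]; congr 1; funext x; ring
  have e2 : ∫ p in slab a t, (v p.1 p.2 * (c * deriv (deriv φ) p.2) + g p * (c * φ p.2))
      = c * ∫ p in slab a t, (v p.1 p.2 * deriv (deriv φ) p.2 + g p * φ p.2) := by
    rw [← integral_const_mul]; congr 1; funext p; ring
  rw [e1, e2]; ring

lemma residual_sub_residual (hv : ContinuousOn v (Icc a b)) (hg : IntegrableOn g (strip a b))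
    {φ : ℝ → ℝ} (hφ : IsNeumann φ) {s t : ℝ} (hs : a ≤ s) (hst : s ≤ t) (ht : t ≤ b) :
    residual a v g φ t - residual a v g φ s
      = (∫ x : unitInterval, v t x * φ x) - (∫ x : unitInterval, v s x * φ x)
        - ∫ p in slab s t, (v p.1 p.2 * deriv (deriv φ) p.2 + g p * φ p.2) := by
  unfold residual
  rw [setIntegral_slab_add hs hst
    ((integrableOn_residual hv hg hφ).mono_set (slab_subset_strip le_rfl ht))]
  ring

lemma volume_slab (s t : ℝ) :
    (volume : Measure (ℝ × unitInterval)) (slab s t) = ENNReal.ofReal (t - s) := by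
  rw [slab, Measure.volume_eq_prod, Measure.prod_prod]
  simp

lemma forcing_le (hv : ContinuousOn v (Icc a b)) (hg : IntegrableOn g (strip a b)) {s t δ : ℝ}
    (has : a ≤ s) (htb : t ≤ b) (hocc : ∀ p ∈ slab s t, |v p.1 p.2 - v s p.2| ≤ δ)
    {φ : ℝ → ℝ} (hφ : IsNeumann φ) (ε : ℝ) :
    ∫ p in slab s t, g p * (v p.1 p.2 - (v s + ε • restrictUnit φ hφ.continuous) p.2)
      ≤ δ * (∫ p in slab s t, |g p|) - ε * ∫ p in slab s t, g p * φ p.2 := by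
  have hsub := slab_subset_strip has htb
  have hgabs : IntegrableOn (fun p => |g p|) (strip a b) := hg.abs
  have c := hφ.continuous
  have hgφ : IntegrableOn (fun p : ℝ × unitInterval => g p * φ p.2) (strip a b) :=
    hg.mul_continuousOn (by fun_prop) (isCompact_strip a b)
  rw [← integral_const_mul, ← integral_const_mul, ← integral_sub
    ((hgabs.mono_set hsub).const_mul δ) ((hgφ.mono_set hsub).const_mul ε)]
  refine setIntegral_mono_on ?_ (((hgabs.mono_set hsub).const_mul δ).sub
    ((hgφ.mono_set hsub).const_mul ε)) (measurableSet_slab _ _) fun p' hp' => ?_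
  · refine (hg.mul_continuousOn ((continuousOn_eval hv).sub ?_)
      (isCompact_strip a b)).mono_set hsub
    exact (Continuous.comp (map_continuous _) continuous_snd).continuousOn
  · have := hocc p' hp'
    have h3 : g p' * (v p'.1 p'.2 - v s p'.2) ≤ δ * |g p'| := by
      refine (le_abs_self _).trans ?_
      rw [abs_mul, mul_comm]
      exact mul_le_mul_of_nonneg_right this (abs_nonneg _)
    have h4 : (v s + ε • restrictUnit φ hφ.continuous) p'.2 = v s p'.2 + ε * φ p'.2 := rfl
    rw [h4]
    linarith

lemma le_diffusion (hv : ContinuousOn v (Icc a b)) {s t δ : ℝ} (has : a ≤ s) (hst : s ≤ t)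
    (htb : t ≤ b) (hδ : 0 ≤ δ) (hocc : ∀ p ∈ slab s t, |v p.1 p.2 - v s p.2| ≤ δ)
    {q : ℝ → ℝ} (hq : Continuous q) :
    (∫ p in slab s t, v p.1 p.2 * q p.2) - δ * ‖restrictUnit q hq‖ * (t - s)
      ≤ (t - s) * ∫ x : unitInterval, v s x * q x := by
  have hsub := slab_subset_strip has htb
  have a3 : IntegrableOn (fun p : ℝ × unitInterval => v s p.2 * q p.2) (slab s t) :=
    (integrableOn_strip_of_continuousOn (volume_strip_lt_top a b) (Continuous.continuousOn
      (by fun_prop))).mono_set hsub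
  have a1 : (t - s) * (∫ x : unitInterval, v s x * q x)
      = ∫ p in slab s t, v s p.2 * q p.2 := by
    rw [setIntegral_slab_eq hst a3]
    simp
  have a2 : δ * ‖restrictUnit q hq‖ * (t - s)
      = ∫ p in slab s t, δ * ‖restrictUnit q hq‖ := by
    rw [setIntegral_const, measureReal_def, volume_slab, ENNReal.toReal_ofReal (by linarith),
      smul_eq_mul, mul_comm]
  have a4 : IntegrableOn (fun p : ℝ × unitInterval => δ * ‖restrictUnit q hq‖) (slab s t) :=
    integrableOn_const (by rw [volume_slab]; exact ENNReal.ofReal_ne_top)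
  have a5 : IntegrableOn (fun p : ℝ × unitInterval => v p.1 p.2 * q p.2) (slab s t) :=
    (integrableOn_strip_of_continuousOn (volume_strip_lt_top a b)
      ((continuousOn_eval hv).mul (Continuous.continuousOn (by fun_prop)))).mono_set hsub
  rw [a1, a2, ← integral_sub a5 a4]
  refine setIntegral_mono_on (a5.sub a4) a3 (measurableSet_slab _ _) fun p' hp' => ?_
  have h5 : (v p'.1 p'.2 - v s p'.2) * q p'.2 ≤ δ * ‖restrictUnit q hq‖ := by
    refine (le_abs_self _).trans ?_
    rw [abs_mul]
    exact mul_le_mul (hocc p' hp') ((restrictUnit q hq).norm_coe_le_norm p'.2) (abs_nonneg _) hδ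
  linarith

/-- The residual increases when tested against directions in which the path can be perturbed
without leaving the walls. -/
lemma IsEVI.residual_mono (h : IsEVI K₁ K₂ a b v g)
    (h0 : (0 : C(unitInterval, ℝ)) ∈ wallSpace K₁ K₂)
    {φ : ℝ → ℝ} (hφ : IsNeumann φ) {c d ε₀ : ℝ} (hac : a ≤ c) (hcd : c ≤ d) (hdb : d ≤ b)
    (hε₀ : 0 < ε₀) (hadm : ∀ ε, 0 < ε → ε ≤ ε₀ → ∀ s ∈ Icc c d,
      v s + ε • restrictUnit φ hφ.continuous ∈ wallSpace K₁ K₂) :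
    residual a v g φ c ≤ residual a v g φ d := by
  have hab : a ≤ b := hac.trans (hcd.trans hdb)
  have hv := h.continuousOn
  have hg := MemLp.integrableOn_strip h.memLp
  obtain ⟨hFi, hFe, hevi⟩ := h.energy_integrable h0 hab
  set p := restrictUnit φ hφ.continuous
  set q := restrictUnit _ hφ.continuous_deriv2
  set e₀ : ℝ := ∫ x : unitInterval, φ x * deriv (deriv φ) x
  set F : ℝ → ℝ := fun r => energy (v r) with hF
  set N1 : ℝ → ℝ := fun t => ∫ p in slab a t, |g p|
  have hgabs : IntegrableOn (fun p => |g p|) (strip a b) := hg.abs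
  have hsubI : Icc c d ⊆ Icc a b := Icc_subset_Icc hac hdb
  have hFcd : IntervalIntegrable F volume c d := hFi.mono_set (by
    rw [uIcc_of_le hab, uIcc_of_le hcd]; exact hsubI)
  have hFsub : ∀ s t, c ≤ s → s ≤ t → t ≤ d → IntervalIntegrable F volume s t :=
    fun s t hs hst ht => hFcd.mono_set (by
      rw [uIcc_of_le hst, uIcc_of_le hcd]; exact Icc_subset_Icc hs ht)
  -- The estimate at a fixed size `ε` of the perturbation and a fixed oscillation `δ`.
  have key : ∀ ε, 0 < ε → ε ≤ ε₀ → ∀ δ, 0 < δ →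
      ε ^ 2 / 2 * e₀ * (d - c) ≤ ε * (residual a v g φ d - residual a v g φ c)
        + δ * (N1 d - N1 c + ε * ‖q‖ * (d - c)) := by
    intro ε hε hεle δ hδ
    obtain ⟨ρ, hρ, hosc⟩ := Metric.uniformContinuousOn_iff.1
      (isCompact_Icc.uniformContinuousOn_of_continuous hv) δ hδ
    -- The competitor at time `s` is `v s + ε φ`. Over a short interval `[s, s + h]` the variational
    -- inequality then bounds the forward difference quotient of `Z` at `s` from below.
    set Z : ℝ → ℝ := fun t => ε * residual a v g φ t - (∫ r in c..t, F r)
      + δ * (N1 t + ε * ‖q‖ * t) with hZdef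
    have hZ : ContinuousOn Z (Icc c d) := by
      have c1 := (continuousOn_residual hab hv hg hφ).mono hsubI
      have c2 := (continuousOn_setIntegral_slab hab hgabs).mono hsubI
      have c3 := intervalIntegral.continuousOn_primitive_interval'
        (f := F) (μ := volume) (b₁ := c) (b₂ := d) (a := c) hFcd left_mem_uIcc
      rw [uIcc_of_le hcd] at c3
      exact ((c1.const_smul ε).sub c3).add ((c2.add (by fun_prop)).const_smul δ)
    have hG : IntervalIntegrable (fun s => ε ^ 2 / 2 * e₀ - F s) volume c d :=
      intervalIntegrable_const.sub hFcd
    have := le_sub_of_diffQuot hZ hcd hG hρ fun h' hh0 hhρ => by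
      filter_upwards [ae_restrict_of_ae_restrict_of_subset (Ioc_subset_Ioc hac hdb) hFe,
        ae_restrict_mem measurableSet_Ioc] with s hs hsm hsd
      have has : a ≤ s := hac.trans hsm.1.le
      have hss : s ≤ s + h' := by linarith
      have hsb : s + h' ≤ b := hsd.trans hdb
      have hsub := slab_subset_strip has hsb
      have hx := hadm ε hε hεle s ⟨hsm.1.le, by linarith⟩
      have h1 := hevi _ hx _ (hs.add_test hφ ε) s (s + h') has hss hsb
      have hres := residual_sub_residual hv hg hφ has hss hsb
      have hN1 : N1 (s + h') = N1 s + ∫ p in slab s (s + h'), |g p| :=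
        setIntegral_slab_add has hss (hgabs.mono_set (slab_subset_strip le_rfl hsb))
      have hP := intervalIntegral.integral_add_adjacent_intervals
        (hFsub c s le_rfl hsm.1.le (by linarith)) (hFsub s (s + h') hsm.1.le hss hsd)
      have hosc' : ∀ r, s < r → r ≤ s + h' → ‖v r - v s‖ ≤ δ := fun r hr1 hr2 => by
        have := hosc r ⟨has.trans hr1.le, hr2.trans hsb⟩ s ⟨has, by linarith⟩ (by
          rw [Real.dist_eq, abs_of_nonneg (by linarith)]; linarith)
        rw [dist_eq_norm] at this; exact this.le
      have hocc : ∀ p ∈ slab s (s + h'), |v p.1 p.2 - v s p.2| ≤ δ := fun p hp =>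
        ((v p.1 - v s).norm_coe_le_norm p.2).trans (hosc' p.1 hp.1.1 hp.1.2)
      -- the increment of the distance
      have e1 : ‖toL2 (v (s + h') - (v s + ε • p))‖ ^ 2 / 2 - ‖toL2 (v s - (v s + ε • p))‖ ^ 2 / 2
          ≥ -ε * ((∫ x : unitInterval, v (s + h') x * φ x) - ∫ x : unitInterval, v s x * φ x) := by
        rw [integral_mul_eq_inner _ hφ.continuous, integral_mul_eq_inner _ hφ.continuous,
          ← inner_sub_right, ← map_sub]
        have a1 : v (s + h') - (v s + ε • p) = (v (s + h') - v s) - ε • p := by abel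
        have a2 : v s - (v s + ε • p) = -(ε • p) := by abel
        rw [a1, a2, map_sub toL2 (v (s + h') - v s), @norm_sub_sq_real, map_neg, norm_neg, map_smul,
          inner_smul_right, real_inner_comm]
        have := sq_nonneg ‖toL2 (v (s + h') - v s)‖
        linarith
      have hgφ : IntegrableOn (fun p : ℝ × unitInterval => g p * φ p.2)
          (strip a b) := hg.mul_continuousOn
        (by have := hφ.continuous; fun_prop) (isCompact_strip a b)
      have e2 := forcing_le hv hg has hsb hocc hφ ε
      have e3 := le_diffusion hv has hss hsb hδ.le hocc hφ.continuous_deriv2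
      have e4 : ∫ p in slab s (s + h'), (v p.1 p.2 * deriv (deriv φ) p.2 + g p * φ p.2)
          = (∫ p in slab s (s + h'), v p.1 p.2 * deriv (deriv φ) p.2)
            + ∫ p in slab s (s + h'), g p * φ p.2 := by
        refine integral_add ?_ (hgφ.mono_set hsub)
        exact (integrableOn_strip_of_continuousOn (volume_strip_lt_top a b)
            ((continuousOn_eval hv).mul (by have := hφ.continuous_deriv2; fun_prop))).mono_set hsub
      have e5 := mul_le_mul_of_nonneg_left e3 hε.le
      simp only [hZdef]
      rw [hN1, ← hP]
      rw [e4] at hres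
      have hres' := congrArg (ε * ·) hres
      nlinarith [h1, e1, e2, e5, hres']
    rw [intervalIntegral.integral_sub intervalIntegrable_const hFcd,
      intervalIntegral.integral_const, smul_eq_mul] at this
    simp only [hZdef, intervalIntegral.integral_same] at this
    linarith
  -- Now `δ → 0`, and afterwards `ε → 0`.
  have key2 : ∀ ε, 0 < ε → ε ≤ ε₀ →
      ε / 2 * e₀ * (d - c) ≤ residual a v g φ d - residual a v g φ c := by
    intro ε hε hεle
    have h1 : Tendsto (fun δ : ℝ => ε * (residual a v g φ d - residual a v g φ c)
        + δ * (N1 d - N1 c + ε * ‖q‖ * (d - c))) (𝓝[>] 0)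
        (𝓝 (ε * (residual a v g φ d - residual a v g φ c))) := by
      have : Continuous fun δ : ℝ => ε * (residual a v g φ d - residual a v g φ c)
        + δ * (N1 d - N1 c + ε * ‖q‖ * (d - c)) := by fun_prop
      have h := (this.tendsto 0).mono_left (nhdsWithin_le_nhds (s := Ioi 0))
      simpa using h
    have h2 := ge_of_tendsto h1 (eventually_mem_nhdsWithin.mono fun δ hδ => key ε hε hεle δ hδ)
    have h3 : ε * (ε / 2 * e₀ * (d - c)) ≤ ε * (residual a v g φ d - residual a v g φ c) := by
      linarith
    exact le_of_mul_le_mul_left h3 hε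
  have h1 : Tendsto (fun ε : ℝ => ε / 2 * e₀ * (d - c)) (𝓝[>] 0) (𝓝 0) := by
    have : Continuous fun ε : ℝ => ε / 2 * e₀ * (d - c) := by fun_prop
    have h := (this.tendsto 0).mono_left (nhdsWithin_le_nhds (s := Ioi 0))
    simpa using h
  have h2 := le_of_tendsto h1 (by
    filter_upwards [Ioc_mem_nhdsGT hε₀] with ε hε
    exact key2 ε hε.1 hε.2)
  linarith

end

/-! ### Space-time measures from increasing families of functionals -/

/-- Positive functionals on `C(X)`, for `X` compact, are integrals. -/
lemma exists_measure_of_positive {X : Type*} [TopologicalSpace X] [CompactSpace X] [T2Space X]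
    [MeasurableSpace X] [BorelSpace X] (Λ : C(X, ℝ) →ₗ[ℝ] ℝ)
    (hΛ : ∀ f : C(X, ℝ), (∀ x, 0 ≤ f x) → 0 ≤ Λ f) :
    ∃ μ : Measure X, IsFiniteMeasure μ ∧ ∀ f : C(X, ℝ), ∫ x, f x ∂μ = Λ f := by
  let L : CompactlySupportedContinuousMap X ℝ →ₗ[ℝ] ℝ :=
    { toFun := fun f => Λ f.toContinuousMap
      map_add' := fun f g => by rw [← map_add]; rfl
      map_smul' := fun c f => by rw [RingHom.id_apply, ← map_smul]; rfl }
  let P : CompactlySupportedContinuousMap X ℝ →ₚ[ℝ] ℝ :=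
    PositiveLinearMap.mk₀ L fun f hf => hΛ _ fun x => hf x
  refine ⟨RealRMK.rieszMeasure P, ?_, fun f => ?_⟩
  · exact ⟨isCompact_univ.measure_lt_top⟩
  · have := RealRMK.integral_rieszMeasure P
      (CompactlySupportedContinuousMap.continuousMapEquiv f)
    exact this

/-- Pointwise bounded linear functionals converge pointwise along an ultrafilter. -/
lemma exists_ultrafilter_limit {V ι : Type*} [AddCommGroup V] [Module ℝ V] (U : Ultrafilter ι)
    (L : ι → V →ₗ[ℝ] ℝ) (C : V → ℝ) (hC : ∀ ψ, ∀ᶠ n in (U : Filter ι), |L n ψ| ≤ C ψ) :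
    ∃ Λ : V →ₗ[ℝ] ℝ, ∀ ψ, Tendsto (fun n => L n ψ) U (𝓝 (Λ ψ)) := by
  have hex : ∀ ψ, ∃ l, Tendsto (fun n => L n ψ) U (𝓝 l) := by
    intro ψ
    obtain ⟨l, -, hl⟩ := (isCompact_Icc (a := -C ψ) (b := C ψ)).ultrafilter_le_nhds
      (U.map fun n => L n ψ) (by
        rw [le_principal_iff]
        exact (hC ψ).mono fun n hn => abs_le.1 hn)
    exact ⟨l, hl⟩
  choose l hl using hex
  refine ⟨{ toFun := l, map_add' := fun ψ φ => ?_, map_smul' := fun c ψ => ?_ }, hl⟩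
  · refine tendsto_nhds_unique (hl (ψ + φ)) ?_
    simpa using (hl ψ).add (hl φ)
  · refine tendsto_nhds_unique (hl (c • ψ)) ?_
    simpa using (hl ψ).const_mul c

/-- The space of test functions. -/
def neumannSpace : Submodule ℝ (ℝ → ℝ) where
  carrier := {φ | IsNeumann φ}
  add_mem' h h' := h.add h'
  zero_mem' := IsNeumann.const 0
  smul_mem' c _ h := h.const_mul c

/-- The restriction of a test function to `[0,1]`. -/
def neumannRestrict : neumannSpace →ₗ[ℝ] C(unitInterval, ℝ) where
  toFun φ := restrictUnit φ.1 (IsNeumann.continuous φ.2)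
  map_add' _ _ := rfl
  map_smul' _ _ := rfl

@[simp] lemma neumannRestrict_apply (φ : neumannSpace) (x : unitInterval) :
    neumannRestrict φ x = φ.1 x := rfl

/-- The constant test function. -/
def neumannOne : neumannSpace := ⟨fun _ => 1, IsNeumann.const 1⟩

/-- The cosines as test functions. -/
def neumannCos (k : ℕ) : neumannSpace := ⟨_, isNeumann_cos k⟩

/-- The Fejér mean as a test function. -/
def fejerTest (N : ℕ) : C(unitInterval, ℝ) →ₗ[ℝ] neumannSpace :=
  (N : ℝ)⁻¹ • ∑ M ∈ Finset.range N, ∑ k ∈ Finset.range (M + 1),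
    cosWeight k • (cosCoeff k).toLinearMap.smulRight (neumannCos k)

lemma neumannRestrict_fejerTest (N : ℕ) (u : C(unitInterval, ℝ)) :
    neumannRestrict (fejerTest N u) = fejerMean N u := by
  have h : ∀ k, neumannRestrict (neumannCos k) = cosMode k := fun k => rfl
  simp [fejerTest, fejerMean_apply, partialSum_apply, h, smul_smul]

lemma fejerMean_nonneg (N : ℕ) {u : C(unitInterval, ℝ)} (hu : ∀ x, 0 ≤ u x) (x : unitInterval) :
    0 ≤ fejerMean N u x := by
  rw [fejerMean_eq_integral]
  exact integral_nonneg fun y => mul_nonneg (hu y) (fejerKernel_nonneg N x y)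

section Increments

variable {c d : ℝ} {m : ℝ → neumannSpace →ₗ[ℝ] ℝ}

lemma abs_increment_le
    (hm : ∀ φ : neumannSpace, (∀ x : unitInterval, 0 ≤ φ.1 x) →
      MonotoneOn (fun t => m t φ) (Icc c d))
    (φ : neumannSpace) {s t : ℝ} (hs : s ∈ Icc c d) (ht : t ∈ Icc c d) (hst : s ≤ t) :
    |m t φ - m s φ| ≤ ‖neumannRestrict φ‖ * (m t neumannOne - m s neumannOne) := by
  set C := ‖neumannRestrict φ‖
  have hb : ∀ x : unitInterval, |φ.1 x| ≤ C := fun x => (neumannRestrict φ).norm_coe_le_norm x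
  have h1 := hm (C • neumannOne - φ) (fun x => by
    have := (abs_le.1 (hb x)).2
    change 0 ≤ C * 1 - φ.1 x
    linarith) hs ht hst
  have h2 := hm (C • neumannOne + φ) (fun x => by
    have := (abs_le.1 (hb x)).1
    change 0 ≤ C * 1 + φ.1 x
    linarith) hs ht hst
  simp only [map_sub, map_add, map_smul, smul_eq_mul] at h1 h2
  rw [abs_le]
  constructor <;> linarith

/-- The continuous function equal to `1` up to time `s` and to `0` from time `t` on, and affine in
between. -/
def timeCutoff (s t r : ℝ) : ℝ := max 0 (min 1 ((t - r) / (t - s)))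

lemma continuous_timeCutoff (s t : ℝ) : Continuous (timeCutoff s t) := by
  unfold timeCutoff; fun_prop

lemma timeCutoff_nonneg (s t r : ℝ) : 0 ≤ timeCutoff s t r := le_max_left _ _

lemma timeCutoff_le_one (s t r : ℝ) : timeCutoff s t r ≤ 1 :=
  max_le zero_le_one (min_le_left _ _)

lemma timeCutoff_eq_one {s t r : ℝ} (hst : s < t) (hr : r ≤ s) : timeCutoff s t r = 1 := by
  unfold timeCutoff
  rw [min_eq_left ((one_le_div (by linarith)).2 (by linarith)), max_eq_right zero_le_one]

lemma timeCutoff_eq_zero {s t r : ℝ} (hst : s < t) (hr : t ≤ r) : timeCutoff s t r = 0 := by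
  unfold timeCutoff
  exact max_eq_left ((min_le_right _ _).trans (div_nonpos_of_nonpos_of_nonneg (by linarith)
    (by linarith)))

/-- An increasing family of functionals on the test functions is the family of distribution
functions of a measure in space-time. -/
theorem exists_measure_of_increments (hcd : c ≤ d)
    (hm : ∀ φ : neumannSpace, (∀ x : unitInterval, 0 ≤ φ.1 x) →
      MonotoneOn (fun t => m t φ) (Icc c d))
    (hmc : ∀ φ : neumannSpace, ContinuousOn (fun t => m t φ) (Icc c d)) :
    ∃ η : Measure (ℝ × unitInterval), η (strip c d) < ⊤ ∧
      ∀ φ : neumannSpace, ∀ t ∈ Icc c d, ∫ p in strip c t, φ.1 p.2 ∂η = m t φ - m c φ := by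
  -- Riemann sums over the uniform partition of `[c,d]`, with test functions replaced by their
  -- Fejér means, are functionals on all continuous functions.
  let T : ℕ → ℕ → Icc c d := fun n i => projIcc c d hcd (c + i * ((d - c) / n))
  let slice : Icc c d → C(Icc c d × unitInterval, ℝ) →ₗ[ℝ] C(unitInterval, ℝ) := fun r =>
    { toFun := fun ψ => ψ.comp ⟨fun x => (r, x), by fun_prop⟩
      map_add' := fun _ _ => rfl
      map_smul' := fun _ _ => rfl }
  let L : ℕ → C(Icc c d × unitInterval, ℝ) →ₗ[ℝ] ℝ := fun n => ∑ i ∈ Finset.range n,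
    (m (T n (i + 1)) - m (T n i)) ∘ₗ fejerTest n ∘ₗ slice (T n (i + 1))
  have hL : ∀ n ψ, L n ψ = ∑ i ∈ Finset.range n,
      (m (T n (i + 1)) (fejerTest n (slice (T n (i + 1)) ψ))
        - m (T n i) (fejerTest n (slice (T n (i + 1)) ψ))) := by
    intro n ψ
    simp [L]
  have hTmono : ∀ n i, (T n i : ℝ) ≤ T n (i + 1) := by
    intro n i
    refine monotone_projIcc hcd ?_
    have : 0 ≤ (d - c) / n := div_nonneg (by linarith) (Nat.cast_nonneg n)
    push_cast
    nlinarith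
  have hT0 : ∀ n, (T n 0 : ℝ) = c := fun n => by
    simp only [T, Nat.cast_zero, zero_mul, add_zero]
    rw [projIcc_left]
  have hTn : ∀ n, n ≠ 0 → (T n n : ℝ) = d := fun n hn => by
    have : c + n * ((d - c) / n) = d := by field_simp; ring
    simp only [T, this]
    rw [projIcc_right]
  have hTmesh : ∀ n i, (T n (i + 1) : ℝ) ≤ T n i + (d - c) / n := by
    intro n i
    have h0 : 0 ≤ (d - c) / n := div_nonneg (by linarith) (Nat.cast_nonneg n)
    simp only [T, coe_projIcc]
    push_cast
    have : c + (i + 1) * ((d - c) / n) = (c + i * ((d - c) / n)) + (d - c) / n := by ring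
    rw [this]
    rcases le_total d (c + i * ((d - c) / n)) with h | h
    · rw [min_eq_left h, min_eq_left (by linarith)]
      linarith
    · rw [min_eq_right h]
      refine max_le (by linarith [le_max_left c (c + i * ((d - c) / n))]) ?_
      refine (min_le_right _ _).trans ?_
      linarith [le_max_right c (c + i * ((d - c) / n))]
  have hone : ∀ s ∈ Icc c d, ∀ t ∈ Icc c d, s ≤ t → m s neumannOne ≤ m t neumannOne :=
    fun s hs t ht hst => hm neumannOne (fun _ => zero_le_one) hs ht hst
  set m₁ := m d neumannOne - m c neumannOne with hm₁
  have hm₁0 : 0 ≤ m₁ :=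
    sub_nonneg.2 (hone c (left_mem_Icc.2 hcd) d (right_mem_Icc.2 hcd) hcd)
  have hbound : ∀ n ψ, |L n ψ| ≤ ‖ψ‖ * m₁ := by
    intro n ψ
    rcases Nat.eq_zero_or_pos n with rfl | hn
    · have : L 0 ψ = 0 := by rw [hL]; simp
      rw [this, abs_zero]; positivity
    rw [hL]
    refine (Finset.abs_sum_le_sum_abs _ _).trans ?_
    have h1 : ∀ i ∈ Finset.range n, |m (T n (i + 1)) (fejerTest n (slice (T n (i + 1)) ψ))
        - m (T n i) (fejerTest n (slice (T n (i + 1)) ψ))|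
        ≤ ‖ψ‖ * (m (T n (i + 1)) neumannOne - m (T n i) neumannOne) := by
      intro i _
      refine (abs_increment_le hm _ (T n i).2 (T n (i + 1)).2 (hTmono n i)).trans ?_
      refine mul_le_mul_of_nonneg_right ?_
        (sub_nonneg.2 (hone _ (T n i).2 _ (T n (i + 1)).2 (hTmono n i)))
      rw [neumannRestrict_fejerTest]
      refine (norm_fejerMean_le _ _).trans ?_
      rw [ContinuousMap.norm_le _ (norm_nonneg _)]
      exact fun x => ψ.norm_coe_le_norm _
    refine (Finset.sum_le_sum h1).trans ?_
    rw [← Finset.mul_sum, Finset.sum_range_sub (fun i => m (T n i) neumannOne), hT0,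
      hTn n hn.ne']
  obtain ⟨Λ, hΛ⟩ := exists_ultrafilter_limit (hyperfilter ℕ) L (fun ψ => ‖ψ‖ * m₁)
    fun ψ => Eventually.of_forall fun n => hbound n ψ
  have hpos : ∀ ψ : C(Icc c d × unitInterval, ℝ), (∀ x, 0 ≤ ψ x) → 0 ≤ Λ ψ := by
    intro ψ hψ
    refine ge_of_tendsto' (hΛ ψ) fun n => ?_
    rw [hL]
    refine Finset.sum_nonneg fun i _ => sub_nonneg.2 ?_
    refine hm _ (fun x => ?_) (T n i).2 (T n (i + 1)).2 (hTmono n i)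
    rw [← neumannRestrict_apply, neumannRestrict_fejerTest]
    exact fejerMean_nonneg n (fun y => hψ _) x
  obtain ⟨μ, hμfin, hμ⟩ := exists_measure_of_positive Λ hpos
  -- The distribution function of `μ` tested against a nonnegative test function.
  let prodFun : (ℝ → ℝ) → neumannSpace → Icc c d × unitInterval → ℝ :=
    fun θ φ x => θ x.1 * φ.1 x.2
  have hprodc : ∀ s t φ, Continuous (prodFun (timeCutoff s t) φ) := fun s t φ => by
    have := continuous_timeCutoff s t
    have := IsNeumann.continuous φ.2
    fun_prop
  have hLprod : ∀ n s t φ, L n ⟨_, hprodc s t φ⟩ = ∑ i ∈ Finset.range n,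
      timeCutoff s t (T n (i + 1)) * (m (T n (i + 1)) (fejerTest n (neumannRestrict φ))
        - m (T n i) (fejerTest n (neumannRestrict φ))) := by
    intro n s t φ
    rw [hL]
    refine Finset.sum_congr rfl fun i _ => ?_
    have : slice (T n (i + 1)) ⟨_, hprodc s t φ⟩
        = timeCutoff s t (T n (i + 1)) • neumannRestrict φ := by
      ext x; rfl
    rw [this, map_smul, map_smul, map_smul, smul_eq_mul, smul_eq_mul, mul_sub]
  have hfej : ∀ φ : neumannSpace, ∀ t ∈ Icc c d,
      Tendsto (fun n =>
        m t (fejerTest n (neumannRestrict φ)) - m c (fejerTest n (neumannRestrict φ)))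
        (hyperfilter ℕ : Filter ℕ) (𝓝 (m t φ - m c φ)) := by
    intro φ t ht
    have h1 : Tendsto (fun n => ‖neumannRestrict (fejerTest n (neumannRestrict φ) - φ)‖
        * (m t neumannOne - m c neumannOne)) (hyperfilter ℕ : Filter ℕ) (𝓝 0) := by
      have h := (tendsto_fejerMean (neumannRestrict φ)).mono_left
        (Nat.hyperfilter_le_atTop)
      have h2 := (tendsto_iff_norm_sub_tendsto_zero.1 h).mul_const
        (m t neumannOne - m c neumannOne)
      rw [zero_mul] at h2
      simpa [map_sub, neumannRestrict_fejerTest] using h2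
    rw [tendsto_iff_norm_sub_tendsto_zero]
    refine squeeze_zero (fun _ => norm_nonneg _) (fun n => ?_) h1
    have := abs_increment_le hm (fejerTest n (neumannRestrict φ) - φ) (left_mem_Icc.2 hcd) ht ht.1
    rw [map_sub (m t), map_sub (m c)] at this
    rw [Real.norm_eq_abs]
    refine le_trans (le_of_eq ?_) this
    congr 1; ring
  have hmonoF : ∀ φ : neumannSpace, (∀ x : unitInterval, 0 ≤ φ.1 x) → ∀ n,
      MonotoneOn (fun t => m t (fejerTest n (neumannRestrict φ))) (Icc c d) := fun φ hφ n =>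
    hm _ fun x => by
      rw [← neumannRestrict_apply, neumannRestrict_fejerTest]
      exact fejerMean_nonneg n (fun y => hφ y) x
  have hupper : ∀ φ : neumannSpace, (∀ x : unitInterval, 0 ≤ φ.1 x) → ∀ t ∈ Icc c d, ∀ t' > t,
      ∫ x in {x : Icc c d × unitInterval | (x.1 : ℝ) ≤ t}, φ.1 x.2 ∂μ
        ≤ m (min d t') φ - m c φ := by
    intro φ hφ t ht t' htt'
    have hφc := IsNeumann.continuous φ.2
    have hc' : min d t' ∈ Icc c d := ⟨le_min hcd (ht.1.trans htt'.le), min_le_left _ _⟩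
    calc ∫ x in {x : Icc c d × unitInterval | (x.1 : ℝ) ≤ t}, φ.1 x.2 ∂μ
        = ∫ x in {x : Icc c d × unitInterval | (x.1 : ℝ) ≤ t},
            prodFun (timeCutoff t t') φ x ∂μ := by
          refine setIntegral_congr_fun (measurableSet_le (by fun_prop) (by fun_prop))
            fun x hx => ?_
          simp only [prodFun]
          rw [timeCutoff_eq_one htt' hx, one_mul]
      _ ≤ ∫ x, prodFun (timeCutoff t t') φ x ∂μ := by
          refine setIntegral_le_integral ((hprodc t t' φ).integrable_of_hasCompactSupport
            (HasCompactSupport.of_compactSpace _)) (Eventually.of_forall fun x => ?_)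
          exact mul_nonneg (timeCutoff_nonneg _ _ _) (hφ _)
      _ = Λ ⟨_, hprodc t t' φ⟩ := hμ ⟨_, hprodc t t' φ⟩
      _ ≤ m (min d t') φ - m c φ := by
          refine le_of_tendsto_of_tendsto (hΛ _) (hfej φ _ hc') ?_
          have hne : ∀ᶠ n in (hyperfilter ℕ : Filter ℕ), n ≠ 0 :=
            (eventually_ne_atTop 0).filter_mono (Nat.hyperfilter_le_atTop)
          refine hne.mono fun n hn => ?_
          beta_reduce
          rw [hLprod]
          set M : ℝ → ℝ := fun t => m t (fejerTest n (neumannRestrict φ))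
          have hM : MonotoneOn M (Icc c d) := hmonoF φ hφ n
          have hmem : ∀ i, min (T n i : ℝ) t' ∈ Icc c d := fun i =>
            ⟨le_min (T n i).2.1 (ht.1.trans htt'.le), (min_le_left _ _).trans (T n i).2.2⟩
          have h1 : ∀ i ∈ Finset.range n,
              timeCutoff t t' (T n (i + 1)) * (M (T n (i + 1)) - M (T n i))
              ≤ M (min (T n (i + 1) : ℝ) t') - M (min (T n i : ℝ) t') := by
            intro i _
            rcases le_total t' (T n (i + 1) : ℝ) with h | h
            · rw [timeCutoff_eq_zero htt' h, zero_mul]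
              exact sub_nonneg.2 (hM (hmem i) (hmem (i + 1)) (min_le_min (hTmono n i) le_rfl))
            · rw [min_eq_left h, min_eq_left ((hTmono n i).trans h)]
              refine mul_le_of_le_one_left (sub_nonneg.2 (hM (T n i).2 (T n (i + 1)).2
                (hTmono n i))) (timeCutoff_le_one _ _ _)
          refine (Finset.sum_le_sum h1).trans (le_of_eq ?_)
          rw [Finset.sum_range_sub (fun i => M (min (T n i : ℝ) t')), hT0, hTn n hn,
            min_eq_left (ht.1.trans htt'.le)]
  have hlower : ∀ φ : neumannSpace, (∀ x : unitInterval, 0 ≤ φ.1 x) → ∀ t ∈ Icc c d,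
      ∀ τ ∈ Icc c d, τ < t → m τ φ - m c φ
        ≤ ∫ x in {x : Icc c d × unitInterval | (x.1 : ℝ) ≤ t}, φ.1 x.2 ∂μ := by
    intro φ hφ t ht τ hτ hτt
    have hφc := IsNeumann.continuous φ.2
    set σ := (τ + t) / 2 with hσ
    have hτσ : τ < σ := by linarith
    have hσt : σ < t := by linarith
    have hmeasA : MeasurableSet {x : Icc c d × unitInterval | (x.1 : ℝ) ≤ t} :=
      measurableSet_le (by fun_prop) (by fun_prop)
    calc m τ φ - m c φ ≤ Λ ⟨_, hprodc σ t φ⟩ := by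
          refine le_of_tendsto_of_tendsto (hfej φ _ hτ) (hΛ _) ?_
          have hmesh : ∀ᶠ n : ℕ in atTop, (d - c) / n < σ - τ :=
            (tendsto_const_div_atTop_nhds_zero_nat (d - c)).eventually_lt_const (by linarith)
          have hev := (hmesh.and (eventually_ne_atTop 0)).filter_mono
            (Nat.hyperfilter_le_atTop)
          refine hev.mono fun n hn => ?_
          beta_reduce
          rw [hLprod]
          set M : ℝ → ℝ := fun t => m t (fejerTest n (neumannRestrict φ))
          have hM : MonotoneOn M (Icc c d) := hmonoF φ hφ n
          have hmem : ∀ i, min (T n i : ℝ) τ ∈ Icc c d := fun i =>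
            ⟨le_min (T n i).2.1 hτ.1, (min_le_left _ _).trans (T n i).2.2⟩
          have h1 : ∀ i ∈ Finset.range n, M (min (T n (i + 1) : ℝ) τ) - M (min (T n i : ℝ) τ)
              ≤ timeCutoff σ t (T n (i + 1)) * (M (T n (i + 1)) - M (T n i)) := by
            intro i _
            rcases le_total τ (T n i : ℝ) with h | h
            · rw [min_eq_right h, min_eq_right (h.trans (hTmono n i)), sub_self]
              exact mul_nonneg (timeCutoff_nonneg _ _ _)
                (sub_nonneg.2 (hM (T n i).2 (T n (i + 1)).2 (hTmono n i)))
            · rw [timeCutoff_eq_one hσt (by linarith [hTmesh n i, hn.1]), one_mul, min_eq_left h]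
              exact sub_le_sub_right (hM (hmem (i + 1)) (T n (i + 1)).2 (min_le_left _ _)) _
          refine le_trans (le_of_eq ?_) (Finset.sum_le_sum h1)
          rw [Finset.sum_range_sub (fun i => M (min (T n i : ℝ) τ)), hT0, hTn n hn.2,
            min_eq_left hτ.1, min_eq_right hτ.2]
      _ = ∫ x, prodFun (timeCutoff σ t) φ x ∂μ := (hμ ⟨_, hprodc σ t φ⟩).symm
      _ = ∫ x in {x : Icc c d × unitInterval | (x.1 : ℝ) ≤ t},
            prodFun (timeCutoff σ t) φ x ∂μ := by
          refine (setIntegral_eq_integral_of_forall_compl_eq_zero fun x hx => ?_).symm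
          simp only [prodFun]
          rw [timeCutoff_eq_zero hσt (not_le.1 hx).le, zero_mul]
      _ ≤ ∫ x in {x : Icc c d × unitInterval | (x.1 : ℝ) ≤ t}, φ.1 x.2 ∂μ := by
          refine setIntegral_mono_on ?_ ?_ hmeasA fun x hx => ?_
          · exact ((hprodc σ t φ).integrable_of_hasCompactSupport
              (HasCompactSupport.of_compactSpace _)).integrableOn
          · exact (Continuous.integrable_of_hasCompactSupport (by fun_prop)
              (HasCompactSupport.of_compactSpace _)).integrableOn
          · exact mul_le_of_le_one_left (hφ _) (timeCutoff_le_one _ _ _)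
  have heq : ∀ φ : neumannSpace, (∀ x : unitInterval, 0 ≤ φ.1 x) → ∀ t ∈ Icc c d,
      ∫ x in {x : Icc c d × unitInterval | (x.1 : ℝ) ≤ t}, φ.1 x.2 ∂μ = m t φ - m c φ := by
    intro φ hφ t ht
    apply le_antisymm
    · have hcont : Tendsto (fun t' => m (min d t') φ - m c φ) (𝓝[>] t) (𝓝 (m t φ - m c φ)) := by
        refine Tendsto.sub_const ?_ _
        have h1 : Tendsto (fun t' => min d t') (𝓝[>] t) (𝓝[Icc c d] t) := by
          refine tendsto_nhdsWithin_iff.2 ⟨?_, ?_⟩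
          · have : Continuous fun t' => min d t' := by fun_prop
            have h := (this.tendsto t).mono_left (nhdsWithin_le_nhds (s := Ioi t))
            rwa [min_eq_right ht.2] at h
          · filter_upwards [self_mem_nhdsWithin] with t' ht'
            exact ⟨le_min hcd (ht.1.trans (le_of_lt ht')), min_le_left _ _⟩
        exact (hmc φ t ht).tendsto.comp h1
      exact ge_of_tendsto hcont (eventually_mem_nhdsWithin.mono fun t' ht' =>
        hupper φ hφ t ht t' ht')
    · rcases ht.1.eq_or_lt with h | h
      · rw [← h, sub_self]
        exact integral_nonneg fun x => hφ _
      · have hne : (𝓝[Ioo c t] t).NeBot := by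
          rw [← mem_closure_iff_nhdsWithin_neBot, closure_Ioo h.ne]
          exact right_mem_Icc.2 h.le
        have hsub : Ioo c t ⊆ Icc c d := fun s hs => ⟨hs.1.le, hs.2.le.trans ht.2⟩
        refine le_of_tendsto (((hmc φ t ht).mono_left (nhdsWithin_mono t hsub)).sub_const _)
          (eventually_mem_nhdsWithin.mono fun τ hτ => hlower φ hφ t ht τ (hsub hτ) hτ.2)
  -- Transport to the whole space-time.
  have hemb : MeasurableEmbedding (fun x : Icc c d × unitInterval => ((x.1 : ℝ), x.2)) := by
    have : Topology.IsClosedEmbedding (fun x : Icc c d × unitInterval => ((x.1 : ℝ), x.2)) :=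
      isClosed_Icc.isClosedEmbedding_subtypeVal.prodMap Topology.IsClosedEmbedding.id
    exact this.measurableEmbedding
  refine ⟨μ.map fun x => ((x.1 : ℝ), x.2), ?_, fun φ t ht => ?_⟩
  · exact measure_lt_top _ _
  · have hφc := IsNeumann.continuous φ.2
    rw [hemb.setIntegral_map]
    have hpre : (fun x : Icc c d × unitInterval => ((x.1 : ℝ), x.2)) ⁻¹' strip c t
        = {x | (x.1 : ℝ) ≤ t} := by
      ext x
      simp only [strip, mem_preimage, mem_prod, mem_Icc, mem_univ, and_true, mem_ofPred_eq]
      exact ⟨fun h => h.2, fun h => ⟨x.1.2.1, h⟩⟩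
    rw [hpre]
    set C := ‖neumannRestrict φ‖
    have h1 := heq (φ + C • neumannOne) (fun x => by
      have := (abs_le.1 ((neumannRestrict φ).norm_coe_le_norm x)).1
      change 0 ≤ φ.1 x + C * 1
      simp only [neumannRestrict_apply] at this
      linarith) t ht
    have h2 := heq neumannOne (fun x => zero_le_one) t ht
    have hi : ∀ ψ : neumannSpace, IntegrableOn (fun x : Icc c d × unitInterval => ψ.1 x.2)
        {x | (x.1 : ℝ) ≤ t} μ := fun ψ => by
      have := IsNeumann.continuous ψ.2
      exact (Continuous.integrable_of_hasCompactSupport (by fun_prop)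
        (HasCompactSupport.of_compactSpace _)).integrableOn
    have h3 : ∫ x in {x : Icc c d × unitInterval | (x.1 : ℝ) ≤ t}, (φ + C • neumannOne).1 x.2 ∂μ
        = (∫ x in {x : Icc c d × unitInterval | (x.1 : ℝ) ≤ t}, φ.1 x.2 ∂μ)
          + C * ∫ x in {x : Icc c d × unitInterval | (x.1 : ℝ) ≤ t}, neumannOne.1 x.2 ∂μ := by
      rw [← integral_const_mul, ← integral_add (hi φ) ((hi neumannOne).const_mul C)]
      rfl
    rw [h3, h2] at h1
    simp only [map_add, map_smul, smul_eq_mul] at h1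
    linarith

end Increments

/-! ### The reflection measures of a solution of the variational inequality -/

/-- Urysohn's lemma with test functions. -/
lemma exists_isNeumann_urysohn {A B : Set unitInterval} (hA : IsClosed A) (hB : IsClosed B)
    (hAB : Disjoint A B) :
    ∃ φ : ℝ → ℝ, IsNeumann φ ∧ (∀ x : unitInterval, 0 ≤ φ x ∧ φ x ≤ 1) ∧
      (∀ x ∈ A, φ (x : ℝ) = 0) ∧ ∀ x ∈ B, φ (x : ℝ) = 1 := by
  obtain ⟨f, hf0, hf1, -⟩ := exists_continuous_zero_one_of_isClosed hA hB hAB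
  obtain ⟨N, hN⟩ := ((tendsto_fejerMean f).eventually
    (Metric.ball_mem_nhds f (show (0 : ℝ) < 1 / 4 by norm_num))).exists
  have hclose : ∀ x : unitInterval, |(fejerTest N f).1 x - f x| < 1 / 4 := by
    intro x
    rw [dist_eq_norm] at hN
    refine lt_of_le_of_lt ?_ hN
    have := (fejerMean N f - f).norm_coe_le_norm x
    rwa [← neumannRestrict_fejerTest] at this ⊢
  refine ⟨fun x => Real.smoothTransition (2 * (fejerTest N f).1 x - 1 / 2), ?_, fun x => ?_,
    fun x hx => ?_, fun x hx => ?_⟩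
  · exact IsNeumann.comp (S := fun y => Real.smoothTransition (2 * y - 1 / 2)) (fejerTest N f).2
      (Real.smoothTransition.contDiff.comp (by fun_prop))
  · exact ⟨Real.smoothTransition.nonneg _, Real.smoothTransition.le_one _⟩
  · have h1 := hclose x
    rw [hf0 hx, Pi.zero_apply, sub_zero, abs_lt] at h1
    exact Real.smoothTransition.zero_of_nonpos (by linarith)
  · have h1 := hclose x
    rw [hf1 hx, Pi.one_apply, abs_lt] at h1
    exact Real.smoothTransition.one_of_one_le (by linarith)

variable {K₁ K₂ : C(unitInterval, ℝ)} {a b : ℝ} {v : ℝ → C(unitInterval, ℝ)}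
  {g : ℝ × unitInterval → ℝ}

/-- The localized residual, as a linear functional of the test function. -/
def residualMap (hv : ContinuousOn v (Icc a b)) (hg : IntegrableOn g (strip a b)) {χ : ℝ → ℝ}
    (hχ : IsNeumann χ) {t : ℝ} (ht : t ≤ b) : neumannSpace →ₗ[ℝ] ℝ where
  toFun φ := residual a v g (fun x => χ x * φ.1 x) t
  map_add' φ ψ := by
    rw [← residual_add hv hg (hχ.mul φ.2) (hχ.mul ψ.2) ht]
    congr 1
    funext x
    exact mul_add _ _ _
  map_smul' r φ := by
    rw [RingHom.id_apply, smul_eq_mul, ← residual_const_mul (hχ.mul φ.2)]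
    congr 1
    funext x
    exact mul_left_comm _ _ _

lemma residualMap_apply (hv : ContinuousOn v (Icc a b)) (hg : IntegrableOn g (strip a b))
    {χ : ℝ → ℝ} (hχ : IsNeumann χ) {t : ℝ} (ht : t ≤ b) (φ : neumannSpace) :
    residualMap hv hg hχ ht φ = residual a v g (fun x => χ x * φ.1 x) t := rfl

/-- The localized residual increases in time where the cutoff `χ` keeps away from the upper wall:
there the path may be pushed upwards. -/
lemma IsEVI.residual_localized_mono (h : IsEVI K₁ K₂ a b v g)
    (h0 : (0 : C(unitInterval, ℝ)) ∈ wallSpace K₁ K₂) {χ φ : ℝ → ℝ} (hχ : IsNeumann χ)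
    (hχ01 : ∀ x : unitInterval, 0 ≤ χ x ∧ χ x ≤ 1) (hφ : IsNeumann φ)
    (hφ0 : ∀ x : unitInterval, 0 ≤ φ x) {c d δ : ℝ} (hac : a ≤ c) (hcd : c ≤ d) (hdb : d ≤ b)
    (hδ : 0 < δ) (hsep : ∀ s ∈ Icc c d, ∀ x : unitInterval, χ x ≠ 0 → v s x + δ ≤ K₂ x) :
    residual a v g (fun x => χ x * φ x) c ≤ residual a v g (fun x => χ x * φ x) d := by
  set C := ‖restrictUnit φ hφ.continuous‖
  refine h.residual_mono h0 (hχ.mul hφ) hac hcd hdb (ε₀ := δ / (C + 1)) (by positivity)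
    fun ε hε hεle s hs x => ?_
  have hw := h.mem_wallSpace s ⟨hac.trans hs.1, hs.2.trans hdb⟩ x
  change K₁ x ≤ v s x + ε * (χ x * φ x) ∧ v s x + ε * (χ x * φ x) ≤ K₂ x
  have h1 := mul_nonneg hε.le (mul_nonneg (hχ01 x).1 (hφ0 x))
  refine ⟨by linarith, ?_⟩
  by_cases hx : χ x = 0
  · rw [hx]; linarith
  · have h2 : φ x ≤ C := (le_abs_self _).trans ((restrictUnit φ hφ.continuous).norm_coe_le_norm x)
    have h3 : χ x * φ x ≤ C + 1 := by
      have := mul_le_of_le_one_left (hφ0 x) (hχ01 x).2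
      linarith
    have h4 : ε * (χ x * φ x) ≤ δ := by
      calc ε * (χ x * φ x) ≤ δ / (C + 1) * (C + 1) :=
            mul_le_mul hεle h3 (mul_nonneg (hχ01 x).1 (hφ0 x)) (by positivity)
        _ = δ := div_mul_cancel₀ δ (by positivity)
    linarith [hsep s hs x hx]

/-- The localized residual decreases in time, when tested where the path is away from the lower
wall: there the path may be pushed downwards. -/
lemma IsEVI.residual_localized_antitone (h : IsEVI K₁ K₂ a b v g)
    (h0 : (0 : C(unitInterval, ℝ)) ∈ wallSpace K₁ K₂) {χ φ : ℝ → ℝ} (hχ : IsNeumann χ)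
    (hχ01 : ∀ x : unitInterval, 0 ≤ χ x ∧ χ x ≤ 1) (hφ : IsNeumann φ)
    (hφ01 : ∀ x : unitInterval, 0 ≤ φ x ∧ φ x ≤ 1) {c d δ : ℝ} (hac : a ≤ c) (hcd : c ≤ d)
    (hdb : d ≤ b) (hδ : 0 < δ)
    (hsep : ∀ s ∈ Icc c d, ∀ x : unitInterval, φ x ≠ 0 → K₁ x + δ ≤ v s x) :
    residual a v g (fun x => χ x * φ x) d ≤ residual a v g (fun x => χ x * φ x) c := by
  have hn := (hχ.mul hφ).const_mul (-1)
  have := h.residual_mono h0 hn hac hcd hdb (ε₀ := δ) hδ fun ε hε hεle s hs x => by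
    have hw := h.mem_wallSpace s ⟨hac.trans hs.1, hs.2.trans hdb⟩ x
    change K₁ x ≤ v s x + ε * (-1 * (χ x * φ x)) ∧ v s x + ε * (-1 * (χ x * φ x)) ≤ K₂ x
    have h1 := mul_nonneg hε.le (mul_nonneg (hχ01 x).1 (hφ01 x).1)
    refine ⟨?_, by linarith⟩
    by_cases hx : φ x = 0
    · rw [hx]; linarith
    · have h2 : χ x * φ x ≤ 1 := mul_le_one₀ (hχ01 x).2 (hφ01 x).1 (hφ01 x).2
      have h3 : ε * (χ x * φ x) ≤ δ := by
        calc ε * (χ x * φ x) ≤ ε * 1 := mul_le_mul_of_nonneg_left h2 hε.le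
          _ ≤ δ := by linarith
      linarith [hsep s hs x hx]
  rw [residual_const_mul (hχ.mul hφ), residual_const_mul (hχ.mul hφ)] at this
  linarith

/-- The lower reflection measure on a time interval on which a single cutoff separates the contact
sets of the two walls. -/
lemma IsEVI.exists_reflection_measure (h : IsEVI K₁ K₂ a b v g)
    (h0 : (0 : C(unitInterval, ℝ)) ∈ wallSpace K₁ K₂) {χ : ℝ → ℝ} (hχ : IsNeumann χ)
    (hχ01 : ∀ x : unitInterval, 0 ≤ χ x ∧ χ x ≤ 1) {c d δ : ℝ} (hac : a ≤ c) (hcd : c ≤ d)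
    (hdb : d ≤ b) (hδ : 0 < δ)
    (hsep : ∀ s ∈ Icc c d, ∀ x : unitInterval, χ x ≠ 0 → v s x + δ ≤ K₂ x) :
    ∃ η : Measure (ℝ × unitInterval), η (strip c d) < ⊤ ∧
      (∀ φ, IsNeumann φ → ∀ t ∈ Icc c d, ∫ p in strip c t, φ p.2 ∂η
        = residual a v g (fun x => χ x * φ x) t - residual a v g (fun x => χ x * φ x) c) ∧
      ∫ p in strip c d, (v p.1 p.2 - K₁ p.2) ∂η = 0 := by
  have hv := h.continuousOn
  have hg := MemLp.integrableOn_strip h.memLp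
  have hab : a ≤ b := hac.trans (hcd.trans hdb)
  obtain ⟨η, hηfin, hη⟩ := exists_measure_of_increments (c := c) (d := d)
    (m := fun t => residualMap hv hg hχ (t := min t b) (min_le_right t b)) hcd
    (fun φ hφ s hs t ht hst => by
      simp only [residualMap_apply]
      rw [min_eq_left (hs.2.trans hdb), min_eq_left (ht.2.trans hdb)]
      exact h.residual_localized_mono h0 hχ hχ01 φ.2 hφ (hac.trans hs.1) hst (ht.2.trans hdb) hδ
        fun r hr => hsep r ⟨hs.1.trans hr.1, hr.2.trans ht.2⟩)
    (fun φ => by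
      refine ((continuousOn_residual hab hv hg (hχ.mul φ.2)).mono
        (Icc_subset_Icc hac hdb)).congr fun t ht => ?_
      simp only [residualMap_apply]
      rw [min_eq_left (ht.2.trans hdb)])
  have hform : ∀ φ, IsNeumann φ → ∀ t ∈ Icc c d, ∫ p in strip c t, φ p.2 ∂η
        = residual a v g (fun x => χ x * φ x) t - residual a v g (fun x => χ x * φ x) c := by
    intro φ hφ t ht
    have := hη ⟨φ, hφ⟩ t ht
    rw [this]
    simp only [residualMap_apply]
    rw [min_eq_left (ht.2.trans hdb), min_eq_left (hcd.trans hdb)]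
  refine ⟨η, hηfin, hform, ?_⟩
  have hvcd : ContinuousOn v (Icc c d) := hv.mono (Icc_subset_Icc hac hdb)
  have hmem : ∀ p ∈ strip c d, K₁ p.2 ≤ v p.1 p.2 ∧ v p.1 p.2 ≤ K₂ p.2 := fun p hp =>
    h.mem_wallSpace p.1 ⟨hac.trans hp.1.1, hp.1.2.trans hdb⟩ p.2
  set C := ‖K₂ - K₁‖
  have hC : ∀ x, K₂ x - K₁ x ≤ C := fun x =>
    (le_abs_self _).trans ((K₂ - K₁).norm_coe_le_norm x)
  have hvK : ContinuousOn (fun p : ℝ × unitInterval => v p.1 p.2 - K₁ p.2) (strip c d) :=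
    (continuousOn_eval hvcd).sub (Continuous.continuousOn (by fun_prop))
  -- The measure does not charge the set on which `v` exceeds `K₁` by more than `δ₁`: on short time
  -- intervals, test with a cutoff `φ` supported where `v` is away from `K₁`.
  have hzero : ∀ δ₁ > 0, ∫ p in strip c d, max 0 (v p.1 p.2 - K₁ p.2 - δ₁) ∂η ≤ 0 := by
    intro δ₁ hδ₁
    have hpc : ContinuousOn (fun p : ℝ × unitInterval => max 0 (v p.1 p.2 - K₁ p.2 - δ₁))
        (strip c d) := continuousOn_const.sup (hvK.sub continuousOn_const)
    have hpi := integrableOn_strip_of_continuousOn hηfin hpc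
    obtain ⟨ρ, hρ, hosc⟩ := Metric.uniformContinuousOn_iff.1
      (isCompact_Icc.uniformContinuousOn_of_continuous hvcd) (δ₁ / 4) (by positivity)
    have hloc : ∀ s t, c ≤ s → s ≤ t → t ≤ d → t - s < ρ →
        (∫ p in strip c t, max 0 (v p.1 p.2 - K₁ p.2 - δ₁) ∂η)
          ≤ ∫ p in strip c s, max 0 (v p.1 p.2 - K₁ p.2 - δ₁) ∂η := by
      intro s t hcs hst htd hts
      have hsub := slab_subset_strip hcs htd
      have hosc' : ∀ r ∈ Icc s t, ∀ x, |v r x - v s x| ≤ δ₁ / 4 := fun r hr x => by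
        have := hosc r ⟨hcs.trans hr.1, hr.2.trans htd⟩ s ⟨hcs, hst.trans htd⟩ (by
          rw [Real.dist_eq, abs_of_nonneg (by linarith [hr.1])]
          linarith [hr.2])
        rw [dist_eq_norm] at this
        exact ((v r - v s).norm_coe_le_norm x).trans this.le
      obtain ⟨φ, hφ, hφ01, hφA, hφB⟩ := exists_isNeumann_urysohn
        (A := {x | v s x ≤ K₁ x + δ₁ / 2}) (B := {x | K₁ x + 3 * δ₁ / 4 ≤ v s x})
        (isClosed_le (by fun_prop) (by fun_prop)) (isClosed_le (by fun_prop) (by fun_prop)) (by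
          rw [Set.disjoint_left]
          intro x hx hx'
          simp only [mem_ofPred_eq] at hx hx'
          linarith)
      have hanti := h.residual_localized_antitone h0 hχ hχ01 hφ hφ01 (δ := δ₁ / 4)
        (hac.trans hcs) hst (htd.trans hdb) (by positivity) fun r hr x hx => by
          have h1 : ¬ (v s x ≤ K₁ x + δ₁ / 2) := fun hc => hx (hφA x hc)
          have h2 := (abs_le.1 (hosc' r hr x)).1
          linarith
      have hφc := hφ.continuous
      have hφi : IntegrableOn (fun p : ℝ × unitInterval => φ p.2) (strip c d) η :=
        integrableOn_strip_of_continuousOn hηfin (Continuous.continuousOn (by fun_prop))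
      have e1 := setIntegral_strip_add hcs hst
        (hφi.mono_set (strip_subset_strip le_rfl htd))
      rw [hform φ hφ t ⟨hcs.trans hst, htd⟩, hform φ hφ s ⟨hcs, hst.trans htd⟩] at e1
      rw [setIntegral_strip_add hcs hst (hpi.mono_set (strip_subset_strip le_rfl htd))]
      have e2 : ∫ p in slab s t, max 0 (v p.1 p.2 - K₁ p.2 - δ₁) ∂η
          ≤ C * ∫ p in slab s t, φ p.2 ∂η := by
        rw [← integral_const_mul]
        refine setIntegral_mono_on (hpi.mono_set hsub) ((hφi.mono_set hsub).const_mul C)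
          (measurableSet_slab s t) fun p hp => ?_
        have hm := hmem p (hsub hp)
        have h3 := hosc' p.1 ⟨hp.1.1.le, hp.1.2⟩ p.2
        have h4 := mul_nonneg (norm_nonneg (K₂ - K₁)) (hφ01 p.2).1
        refine max_le h4 ?_
        rcases le_total (v p.1 p.2 - K₁ p.2 - δ₁) 0 with h5 | h5
        · exact h5.trans h4
        · have h6 : φ p.2 = 1 := hφB p.2 (by
            simp only [mem_ofPred_eq]
            linarith [(abs_le.1 h3).2])
          rw [h6]
          linarith [hC p.2]
      have e3 : C * ∫ p in slab s t, φ p.2 ∂η ≤ 0 :=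
        mul_nonpos_of_nonneg_of_nonpos (norm_nonneg _) (by linarith)
      linarith
    refine (le_of_locally_le hρ hloc le_rfl hcd le_rfl).trans ?_
    have e1 := hform (fun _ => 1) (IsNeumann.const 1) c ⟨le_rfl, hcd⟩
    rw [sub_self] at e1
    have hsub : strip c c ⊆ strip c d := strip_subset_strip le_rfl hcd
    have h1i : IntegrableOn (fun _ : ℝ × unitInterval => (1 : ℝ)) (strip c c) η :=
      (integrableOn_const hηfin.ne).mono_set hsub
    calc ∫ p in strip c c, max 0 (v p.1 p.2 - K₁ p.2 - δ₁) ∂η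
        ≤ ∫ p in strip c c, C * 1 ∂η := by
          refine setIntegral_mono_on (hpi.mono_set hsub) (h1i.const_mul C)
            (measurableSet_strip c c) fun p hp => ?_
          have hm := hmem p (hsub hp)
          refine max_le (by positivity) ?_
          linarith [hC p.2]
      _ = 0 := by rw [integral_const_mul, e1, mul_zero]
  have hvi := integrableOn_strip_of_continuousOn hηfin hvK
  apply le_antisymm
  · have hle : ∀ δ₁ > 0, ∫ p in strip c d, (v p.1 p.2 - K₁ p.2) ∂η
        ≤ 0 + δ₁ * η.real (strip c d) := by
      intro δ₁ hδ₁
      have h1i : IntegrableOn (fun _ : ℝ × unitInterval => δ₁) (strip c d) η :=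
        integrableOn_const hηfin.ne
      have hpi := integrableOn_strip_of_continuousOn (q := fun p : ℝ × unitInterval =>
        max 0 (v p.1 p.2 - K₁ p.2 - δ₁)) hηfin (continuousOn_const.sup (hvK.sub continuousOn_const))
      calc ∫ p in strip c d, (v p.1 p.2 - K₁ p.2) ∂η
          ≤ ∫ p in strip c d, (max 0 (v p.1 p.2 - K₁ p.2 - δ₁) + δ₁) ∂η := by
            refine setIntegral_mono_on hvi (hpi.add h1i) (measurableSet_strip c d) fun p _ => ?_
            have := le_max_right 0 (v p.1 p.2 - K₁ p.2 - δ₁)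
            linarith
        _ = (∫ p in strip c d, max 0 (v p.1 p.2 - K₁ p.2 - δ₁) ∂η) + δ₁ * η.real (strip c d) := by
            rw [integral_add hpi h1i, setIntegral_const, smul_eq_mul, mul_comm]
        _ ≤ _ := by linarith [hzero δ₁ hδ₁]
    refine le_of_forall_pos_le_add fun ε hε => ?_
    have h1 := hle (ε / (η.real (strip c d) + 1)) (by positivity)
    have h2 : ε / (η.real (strip c d) + 1) * η.real (strip c d) ≤ ε := by
      rw [div_mul_eq_mul_div, div_le_iff₀ (by positivity)]
      have : 0 ≤ η.real (strip c d) := measureReal_nonneg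
      nlinarith
    linarith
  · exact setIntegral_nonneg (measurableSet_strip c d) fun p hp => sub_nonneg.2 (hmem p hp).1

/-- The reflection `v ↦ -v` exchanges the two walls. -/
lemma IsEVI.neg (h : IsEVI K₁ K₂ a b v g) :
    IsEVI (-K₂) (-K₁) a b (fun t => -v t) (fun p => -g p) := by
  have hmem : ∀ u : C(unitInterval, ℝ), u ∈ wallSpace (-K₂) (-K₁) ↔ -u ∈ wallSpace K₁ K₂ := by
    intro u
    simp only [wallSpace, mem_ofPred_eq, ContinuousMap.neg_apply]
    exact forall_congr' fun x => ⟨fun h => ⟨by linarith [h.2], by linarith [h.1]⟩,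
      fun h => ⟨by linarith [h.2], by linarith [h.1]⟩⟩
  refine ⟨h.continuousOn.neg, fun t ht => (hmem _).2 ?_, h.memLp.neg, ?_⟩
  · rw [neg_neg]; exact h.mem_wallSpace t ht
  · intro x hx E hE s t has hst htb K
    have h1 := h.evi (-x) ((hmem x).1 hx) E hE.neg s t has hst htb K
    have e : ∀ r, ‖toL2 (-v r - x)‖ = ‖toL2 (v r - -x)‖ := fun r => by
      rw [← norm_neg, ← map_neg]; congr 2; abel
    rw [e, e]
    simp only [partialEnergy_neg]
    refine h1.trans (le_of_eq ?_)
    congr 2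
    funext p
    simp only [ContinuousMap.neg_apply]
    ring

lemma residual_neg (φ : ℝ → ℝ) (t : ℝ) :
    residual a (fun t => -v t) (fun p => -g p) φ t = -residual a v g φ t := by
  unfold residual
  have e1 : ∫ x : unitInterval, (-v t) x * φ x = -∫ x : unitInterval, v t x * φ x := by
    rw [← integral_neg]; congr 1; funext x; simp
  have e2 : ∫ p in slab a t, ((-v p.1) p.2 * deriv (deriv φ) p.2 + -g p * φ p.2)
      = -∫ p in slab a t, (v p.1 p.2 * deriv (deriv φ) p.2 + g p * φ p.2) := by
    rw [← integral_neg]; congr 1; funext p; simp; ring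
  rw [e1, e2]; ring

/-- The reflection measures of the path `v` on the time interval `[c,d]`. -/
structure IsReflection (K₁ K₂ : C(unitInterval, ℝ)) (a : ℝ) (v : ℝ → C(unitInterval, ℝ))
    (g : ℝ × unitInterval → ℝ) (c d : ℝ) (η ξ : Measure (ℝ × unitInterval)) : Prop where
  eta_finite : η (strip c d) < ⊤
  xi_finite : ξ (strip c d) < ⊤
  residual_eq : ∀ φ, IsNeumann φ → ∀ t ∈ Icc c d,
    (∫ p in strip c t, φ p.2 ∂η) - (∫ p in strip c t, φ p.2 ∂ξ)
      = residual a v g φ t - residual a v g φ c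
  eta_support : ∫ p in strip c d, (v p.1 p.2 - K₁ p.2) ∂η = 0
  xi_support : ∫ p in strip c d, (K₂ p.2 - v p.1 p.2) ∂ξ = 0

/-- Reflection measures on a time interval on which the path oscillates less than the gap between
the walls: a cutoff `χ`, zero near the contact set of the upper wall and one near that of the lower
wall, splits the residual into its increasing and its decreasing part. -/
lemma IsEVI.exists_isReflection_local (h : IsEVI K₁ K₂ a b v g)
    (h0 : (0 : C(unitInterval, ℝ)) ∈ wallSpace K₁ K₂) {δ c d : ℝ} (hδ : 0 < δ)
    (hgap : ∀ x, K₁ x + 4 * δ ≤ K₂ x) (hac : a ≤ c) (hcd : c ≤ d) (hdb : d ≤ b)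
    (hosc : ∀ s ∈ Icc c d, ‖v s - v c‖ ≤ δ) :
    ∃ η ξ, IsReflection K₁ K₂ a v g c d η ξ := by
  have hv := h.continuousOn
  have hg := MemLp.integrableOn_strip h.memLp
  have hosc' : ∀ s ∈ Icc c d, ∀ x, |v s x - v c x| ≤ δ := fun s hs x =>
    ((v s - v c).norm_coe_le_norm x).trans (hosc s hs)
  obtain ⟨χ, hχ, hχ01, hχA, hχB⟩ := exists_isNeumann_urysohn
    (A := {x | K₂ x ≤ v c x + 2 * δ}) (B := {x | v c x + 2 * δ ≤ K₁ x + 4 * δ - δ / 2})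
    (isClosed_le (by fun_prop) (by fun_prop)) (isClosed_le (by fun_prop) (by fun_prop)) (by
      rw [Set.disjoint_left]
      intro x hx hx'
      simp only [mem_ofPred_eq] at hx hx'
      linarith [hgap x])
  obtain ⟨η, hη1, hη2, hη3⟩ := h.exists_reflection_measure h0 hχ hχ01 hac hcd hdb hδ
    fun s hs x hx => by
      have h1 : ¬ (K₂ x ≤ v c x + 2 * δ) := fun hc => hx (hχA x hc)
      have := (abs_le.1 (hosc' s hs x)).2
      linarith
  -- The upper measure belongs to the complementary cutoff and the reflected path `-v`.
  set χ' : ℝ → ℝ := fun x => 1 + -1 * χ x with hχ'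
  have hχ'N : IsNeumann χ' := (IsNeumann.const 1).add (hχ.const_mul (-1))
  have h0' : (0 : C(unitInterval, ℝ)) ∈ wallSpace (-K₂) (-K₁) := fun x => by
    have := h0 x
    simp only [ContinuousMap.zero_apply, ContinuousMap.neg_apply] at this ⊢
    constructor <;> linarith
  obtain ⟨ξ, hξ1, hξ2, hξ3⟩ := h.neg.exists_reflection_measure h0' hχ'N
    (fun x => by simp only [hχ']; constructor <;> linarith [(hχ01 x).1, (hχ01 x).2])
    hac hcd hdb (δ := δ / 2) (by positivity) fun s hs x hx => by
      have h1 : ¬ (v c x + 2 * δ ≤ K₁ x + 4 * δ - δ / 2) := fun hc => hx (by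
        simp only [hχ']; rw [hχB x hc]; ring)
      have := (abs_le.1 (hosc' s hs x)).1
      simp only [ContinuousMap.neg_apply]
      linarith
  refine ⟨η, ξ, hη1, hξ1, fun φ hφ t ht => ?_, hη3, ?_⟩
  · rw [hη2 φ hφ t ht, hξ2 φ hφ t ht, residual_neg, residual_neg]
    have hsplit : ∀ t ≤ b, residual a v g φ t = residual a v g (fun x => χ x * φ x) t
        + residual a v g (fun x => χ' x * φ x) t := by
      intro t ht
      rw [← residual_add hv hg (hχ.mul hφ) (hχ'N.mul hφ) ht]
      congr 1
      funext x
      simp only [hχ']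
      ring
    rw [hsplit t (ht.2.trans hdb), hsplit c (hcd.trans hdb)]
    ring
  · rw [← hξ3]
    congr 1
    funext p
    simp only [ContinuousMap.neg_apply]
    ring

lemma IsReflection.glue {c d e : ℝ} {η₁ ξ₁ η₂ ξ₂ : Measure (ℝ × unitInterval)} (hcd : c ≤ d)
    (hde : d ≤ e) (hv : ContinuousOn v (Icc c e)) (h₁ : IsReflection K₁ K₂ a v g c d η₁ ξ₁)
    (h₂ : IsReflection K₁ K₂ a v g d e η₂ ξ₂) :
    IsReflection K₁ K₂ a v g c e (η₁.restrict (strip c d) + η₂.restrict (strip d e))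
      (ξ₁.restrict (strip c d) + ξ₂.restrict (strip d e)) := by
  have m1 := measurableSet_strip c d
  have m2 := measurableSet_strip d e
  have hi : ∀ {ν₁ ν₂ : Measure (ℝ × unitInterval)} {q : ℝ × unitInterval → ℝ} {t : ℝ},
      ν₁ (strip c d) < ⊤ → ν₂ (strip d e) < ⊤ → ContinuousOn q (strip c e) → t ∈ Icc c e →
      ∫ p in strip c t, q p ∂(ν₁.restrict (strip c d) + ν₂.restrict (strip d e))
      = (∫ p in strip c (min t d), q p ∂ν₁) + ∫ p in strip d t, q p ∂ν₂ := by
    intro ν₁ ν₂ q t hν₁ hν₂ hq ht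
    rw [Measure.restrict_add, Measure.restrict_restrict (measurableSet_strip c t),
      Measure.restrict_restrict (measurableSet_strip c t)]
    have s1 : strip c t ∩ strip c d = strip c (min t d) := by
      rw [strip, strip, strip, prod_inter_prod, univ_inter, Icc_inter_Icc, max_self]
    have s2 : strip c t ∩ strip d e = strip d t := by
      rw [strip, strip, strip, prod_inter_prod, univ_inter, Icc_inter_Icc, max_eq_right hcd,
        min_eq_left ht.2]
    rw [s1, s2]
    have q1 : IntegrableOn q (strip c d) ν₁ := integrableOn_strip_of_continuousOn hν₁
      (hq.mono (strip_subset_strip le_rfl hde))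
    have q2 : IntegrableOn q (strip d e) ν₂ := integrableOn_strip_of_continuousOn hν₂
      (hq.mono (strip_subset_strip hcd le_rfl))
    exact integral_add_measure (q1.mono_set (strip_subset_strip le_rfl (min_le_right _ _)))
      (q2.mono_set (strip_subset_strip le_rfl ht.2))
  have hfin : ∀ {ν₁ ν₂ : Measure (ℝ × unitInterval)}, ν₁ (strip c d) < ⊤ → ν₂ (strip d e) < ⊤ →
      (ν₁.restrict (strip c d) + ν₂.restrict (strip d e)) (strip c e) < ⊤ := by
    intro ν₁ ν₂ hν₁ hν₂
    rw [Measure.add_apply]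
    refine ENNReal.add_lt_top.2 ⟨?_, ?_⟩
    · exact ((measure_mono (subset_univ _)).trans_eq (Measure.restrict_apply_univ _)).trans_lt hν₁
    · exact ((measure_mono (subset_univ _)).trans_eq (Measure.restrict_apply_univ _)).trans_lt hν₂
  have hec : e ∈ Icc c e := ⟨hcd.trans hde, le_rfl⟩
  have hvK : ∀ K : C(unitInterval, ℝ), ContinuousOn (fun p : ℝ × unitInterval => K p.2)
    (strip c e) := fun K => Continuous.continuousOn (by fun_prop)
  refine ⟨hfin h₁.eta_finite h₂.eta_finite, hfin h₁.xi_finite h₂.xi_finite, ?_, ?_, ?_⟩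
  · intro φ hφ t ht
    have hφc := hφ.continuous
    have hq : ContinuousOn (fun p : ℝ × unitInterval => φ p.2) (strip c e) :=
      Continuous.continuousOn (by fun_prop)
    rw [hi h₁.eta_finite h₂.eta_finite hq ht, hi h₁.xi_finite h₂.xi_finite hq ht]
    rcases le_total d t with hdt | htd
    · have e1 := h₁.residual_eq φ hφ d ⟨hcd, le_rfl⟩
      have e2 := h₂.residual_eq φ hφ t ⟨hdt, ht.2⟩
      rw [min_eq_right hdt]
      linarith
    · have e1 := h₁.residual_eq φ hφ t ⟨ht.1, htd⟩
      rw [min_eq_left htd]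
      rcases htd.eq_or_lt with rfl | hlt
      · have e2 := h₂.residual_eq φ hφ t ⟨le_rfl, hde⟩
        linarith
      · have : strip d t = ∅ := by rw [strip, Icc_eq_empty (not_le.2 hlt), empty_prod]
        rw [this]
        simp only [setIntegral_empty]
        linarith
  · have := hi (q := fun p => v p.1 p.2 - K₁ p.2) h₁.eta_finite h₂.eta_finite
      ((continuousOn_eval hv).sub (hvK K₁)) hec
    rw [this, min_eq_right hde, h₁.eta_support, h₂.eta_support, add_zero]
  · have := hi (q := fun p => K₂ p.2 - v p.1 p.2) h₁.xi_finite h₂.xi_finite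
      ((hvK K₂).sub (continuousOn_eval hv)) hec
    rw [this, min_eq_right hde, h₁.xi_support, h₂.xi_support, add_zero]

/-- Solutions of the variational inequality have reflection measures. -/
theorem IsEVI.exists_isReflection (h : IsEVI K₁ K₂ a b v g)
    (h0 : (0 : C(unitInterval, ℝ)) ∈ wallSpace K₁ K₂) (hK : ∀ x, K₁ x < K₂ x) (hab : a ≤ b) :
    ∃ η ξ, IsReflection K₁ K₂ a v g a b η ξ := by
  obtain ⟨δ, hδ, hgap⟩ : ∃ δ > 0, ∀ x, K₁ x + 4 * δ ≤ K₂ x := by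
    obtain ⟨x₀, -, hx₀⟩ := isCompact_univ.exists_isMinOn (univ_nonempty (α := unitInterval))
      (f := fun x => K₂ x - K₁ x) (Continuous.continuousOn (by fun_prop))
    refine ⟨(K₂ x₀ - K₁ x₀) / 4, by linarith [hK x₀], fun x => ?_⟩
    have := isMinOn_iff.1 hx₀ x (mem_univ x)
    linarith
  have hv := h.continuousOn
  obtain ⟨ρ, hρ, hosc⟩ := Metric.uniformContinuousOn_iff.1
    (isCompact_Icc.uniformContinuousOn_of_continuous hv) δ hδ
  obtain ⟨n, hn⟩ := exists_nat_gt ((b - a) / ρ)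
  have hn0 : (0 : ℝ) < n := lt_of_le_of_lt (div_nonneg (by linarith) hρ.le) hn
  set τ := (b - a) / n with hτ
  have hτρ : τ < ρ := by
    rw [div_lt_iff₀ hρ] at hn
    rw [hτ, div_lt_iff₀ hn0]; linarith
  have hτ0 : 0 ≤ τ := div_nonneg (by linarith) hn0.le
  have hnτ : n * τ = b - a := by rw [hτ]; field_simp
  have key : ∀ i : ℕ, i ≤ n → ∃ η ξ, IsReflection K₁ K₂ a v g a (a + i * τ) η ξ := by
    intro i
    induction i with
    | zero =>
      intro _
      refine ⟨0, 0, by simp, by simp, fun φ _ t ht => ?_, by simp, by simp⟩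
      simp only [Nat.cast_zero, zero_mul, add_zero, Icc_self, mem_singleton_iff] at ht
      simp [ht]
    | succ i ih =>
      intro hi
      obtain ⟨η₁, ξ₁, h₁⟩ := ih (by omega)
      have hiτ : 0 ≤ i * τ := by positivity
      have hle : a + ((i + 1 : ℕ) : ℝ) * τ ≤ b := by
        have : ((i + 1 : ℕ) : ℝ) * τ ≤ n * τ :=
          mul_le_mul_of_nonneg_right (by exact_mod_cast hi) hτ0
        linarith
      have hstep : a + i * τ ≤ a + ((i + 1 : ℕ) : ℝ) * τ := by push_cast; linarith
      obtain ⟨η₂, ξ₂, h₂⟩ := h.exists_isReflection_local h0 hδ hgap (by linarith) hstep hle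
        fun s hs => by
          have := hosc s ⟨by linarith [hs.1], hs.2.trans hle⟩ (a + i * τ)
            ⟨by linarith, by linarith⟩ (by
            rw [Real.dist_eq, abs_of_nonneg (by linarith [hs.1])]
            have := hs.2
            push_cast at this
            linarith)
          rw [dist_eq_norm] at this
          exact this.le
      exact ⟨_, _, h₁.glue (by linarith) hstep (hv.mono (Icc_subset_Icc le_rfl hle)) h₂⟩
  obtain ⟨η, ξ, hr⟩ := key n le_rfl
  rw [hnτ, add_sub_cancel] at hr
  exact ⟨η, ξ, hr⟩

/-! ### The skeleton equation as a variational inequality -/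

/-- Coefficients `f`, `σ` bounded by `B`, with `|σ|` bounded below by `m > 0`. -/
structure IsCoefficient (f σ : unitInterval → ℝ → ℝ) (B m : ℝ) : Prop where
  measurable_f : Measurable (Function.uncurry f)
  continuous_σ : Continuous (Function.uncurry σ)
  abs_f_le : ∀ x y, |f x y| ≤ B
  abs_σ_le : ∀ x y, |σ x y| ≤ B
  pos : 0 < m
  le_abs_σ : ∀ x y, m ≤ |σ x y|

/-- The total forcing `-αv + f(x,v) + σ(x,v)h` acting on the reflected heat equation. -/
def forcing (α : ℝ) (f σ : unitInterval → ℝ → ℝ) (v : ℝ → C(unitInterval, ℝ))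
    (h : ℝ × unitInterval → ℝ) (p : ℝ × unitInterval) : ℝ :=
  -α * v p.1 p.2 + f p.2 (v p.1 p.2) + σ p.2 (v p.1 p.2) * h p

/-- The control that produces the total forcing `g` along `v`. -/
def control (α : ℝ) (f σ : unitInterval → ℝ → ℝ) (v : ℝ → C(unitInterval, ℝ))
    (g : ℝ × unitInterval → ℝ) (p : ℝ × unitInterval) : ℝ :=
  (g p + α * v p.1 p.2 - f p.2 (v p.1 p.2)) / σ p.2 (v p.1 p.2)

variable {α : ℝ} {f σ : unitInterval → ℝ → ℝ} {B m : ℝ} {K₁ K₂ : C(unitInterval, ℝ)}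
  {a b : ℝ} {v : ℝ → C(unitInterval, ℝ)} {g h : ℝ × unitInterval → ℝ}

lemma IsCoefficient.σ_ne_zero (hc : IsCoefficient f σ B m) (x : unitInterval) (y : ℝ) :
    σ x y ≠ 0 := abs_pos.1 (hc.pos.trans_le (hc.le_abs_σ x y))

lemma IsCoefficient.nonneg (hc : IsCoefficient f σ B m) : 0 ≤ B :=
  (abs_nonneg _).trans (hc.abs_f_le 0 0)

lemma forcing_control (hc : IsCoefficient f σ B m) :
    forcing α f σ v (control α f σ v g) = g := by
  funext p
  rw [forcing, control, mul_div_cancel₀ _ (hc.σ_ne_zero _ _)]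
  ring

lemma control_forcing (hc : IsCoefficient f σ B m) :
    control α f σ v (forcing α f σ v h) = h := by
  funext p
  rw [control, div_eq_iff (hc.σ_ne_zero _ _), forcing]
  ring

/-- A bound for the functions between the walls. -/
def wallBound (K₁ K₂ : C(unitInterval, ℝ)) : ℝ := ‖K₁‖ + ‖K₂‖

lemma wallBound_nonneg (K₁ K₂ : C(unitInterval, ℝ)) : 0 ≤ wallBound K₁ K₂ :=
  add_nonneg (norm_nonneg _) (norm_nonneg _)

lemma abs_le_wallBound {u : C(unitInterval, ℝ)} (hu : u ∈ wallSpace K₁ K₂) (x : unitInterval) :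
    |u x| ≤ wallBound K₁ K₂ := by
  have h1 := K₁.norm_coe_le_norm x
  have h2 := K₂.norm_coe_le_norm x
  have h3 := hu x
  have := norm_nonneg K₁
  have := norm_nonneg K₂
  rw [Real.norm_eq_abs, abs_le] at h1 h2
  rw [wallBound, abs_le]
  constructor <;> linarith

lemma norm_le_wallBound {u : C(unitInterval, ℝ)} (hu : u ∈ wallSpace K₁ K₂) :
    ‖u‖ ≤ wallBound K₁ K₂ :=
  (ContinuousMap.norm_le _ (wallBound_nonneg _ _)).2 (abs_le_wallBound hu)

lemma norm_toL2_sub_le {u w : C(unitInterval, ℝ)} (hu : u ∈ wallSpace K₁ K₂)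
    (hw : w ∈ wallSpace K₁ K₂) : ‖toL2 (u - w)‖ ≤ 2 * wallBound K₁ K₂ := by
  have h1 := norm_toL2_le (u - w)
  have h2 := norm_sub_le u w
  have h3 := norm_le_wallBound hu
  have h4 := norm_le_wallBound hw
  linarith

lemma zero_mem_wallSpace (hK : ∀ x, K₁ x < 0 ∧ 0 < K₂ x) :
    (0 : C(unitInterval, ℝ)) ∈ wallSpace K₁ K₂ := fun x => ⟨(hK x).1.le, (hK x).2.le⟩

instance isFiniteMeasure_strip (a b : ℝ) :
    IsFiniteMeasure ((volume : Measure (ℝ × unitInterval)).restrict (strip a b)) :=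
  ⟨by simpa using volume_strip_lt_top a b⟩

lemma strip_ae_eq_slab (a b : ℝ) :
    strip a b =ᵐ[(volume : Measure (ℝ × unitInterval))] slab a b := by
  rw [strip, slab, Measure.volume_eq_prod]
  exact Measure.set_prod_ae_eq Ioc_ae_eq_Icc.symm (ae_eq_refl _)

lemma setIntegral_strip_eq (q : ℝ × unitInterval → ℝ) (a b : ℝ) :
    ∫ p in strip a b, q p = ∫ p in slab a b, q p := setIntegral_congr_set (strip_ae_eq_slab a b)

lemma aestronglyMeasurable_eval (hv : ContinuousOn v (Icc a b)) :
    AEStronglyMeasurable (fun p : ℝ × unitInterval => v p.1 p.2) (volume.restrict (strip a b)) :=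
  (continuousOn_eval hv).aestronglyMeasurable (measurableSet_strip a b)

section

variable {μ : Measure (ℝ × unitInterval)}

lemma IsCoefficient.aestronglyMeasurable_f (hc : IsCoefficient f σ B m)
    (hv : AEStronglyMeasurable (fun p : ℝ × unitInterval => v p.1 p.2) μ) :
    AEStronglyMeasurable (fun p : ℝ × unitInterval => f p.2 (v p.1 p.2)) μ :=
  (hc.measurable_f.comp_aemeasurable
    (measurable_snd.aemeasurable.prodMk hv.aemeasurable)).aestronglyMeasurable

lemma IsCoefficient.aestronglyMeasurable_σ (hc : IsCoefficient f σ B m)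
    (hv : AEStronglyMeasurable (fun p : ℝ × unitInterval => v p.1 p.2) μ) :
    AEStronglyMeasurable (fun p : ℝ × unitInterval => σ p.2 (v p.1 p.2)) μ :=
  hc.continuous_σ.comp_aestronglyMeasurable
    (measurable_snd.aestronglyMeasurable.prodMk hv)

end

lemma memLp_eval (hv : ContinuousOn v (Icc a b)) (hw : ∀ t ∈ Icc a b, v t ∈ wallSpace K₁ K₂) :
    MemLp (fun p : ℝ × unitInterval => v p.1 p.2) 2 (volume.restrict (strip a b)) := by
  refine MemLp.of_bound (aestronglyMeasurable_eval hv) (wallBound K₁ K₂) ?_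
  filter_upwards [ae_restrict_mem (measurableSet_strip a b)] with p hp
  exact abs_le_wallBound (hw p.1 hp.1) p.2

lemma IsCoefficient.memLp_f (hc : IsCoefficient f σ B m) (hv : ContinuousOn v (Icc a b)) :
    MemLp (fun p : ℝ × unitInterval => f p.2 (v p.1 p.2)) 2 (volume.restrict (strip a b)) :=
  MemLp.of_bound (hc.aestronglyMeasurable_f (aestronglyMeasurable_eval hv)) B
    (Eventually.of_forall fun _ => hc.abs_f_le _ _)

lemma IsCoefficient.memLp_σ_mul (hc : IsCoefficient f σ B m) (hv : ContinuousOn v (Icc a b))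
    (hh : MemLp h 2 (volume.restrict (strip a b))) :
    MemLp (fun p : ℝ × unitInterval => σ p.2 (v p.1 p.2) * h p) 2 (volume.restrict (strip a b)) :=
  MemLp.of_le_mul (c := B) hh
    ((hc.aestronglyMeasurable_σ (aestronglyMeasurable_eval hv)).mul hh.aestronglyMeasurable)
    (Eventually.of_forall fun p => by
      rw [norm_mul]
      exact mul_le_mul_of_nonneg_right (hc.abs_σ_le _ _) (norm_nonneg _))

lemma IsCoefficient.memLp_forcing (hc : IsCoefficient f σ B m) (hv : ContinuousOn v (Icc a b))
    (hw : ∀ t ∈ Icc a b, v t ∈ wallSpace K₁ K₂) (hh : MemLp h 2 (volume.restrict (strip a b))) :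
    MemLp (forcing α f σ v h) 2 (volume.restrict (strip a b)) :=
  (((memLp_eval hv hw).const_mul (-α)).add (hc.memLp_f hv)).add (hc.memLp_σ_mul hv hh)

lemma IsCoefficient.memLp_control (hc : IsCoefficient f σ B m) (hv : ContinuousOn v (Icc a b))
    (hw : ∀ t ∈ Icc a b, v t ∈ wallSpace K₁ K₂) (hg : MemLp g 2 (volume.restrict (strip a b))) :
    MemLp (control α f σ v g) 2 (volume.restrict (strip a b)) := by
  have h1 := (hg.add ((memLp_eval hv hw).const_mul α)).sub (hc.memLp_f hv)
  refine MemLp.of_le_mul (c := m⁻¹) h1 ?_ (Eventually.of_forall fun p => ?_)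
  · exact (h1.aestronglyMeasurable.aemeasurable.div
      (hc.aestronglyMeasurable_σ (aestronglyMeasurable_eval hv)).aemeasurable).aestronglyMeasurable
  · rw [control, norm_div, div_eq_inv_mul]
    exact mul_le_mul_of_nonneg_right (inv_anti₀ hc.pos (hc.le_abs_σ _ _)) (norm_nonneg _)

lemma integrableOn_mul_test {g : ℝ × unitInterval → ℝ} {ν : Measure (ℝ × unitInterval)}
    (hg : IntegrableOn g (strip a b) ν) {ψ : ℝ → ℝ} (hψ : Continuous ψ) :
    IntegrableOn (fun p => g p * ψ p.2) (strip a b) ν :=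
  hg.mul_continuousOn (Continuous.continuousOn (by fun_prop)) (isCompact_strip a b)

/-- The four volume integrals of the weak formulation, collected. -/
lemma IsCoefficient.setIntegral_forcing (hc : IsCoefficient f σ B m)
    (hv : ContinuousOn v (Icc a b)) (hw : ∀ t ∈ Icc a b, v t ∈ wallSpace K₁ K₂)
    (hh : MemLp h 2 (volume.restrict (strip a b))) {φ : ℝ → ℝ} (hφ : IsNeumann φ)
    {s : Set (ℝ × unitInterval)} (hs : s ⊆ strip a b) :
    ∫ p in s, (v p.1 p.2 * deriv (deriv φ) p.2 + forcing α f σ v h p * φ p.2)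
      = (∫ p in s, v p.1 p.2 * deriv (deriv φ) p.2) - α * (∫ p in s, v p.1 p.2 * φ p.2)
        + (∫ p in s, f p.2 (v p.1 p.2) * φ p.2)
        + ∫ p in s, σ p.2 (v p.1 p.2) * h p * φ p.2 := by
  have c := hφ.continuous
  have hi := MemLp.integrableOn_strip (memLp_eval hv hw)
  have h0 := (integrableOn_mul_test hi hφ.continuous_deriv2).mono_set hs
  have h1 := (integrableOn_mul_test hi c).mono_set hs
  have h2 := (integrableOn_mul_test (MemLp.integrableOn_strip (hc.memLp_f hv)) c).mono_set hs
  have h3 := (integrableOn_mul_test (MemLp.integrableOn_strip (hc.memLp_σ_mul hv hh)) c).mono_set hs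
  have e1 := integral_sub h0 (h1.const_mul α)
  have e2 := integral_add (h0.sub (h1.const_mul α)) h2
  have e3 := integral_add ((h0.sub (h1.const_mul α)).add h2) h3
  simp only [Pi.add_apply, Pi.sub_apply] at e1 e2 e3
  rw [← integral_const_mul, ← e1, ← e2, ← e3]
  refine integral_congr_ae (Eventually.of_forall fun p => ?_)
  simp only [forcing]
  ring

/-- The skeleton equation implies the variational inequality. -/
theorem IsDrivenBy.isEVI (hc : IsCoefficient f σ B m) (H : IsDrivenBy α f σ K₁ K₂ a b h v) :
    IsEVI K₁ K₂ a b v (forcing α f σ v h) := by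
  obtain ⟨hh, η, ξ, S⟩ := H
  have hv := S.continuousOn
  have hw := S.mem_wallSpace
  refine isEVI_of_increments hv hw (hc.memLp_forcing hv hw hh) S.eta_finite S.xi_finite
    (fun s t has hst htb φ hφ => ?_) S.eta_support S.xi_support
  have wt := S.weak_form t ⟨has.trans hst, htb⟩ φ hφ.contDiff hφ.deriv_zero hφ.deriv_one
  have ws := S.weak_form s ⟨has, hst.trans htb⟩ φ hφ.contDiff hφ.deriv_zero hφ.deriv_one
  have c := hφ.continuous
  have hsub : strip a t ⊆ strip a b := strip_subset_strip le_rfl htb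
  have hi := MemLp.integrableOn_strip (memLp_eval hv hw)
  have e0 := setIntegral_strip_add has hst
    ((integrableOn_mul_test hi hφ.continuous_deriv2).mono_set hsub)
  have e1 := setIntegral_strip_add has hst ((integrableOn_mul_test hi c).mono_set hsub)
  have e2 := setIntegral_strip_add has hst
    ((integrableOn_mul_test (MemLp.integrableOn_strip (hc.memLp_f hv)) c).mono_set hsub)
  have e3 := setIntegral_strip_add has hst
    ((integrableOn_mul_test (MemLp.integrableOn_strip (hc.memLp_σ_mul hv hh)) c).mono_set hsub)
  have cφ : ContinuousOn (fun p : ℝ × unitInterval => φ p.2) (strip a b) :=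
    Continuous.continuousOn (by fun_prop)
  have e4 := setIntegral_strip_add has hst
    ((integrableOn_strip_of_continuousOn S.eta_finite cφ).mono_set hsub)
  have e5 := setIntegral_strip_add has hst
    ((integrableOn_strip_of_continuousOn S.xi_finite cφ).mono_set hsub)
  rw [hc.setIntegral_forcing hv hw hh hφ (slab_subset_strip has htb)]
  rw [e0, e1, e2, e3, e4, e5] at wt
  linarith

/-- The variational inequality implies the skeleton equation. -/
theorem IsEVI.isDrivenBy (hc : IsCoefficient f σ B m) (hK : ∀ x, K₁ x < 0 ∧ 0 < K₂ x)
    (hab : a ≤ b) (H : IsEVI K₁ K₂ a b v g) :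
    IsDrivenBy α f σ K₁ K₂ a b (control α f σ v g) v := by
  have hv := H.continuousOn
  have hw := H.mem_wallSpace
  have hh := hc.memLp_control (α := α) hv hw H.memLp
  obtain ⟨η, ξ, R⟩ := H.exists_isReflection (zero_mem_wallSpace hK)
    (fun x => (hK x).1.trans (hK x).2) hab
  refine ⟨hh, η, ξ, hv, hw, R.eta_finite, R.xi_finite, fun t ht φ h1 h2 h3 => ?_,
    R.eta_support, R.xi_support⟩
  have hφ : IsNeumann φ := ⟨h1, h2, h3⟩
  have e := R.residual_eq φ hφ t ht
  have e0 : slab a a = ∅ := by rw [slab, Ioc_self, empty_prod]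
  rw [residual, residual, e0, setIntegral_empty, sub_zero, ← setIntegral_strip_eq,
    ← forcing_control hc (α := α) (v := v) (g := g),
    hc.setIntegral_forcing hv hw hh hφ (strip_subset_strip le_rfl ht.2)] at e
  linarith

/-- The cost `½ ∫ h²` of the total forcing `g` along `v` over the time interval `[a,b]`. -/
def cost (α : ℝ) (f σ : unitInterval → ℝ → ℝ) (a b : ℝ) (v : ℝ → C(unitInterval, ℝ))
    (g : ℝ × unitInterval → ℝ) : ℝ := (1 / 2) * ∫ p in slab a b, control α f σ v g p ^ 2

lemma cost_nonneg : 0 ≤ cost α f σ a b v g :=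
  mul_nonneg (by norm_num) (integral_nonneg fun _ => sq_nonneg _)

lemma IsEVI.integrableOn_control_sq (hc : IsCoefficient f σ B m) (H : IsEVI K₁ K₂ a b v g) :
    IntegrableOn (fun p => control α f σ v g p ^ 2) (strip a b) :=
  (hc.memLp_control H.continuousOn H.mem_wallSpace H.memLp).integrable_sq

/-- The cost in terms of the size of the forcing. -/
lemma IsEVI.cost_le (hc : IsCoefficient f σ B m) (H : IsEVI K₁ K₂ a b v g) (hab : a ≤ b) :
    cost α f σ a b v g ≤ 3 / (2 * m ^ 2) * ((∫ p in slab a b, g p ^ 2)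
      + (b - a) * ((α * wallBound K₁ K₂) ^ 2 + B ^ 2)) := by
  have hm := hc.pos
  have hsub : slab a b ⊆ strip a b := slab_subset_strip le_rfl le_rfl
  have hg : IntegrableOn (fun p => g p ^ 2) (slab a b) :=
    IntegrableOn.mono_set H.memLp.integrable_sq hsub
  have hfin : (volume : Measure (ℝ × unitInterval)) (slab a b) ≠ ⊤ := by
    rw [volume_slab]; exact ENNReal.ofReal_ne_top
  have hle : ∫ p in slab a b, control α f σ v g p ^ 2
      ≤ ∫ p in slab a b, 3 / m ^ 2 * (g p ^ 2 + ((α * wallBound K₁ K₂) ^ 2 + B ^ 2)) := by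
    refine setIntegral_mono_on ((H.integrableOn_control_sq hc).mono_set hsub)
      (Integrable.const_mul (hg.add (integrableOn_const hfin)) _) (measurableSet_slab a b)
      fun p hp => ?_
    rw [control, div_pow, ← sq_abs (σ _ _), div_mul_eq_mul_div]
    -- Pointwise: `(g + α v - f)² ≤ 3 (g² + (α v)² + f²)`, divided by `σ² ≥ m²`.
    have h1 := hc.le_abs_σ p.2 (v p.1 p.2)
    have h2 : (α * v p.1 p.2) ^ 2 ≤ (α * wallBound K₁ K₂) ^ 2 := by
      rw [mul_pow, mul_pow]
      refine mul_le_mul_of_nonneg_left (sq_le_sq.2 ?_) (sq_nonneg _)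
      rw [abs_of_nonneg (wallBound_nonneg K₁ K₂)]
      exact abs_le_wallBound (H.mem_wallSpace p.1 (hsub hp).1) p.2
    have h3 : f p.2 (v p.1 p.2) ^ 2 ≤ B ^ 2 :=
      sq_le_sq.2 (by rw [abs_of_nonneg hc.nonneg]; exact hc.abs_f_le _ _)
    refine div_le_div₀ (by positivity) ?_ (by positivity) (pow_le_pow_left₀ hm.le h1 2)
    nlinarith [sq_nonneg (g p - α * v p.1 p.2), sq_nonneg (g p + f p.2 (v p.1 p.2)),
      sq_nonneg (α * v p.1 p.2 + f p.2 (v p.1 p.2))]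
  have hv : ∫ _ in slab a b, ((α * wallBound K₁ K₂) ^ 2 + B ^ 2)
      = (b - a) * ((α * wallBound K₁ K₂) ^ 2 + B ^ 2) := by
    rw [setIntegral_const, Measure.real, volume_slab, ENNReal.toReal_ofReal (by linarith),
      smul_eq_mul]
  rw [integral_const_mul, integral_add hg (integrableOn_const hfin), hv] at hle
  rw [cost]
  calc (1 / 2) * ∫ p in slab a b, control α f σ v g p ^ 2
      ≤ (1 / 2) * _ := mul_le_mul_of_nonneg_left hle (by norm_num)
    _ = _ := by field_simp

/-- The forcing in terms of the cost. -/
lemma IsEVI.forcing_sq_le (hc : IsCoefficient f σ B m) (H : IsEVI K₁ K₂ a b v g) (hab : a ≤ b) :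
    ∫ p in slab a b, g p ^ 2 ≤ 3 * ((b - a) * ((α * wallBound K₁ K₂) ^ 2 + B ^ 2)
      + B ^ 2 * (2 * cost α f σ a b v g)) := by
  have hsub : slab a b ⊆ strip a b := slab_subset_strip le_rfl le_rfl
  have hg : IntegrableOn (fun p => g p ^ 2) (slab a b) :=
    IntegrableOn.mono_set H.memLp.integrable_sq hsub
  have hctrl := (H.integrableOn_control_sq (α := α) hc).mono_set hsub
  have hfin : (volume : Measure (ℝ × unitInterval)) (slab a b) ≠ ⊤ := by
    rw [volume_slab]; exact ENNReal.ofReal_ne_top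
  have hconst : IntegrableOn (fun _ => (α * wallBound K₁ K₂) ^ 2 + B ^ 2) (slab a b)
    (volume : Measure (ℝ × unitInterval)) := integrableOn_const hfin
  have hle : ∫ p in slab a b, g p ^ 2 ≤ ∫ p in slab a b,
      3 * (((α * wallBound K₁ K₂) ^ 2 + B ^ 2) + B ^ 2 * control α f σ v g p ^ 2) := by
    refine setIntegral_mono_on hg (Integrable.const_mul (hconst.add (hctrl.const_mul _)) _)
      (measurableSet_slab a b) fun p hp => ?_
    have e : g p = -α * v p.1 p.2 + f p.2 (v p.1 p.2) + σ p.2 (v p.1 p.2) * control α f σ v g p :=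
      (congrFun (forcing_control hc (α := α) (v := v) (g := g)) p).symm
    have h2 : (α * v p.1 p.2) ^ 2 ≤ (α * wallBound K₁ K₂) ^ 2 := by
      rw [mul_pow, mul_pow]
      refine mul_le_mul_of_nonneg_left (sq_le_sq.2 ?_) (sq_nonneg _)
      rw [abs_of_nonneg (wallBound_nonneg K₁ K₂)]
      exact abs_le_wallBound (H.mem_wallSpace p.1 (hsub hp).1) p.2
    have h3 : f p.2 (v p.1 p.2) ^ 2 ≤ B ^ 2 :=
      sq_le_sq.2 (by rw [abs_of_nonneg hc.nonneg]; exact hc.abs_f_le _ _)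
    have h4 : (σ p.2 (v p.1 p.2) * control α f σ v g p) ^ 2 ≤ B ^ 2 * control α f σ v g p ^ 2 := by
      rw [mul_pow]
      refine mul_le_mul_of_nonneg_right (sq_le_sq.2 ?_) (sq_nonneg _)
      rw [abs_of_nonneg hc.nonneg]; exact hc.abs_σ_le _ _
    generalize control α f σ v g p = k at *
    rw [e]
    generalize σ p.2 (v p.1 p.2) * k = w at *
    generalize f p.2 (v p.1 p.2) = z at *
    nlinarith [sq_nonneg (α * v p.1 p.2 + z), sq_nonneg (α * v p.1 p.2 + w), sq_nonneg (z - w)]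
  have hv : ∫ _ in slab a b, ((α * wallBound K₁ K₂) ^ 2 + B ^ 2)
      = (b - a) * ((α * wallBound K₁ K₂) ^ 2 + B ^ 2) := by
    rw [setIntegral_const, Measure.real, volume_slab, ENNReal.toReal_ofReal (by linarith),
      smul_eq_mul]
  rw [integral_const_mul, integral_add hconst (hctrl.const_mul _), hv, integral_const_mul] at hle
  rw [cost]
  linarith

lemma IsEVI.cost_add (hc : IsCoefficient f σ B m) (H : IsEVI K₁ K₂ a b v g) {c : ℝ}
    (hac : a ≤ c) (hcb : c ≤ b) :
    cost α f σ a b v g = cost α f σ a c v g + cost α f σ c b v g := by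
  rw [cost, cost, cost, setIntegral_slab_add hac hcb
    ((H.integrableOn_control_sq hc).mono_set (slab_subset_strip le_rfl le_rfl))]
  ring

lemma quasipotential_le (hc : IsCoefficient f σ B m) (hK : ∀ x, K₁ x < 0 ∧ 0 < K₂ x) {T : ℝ}
    (hT : 0 < T) (H : IsEVI K₁ K₂ 0 T v g) (h0 : v 0 = 0) {z : wallSpace K₁ K₂} (hz : v T = z) :
    quasipotential α f σ K₁ K₂ z ≤ ENNReal.ofReal (cost α f σ 0 T v g) := by
  refine iInf₂_le_of_le T hT (iInf₂_le_of_le v H.continuousOn (iInf₂_le_of_le H.mem_wallSpace h0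
    (iInf_le_of_le hz (iInf₂_le_of_le _ (H.isDrivenBy (α := α) hc hK hT.le) ?_))))
  rw [setIntegral_strip_eq, cost]

lemma exists_of_quasipotential_lt (hc : IsCoefficient f σ B m) {z : wallSpace K₁ K₂} {r : ℝ}
    (hr : quasipotential α f σ K₁ K₂ z < ENNReal.ofReal r) :
    ∃ (T : ℝ) (v : ℝ → C(unitInterval, ℝ)) (g : ℝ × unitInterval → ℝ), 0 < T ∧
      IsEVI K₁ K₂ 0 T v g ∧ v 0 = 0 ∧ v T = z ∧ cost α f σ 0 T v g < r := by
  simp only [quasipotential, rateFunctional, iInf_lt_iff] at hr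
  obtain ⟨T, hT, v, -, -, h0, hz, h, H, hlt⟩ := hr
  refine ⟨T, v, _, hT, H.isEVI hc, h0, hz, ?_⟩
  rw [cost, control_forcing hc, ← setIntegral_strip_eq]
  exact (ENNReal.ofReal_lt_ofReal_iff_of_nonneg
    (mul_nonneg (by norm_num) (integral_nonneg fun _ => sq_nonneg _))).1 hlt

/-! ### Regularization -/

lemma intervalIntegral_swap_of_continuous {D : ℝ → ℝ → ℝ} (hD : Continuous (Function.uncurry D))
    (a t h : ℝ) :
    ∫ s in a..t, ∫ θ in (0 : ℝ)..h, D s θ = ∫ θ in (0 : ℝ)..h, ∫ s in a..t, D s θ := by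
  refine intervalIntegral_intervalIntegral_swap (IntegrableOn.mono_set
    (t := uIcc a t ×ˢ uIcc 0 h) ?_ (prod_mono uIoc_subset_uIcc uIoc_subset_uIcc))
  exact hD.continuousOn.integrableOn_compact (isCompact_uIcc.prod isCompact_uIcc)

lemma integral_shift_sub {P : ℝ → ℝ} (hP : Continuous P) (a t h : ℝ) :
    ∫ s in a..t, (P (s + h) - P s)
      = (∫ θ in (0 : ℝ)..h, P (t + θ)) - ∫ θ in (0 : ℝ)..h, P (a + θ) := by
  have hi : ∀ c d, IntervalIntegrable P volume c d := fun c d => hP.intervalIntegrable c d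
  have hs : IntervalIntegrable (fun s => P (s + h)) volume a t :=
    Continuous.intervalIntegrable (by fun_prop) a t
  rw [intervalIntegral.integral_sub hs (hi a t), intervalIntegral.integral_comp_add_right,
    intervalIntegral.integral_comp_add_left, intervalIntegral.integral_comp_add_left,
    intervalIntegral.integral_interval_sub_interval_comm' (hi _ _) (hi _ _) (hi _ _)]
  simp

/-- The real-variable core of the regularizing effect. Here `P` is the primitive of the energy
`F` of a path, `Q` that of the squared forcing, and `D s θ` is the squared distance of the path at
the times `s` and `s + θ`. -/
lemma diffQuot_estimate {P Q F : ℝ → ℝ} {D : ℝ → ℝ → ℝ} (hP : Continuous P) (hPm : Monotone P)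
    (hQ : Continuous Q) (hD : Continuous (Function.uncurry D)) (hD0 : ∀ s θ, 0 ≤ D s θ)
    (hDz : ∀ s, D s 0 = 0) {a t L G H : ℝ} (hat : a ≤ t) (hL : 0 ≤ L) (hG : 0 ≤ G)
    (hF : IntervalIntegrable F volume a t) (hPF : P t - P a = ∫ s in a..t, F s)
    (hQ01 : ∀ s, 0 ≤ Q s ∧ Q s ≤ G) (hslope : ∀ θ, 0 ≤ θ → P (a + θ) - P a ≤ L * θ)
    (hevi : ∀ h, 0 < h → h ≤ H → ∀ᵐ s ∂volume.restrict (Icc a t),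
      D s h / 2 + (P (s + h) - P s) ≤ h * F s + h * (Q (s + h) - Q s)
        + (4 * h)⁻¹ * ∫ θ in (0 : ℝ)..h, D s θ) {h : ℝ} (hh : 0 < h) (hhH : h ≤ H) :
    (∫ s in a..t, D s h) ≤ (2 * L + 4 * G) * h ^ 2 ∧
      (∫ θ in (0 : ℝ)..h, (P (t + θ) - P t)) ≤ (L + 2 * G) * h ^ 2 := by
  have hcont : Continuous fun θ => ∫ s in a..t, D s θ :=
    intervalIntegral.continuous_parametric_intervalIntegral_of_continuous'
      (f := fun θ s => D s θ) (hD.comp continuous_swap) a t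
  set A : ℝ → ℝ := fun θ => ∫ s in a..t, D s θ with hA
  have hA0 : ∀ θ, 0 ≤ A θ := fun θ =>
    intervalIntegral.integral_nonneg hat fun s _ => hD0 s θ
  have hPi : ∀ c, Continuous fun θ => P (c + θ) := fun c => by fun_prop
  -- Integrate the hypothesis in `s` over `[a,t]`. The integral of `P (s + k) - P s` is a difference of
  -- integrals over `[t, t + k]` and `[a, a + k]`, and that of `k F` is `k (P t - P a)`.
  have key : ∀ k, 0 < k → k ≤ H → A k / 2 + ∫ θ in (0 : ℝ)..k, (P (t + θ) - P t)
      ≤ L * k ^ 2 / 2 + G * k ^ 2 + (4 * k)⁻¹ * ∫ θ in (0 : ℝ)..k, A θ := by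
    intro k hk hkH
    have c1 : Continuous fun s => D s k :=
      hD.comp (continuous_id.prodMk continuous_const)
    have c2 : Continuous fun s => P (s + k) - P s := by fun_prop
    have c3 : Continuous fun s => Q (s + k) - Q s := by fun_prop
    have c4 : Continuous fun s => ∫ θ in (0 : ℝ)..k, D s θ :=
      intervalIntegral.continuous_parametric_intervalIntegral_of_continuous' hD 0 k
    have i1 := (c1.div_const 2).intervalIntegrable (μ := volume) a t
    have i2 := c2.intervalIntegrable (μ := volume) a t
    have i3 := (c3.const_mul k).intervalIntegrable (μ := volume) a t
    have i4 := (c4.const_mul (4 * k)⁻¹).intervalIntegrable (μ := volume) a t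
    have hint := intervalIntegral.integral_mono_ae_restrict hat (i1.add i2)
      (((hF.const_mul k).add i3).add i4) (hevi k hk hkH)
    rw [intervalIntegral.integral_add i1 i2,
      intervalIntegral.integral_add ((hF.const_mul k).add i3) i4,
      intervalIntegral.integral_add (hF.const_mul k) i3, intervalIntegral.integral_div,
      intervalIntegral.integral_const_mul, intervalIntegral.integral_const_mul,
      intervalIntegral.integral_const_mul, integral_shift_sub hP, integral_shift_sub hQ,
      intervalIntegral_swap_of_continuous hD, ← hPF] at hint
    have e1 : ∫ θ in (0 : ℝ)..k, (P (t + θ) - P t) = (∫ θ in (0 : ℝ)..k, P (t + θ)) - k * P t := by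
      rw [intervalIntegral.integral_sub ((hPi t).intervalIntegrable _ _) (by simp)]; simp
    have e2 : (∫ θ in (0 : ℝ)..k, P (a + θ)) - k * P a ≤ L * k ^ 2 / 2 := by
      have : ∫ θ in (0 : ℝ)..k, (P (a + θ) - P a) ≤ ∫ θ in (0 : ℝ)..k, L * θ := by
        refine intervalIntegral.integral_mono_on hk.le
          (((hPi a).sub continuous_const).intervalIntegrable _ _)
          ((continuous_const.mul continuous_id).intervalIntegrable _ _) fun θ hθ => hslope θ hθ.1
      rw [intervalIntegral.integral_sub ((hPi a).intervalIntegrable _ _) (by simp),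
        intervalIntegral.integral_const_mul, integral_id] at this
      simp only [intervalIntegral.integral_const, smul_eq_mul, sub_zero] at this
      linarith
    have hQi : ∀ c, IntervalIntegrable (fun θ => Q (c + θ)) volume 0 k := fun c =>
      Continuous.intervalIntegrable (by fun_prop) _ _
    have e3 : (∫ θ in (0 : ℝ)..k, Q (t + θ)) ≤ k * G := by
      have := intervalIntegral.integral_mono_on hk.le (hQi t)
        (intervalIntegrable_const (μ := volume) (c := G)) fun θ _ => (hQ01 (t + θ)).2
      simpa using this
    have e4 : 0 ≤ ∫ θ in (0 : ℝ)..k, Q (a + θ) :=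
      intervalIntegral.integral_nonneg hk.le fun θ _ => (hQ01 (a + θ)).1
    have e5 : k * ((∫ θ in (0 : ℝ)..k, Q (t + θ)) - ∫ θ in (0 : ℝ)..k, Q (a + θ)) ≤ G * k ^ 2 := by
      nlinarith
    rw [e1]
    change A k / 2 + _ ≤ _ at hint
    linarith
  have hpos : ∀ k, 0 < k → 0 ≤ ∫ θ in (0 : ℝ)..k, (P (t + θ) - P t) := fun k hk =>
    intervalIntegral.integral_nonneg hk.le fun θ hθ => sub_nonneg.2 (hPm (by linarith [hθ.1]))
  have hint : ∀ k S, 0 < k → (∀ θ ∈ Icc 0 k, A θ ≤ S) → (4 * k)⁻¹ * (∫ θ in (0 : ℝ)..k, A θ)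
      ≤ S / 4 := by
    intro k S hk hS
    have := intervalIntegral.integral_mono_on hk.le (hcont.intervalIntegrable 0 k)
      (intervalIntegrable_const (μ := volume) (c := S)) hS
    rw [intervalIntegral.integral_const, smul_eq_mul, sub_zero] at this
    calc _ ≤ (4 * k)⁻¹ * (k * S) := mul_le_mul_of_nonneg_left this (by positivity)
      _ = S / 4 := by field_simp
  -- The maximum of `A` over `[0,h]` is absorbed into the left-hand side.
  have hmax : ∀ θ ∈ Icc 0 h, A θ ≤ (2 * L + 4 * G) * h ^ 2 := by
    obtain ⟨k, hk, hkmax⟩ := isCompact_Icc.exists_isMaxOn (nonempty_Icc.2 hh.le)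
      hcont.continuousOn
    have hkm : ∀ θ ∈ Icc 0 h, A θ ≤ A k := fun θ hθ => hkmax hθ
    intro θ hθ
    refine (hkm θ hθ).trans ?_
    rcases hk.1.eq_or_lt with hk0 | hk0
    · have : A k = 0 := by simp [hA, ← hk0, hDz]
      rw [this]; positivity
    · have h1 := key k hk0 (hk.2.trans hhH)
      have h2 := hpos k hk0
      have h3 := hint k (A k) hk0 fun θ hθ => hkm θ ⟨hθ.1, hθ.2.trans hk.2⟩
      have h4 : k ^ 2 ≤ h ^ 2 := pow_le_pow_left₀ hk0.le hk.2 2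
      calc A k ≤ (2 * L + 4 * G) * k ^ 2 := by linarith
        _ ≤ _ := mul_le_mul_of_nonneg_left h4 (by positivity)
  refine ⟨hmax h ⟨hh.le, le_rfl⟩, ?_⟩
  have h1 := key h hh hhH
  have h3 := hint h _ hh hmax
  have h4 := hA0 h
  linarith

variable {K₁ K₂ : C(unitInterval, ℝ)} {a b : ℝ} {v : ℝ → C(unitInterval, ℝ)}
  {g : ℝ × unitInterval → ℝ}

lemma IsEVI.integrableOn_sq (H : IsEVI K₁ K₂ a b v g) :
    IntegrableOn (fun p => g p ^ 2) (strip a b) := H.memLp.integrable_sq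

lemma IsEVI.setIntegral_forcing_le (H : IsEVI K₁ K₂ a b v g) {s t : ℝ} (has : a ≤ s) (hst : s ≤ t)
    (htb : t ≤ b) (x : C(unitInterval, ℝ)) {k : ℝ} (hk : 0 < k) :
    ∫ p in slab s t, g p * (v p.1 p.2 - x p.2)
      ≤ k * (∫ p in slab s t, g p ^ 2) + (4 * k)⁻¹ * ∫ r in s..t, ‖toL2 (v r - x)‖ ^ 2 := by
  have hsub := slab_subset_strip has htb
  have hg := H.integrableOn_sq.mono_set hsub
  have hcx : ContinuousOn (fun p : ℝ × unitInterval => v p.1 p.2 - x p.2) (strip a b) :=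
    (continuousOn_eval H.continuousOn).sub (Continuous.continuousOn (by fun_prop))
  have hsq : IntegrableOn (fun p : ℝ × unitInterval => (v p.1 p.2 - x p.2) ^ 2) (slab s t) :=
    (integrableOn_strip_of_continuousOn (volume_strip_lt_top a b) (hcx.pow 2)).mono_set hsub
  have e : ∫ r in s..t, ‖toL2 (v r - x)‖ ^ 2 = ∫ p in slab s t, (v p.1 p.2 - x p.2) ^ 2 := by
    rw [setIntegral_slab_eq hst hsq]
    simp_rw [norm_toL2_sq, ContinuousMap.sub_apply]
  rw [e, ← integral_const_mul, ← integral_const_mul, ← integral_add (hg.const_mul k)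
    (hsq.const_mul _)]
  refine setIntegral_mono_on (((MemLp.integrableOn_strip H.memLp).mul_continuousOn hcx
    (isCompact_strip a b)).mono_set hsub) ((hg.const_mul k).add (hsq.const_mul _))
    (measurableSet_slab s t) fun p _ => ?_
  generalize v p.1 p.2 - x p.2 = y
  have : k * g p ^ 2 + (4 * k)⁻¹ * y ^ 2 - g p * y = k * (g p - y / (2 * k)) ^ 2 := by
    field_simp; ring
  nlinarith [mul_nonneg hk.le (sq_nonneg (g p - y / (2 * k)))]

/-- Projection of the real line onto `[a,b]`. -/
def clamp (a b r : ℝ) : ℝ := max a (min b r)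

lemma continuous_clamp (a b : ℝ) : Continuous (clamp a b) := by unfold clamp; fun_prop

lemma monotone_clamp (a b : ℝ) : Monotone (clamp a b) := fun _ _ h =>
  max_le_max le_rfl (min_le_min le_rfl h)

lemma clamp_mem {a b : ℝ} (hab : a ≤ b) (r : ℝ) : clamp a b r ∈ Icc a b :=
  ⟨le_max_left _ _, max_le hab (min_le_left _ _)⟩

lemma clamp_eq {a b r : ℝ} (h : r ∈ Icc a b) : clamp a b r = r := by
  rw [clamp, min_eq_right h.2, max_eq_right h.1]

lemma ContinuousOn.comp_clamp {X : Type*} [TopologicalSpace X] {q : ℝ → X} {a b : ℝ}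
    (hq : ContinuousOn q (Icc a b)) (hab : a ≤ b) : Continuous fun r => q (clamp a b r) :=
  hq.comp_continuous (continuous_clamp a b) (clamp_mem hab)

/-- The regularizing effect, from a starting time after which the mean energy is at most `L`. -/
lemma IsEVI.diffQuot_le (H : IsEVI K₁ K₂ a b v g) (h0 : (0 : C(unitInterval, ℝ)) ∈ wallSpace K₁ K₂)
    {L G : ℝ} (hL : 0 ≤ L) (hG : ∫ p in slab a b, g p ^ 2 ≤ G) {a' : ℝ} (ha' : a' ∈ Icc a b)
    (hslope : ∀ r ∈ Icc a' b, ∫ r in a'..r, energy (v r) ≤ L * (r - a')) {t h : ℝ} (hat : a' ≤ t)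
    (hh : 0 < h) (htb : t + h ≤ b) :
    (∫ s in a'..t, ‖toL2 (v (clamp a b (s + h)) - v (clamp a b s))‖ ^ 2)
        ≤ (2 * L + 4 * G) * h ^ 2 ∧
      (∫ θ in (0 : ℝ)..h, ∫ r in t..t + θ, energy (v r)) ≤ (L + 2 * G) * h ^ 2 := by
  have hab : a ≤ b := ha'.1.trans ha'.2
  obtain ⟨hFi, hFe, hevi⟩ := H.energy_integrable h0 hab
  have hv := ContinuousOn.comp_clamp H.continuousOn hab
  have hGi : IntegrableOn (fun p => g p ^ 2) (strip a b) := H.integrableOn_sq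
  set F : ℝ → ℝ := fun r => energy (v r) with hF
  have hFsub : ∀ s ∈ Icc a b, ∀ t ∈ Icc a b, IntervalIntegrable F volume s t := fun s hs t ht =>
    hFi.mono_set (by rw [uIcc_of_le hab]; exact uIcc_subset_Icc hs ht)
  set P : ℝ → ℝ := fun s => ∫ r in a..clamp a b s, F r with hP
  set Q : ℝ → ℝ := fun s => ∫ p in slab a (clamp a b s), g p ^ 2 with hQ
  have hPc : Continuous P := by
    refine ContinuousOn.comp_clamp (q := fun s => ∫ r in a..s, F r) ?_ hab
    have := intervalIntegral.continuousOn_primitive_interval' hFi left_mem_uIcc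
    rwa [uIcc_of_le hab] at this
  have hQc : Continuous Q :=
    ContinuousOn.comp_clamp (continuousOn_setIntegral_slab hab hGi) hab
  have hPsub : ∀ s ∈ Icc a b, ∀ t ∈ Icc a b, P t - P s = ∫ r in s..t, F r := by
    intro s hs t ht
    simp only [hP]
    rw [clamp_eq hs, clamp_eq ht, intervalIntegral.integral_interval_sub_left
      (hFsub _ ⟨le_rfl, hab⟩ _ ht) (hFsub _ ⟨le_rfl, hab⟩ _ hs)]
  have hQsub : ∀ s ∈ Icc a b, ∀ t ∈ Icc a b, s ≤ t → Q t - Q s = ∫ p in slab s t, g p ^ 2 := by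
    intro s hs t ht hst
    simp only [hQ]
    rw [clamp_eq hs, clamp_eq ht, setIntegral_slab_add hs.1 hst
      (hGi.mono_set (slab_subset_strip le_rfl ht.2))]
    ring
  have hPm : Monotone P := by
    intro s t hst
    have h1 := clamp_mem hab s
    have h2 := clamp_mem hab t
    have h3 := hPsub _ h1 _ h2
    have h4 : 0 ≤ ∫ r in clamp a b s..clamp a b t, F r :=
      intervalIntegral.integral_nonneg (monotone_clamp a b hst) fun r _ => energy_nonneg _
    simp only [hP, clamp_eq h1, clamp_eq h2] at h3 ⊢
    linarith
  have hQ01 : ∀ s, 0 ≤ Q s ∧ Q s ≤ G := fun s =>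
    ⟨integral_nonneg fun _ => sq_nonneg _, (setIntegral_mono_set
      (hGi.mono_set (slab_subset_strip le_rfl le_rfl)) (Eventually.of_forall fun _ => sq_nonneg _)
      (Eventually.of_forall (prod_mono (Ioc_subset_Ioc le_rfl (clamp_mem hab s).2)
        subset_rfl))).trans hG⟩
  have hmemt : t ∈ Icc a b := ⟨ha'.1.trans hat, by linarith⟩
  have hslope' : ∀ θ, 0 ≤ θ → P (a' + θ) - P a' ≤ L * θ := by
    intro θ hθ
    have h1 := clamp_mem hab (a' + θ)
    have h2 : a' ≤ clamp a b (a' + θ) := by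
      have := monotone_clamp a b (show a' ≤ a' + θ by linarith)
      rwa [clamp_eq ha'] at this
    have h3 : clamp a b (a' + θ) ≤ a' + θ :=
      max_le (by linarith [ha'.1]) (min_le_right _ _)
    have e : P (a' + θ) = P (clamp a b (a' + θ)) := by simp only [hP, clamp_eq h1]
    rw [e, hPsub _ ha' _ h1]
    refine (hslope _ ⟨h2, h1.2⟩).trans (mul_le_mul_of_nonneg_left (by linarith) hL)
  have hmain := diffQuot_estimate (P := P) (Q := Q) (F := F) (H := b - t)
    (D := fun s θ => ‖toL2 (v (clamp a b (s + θ)) - v (clamp a b s))‖ ^ 2) hPc hPm hQc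
    (by
      have h1 : Continuous fun p : ℝ × ℝ => v (clamp a b (p.1 + p.2)) :=
        hv.comp (by fun_prop : Continuous fun p : ℝ × ℝ => p.1 + p.2)
      have h2 : Continuous fun p : ℝ × ℝ => v (clamp a b p.1) := hv.comp continuous_fst
      exact (toL2.continuous.comp (h1.sub h2)).norm.pow 2)
    (fun _ _ => sq_nonneg _) (fun s => by simp) hat hL ((hQ01 a).1.trans (hQ01 a).2)
    (hFsub _ ha' _ hmemt) (hPsub _ ha' _ hmemt) hQ01 hslope' ?_ hh (by linarith)
  · refine ⟨hmain.1, le_trans (le_of_eq ?_) hmain.2⟩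
    refine intervalIntegral.integral_congr fun θ hθ => ?_
    rw [uIcc_of_le hh.le] at hθ
    exact (hPsub _ hmemt _ ⟨by linarith [hmemt.1, hθ.1], by linarith [hθ.2]⟩).symm
  · intro k hk hkH
    have hFe' : ∀ᵐ s ∂volume.restrict (Icc a' t), EnergyLE (v s) (F s) := by
      rw [← restrict_Ioc_eq_restrict_Icc]
      exact ae_restrict_of_ae_restrict_of_subset (Ioc_subset_Ioc ha'.1 hmemt.2) hFe
    -- The variational inequality on `[s, s + k]` with the competitor `v s`.
    filter_upwards [hFe', ae_restrict_mem measurableSet_Icc] with s hs hsm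
    have hs1 : s ∈ Icc a b := ⟨ha'.1.trans hsm.1, hsm.2.trans hmemt.2⟩
    have hs2 : s + k ∈ Icc a b := ⟨by linarith [hs1.1], by linarith [hsm.2]⟩
    have e1 := hevi (v s) (H.mem_wallSpace s hs1) _ hs s (s + k) hs1.1 (by linarith) hs2.2
    have e2 := H.setIntegral_forcing_le hs1.1 (show s ≤ s + k by linarith) hs2.2 (v s) hk
    rw [hPsub _ hs1 _ hs2, hQsub _ hs1 _ hs2 (by linarith), clamp_eq hs1, clamp_eq hs2]
    have e3 : ∫ r in s..s + k, ‖toL2 (v r - v s)‖ ^ 2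
        = ∫ θ in (0 : ℝ)..k, ‖toL2 (v (clamp a b (s + θ)) - v s)‖ ^ 2 := by
      have := intervalIntegral.integral_comp_add_left (a := 0) (b := k)
        (fun r => ‖toL2 (v r - v s)‖ ^ 2) s
      rw [add_zero] at this
      rw [← this]
      refine intervalIntegral.integral_congr fun θ hθ => ?_
      rw [uIcc_of_le hk.le] at hθ
      rw [clamp_eq (r := s + θ) ⟨by linarith [hs1.1, hθ.1], by linarith [hs2.2, hθ.2]⟩]
    rw [sub_self, map_zero, norm_zero] at e1
    rw [e3] at e2
    linarith

/-- At every later time the energy is bounded. -/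
lemma IsEVI.energyLE_of_slope (H : IsEVI K₁ K₂ a b v g)
    (h0 : (0 : C(unitInterval, ℝ)) ∈ wallSpace K₁ K₂)
    {L G : ℝ} (hL : 0 ≤ L) (hG : ∫ p in slab a b, g p ^ 2 ≤ G) {a' : ℝ} (ha' : a' ∈ Icc a b)
    (hslope : ∀ r ∈ Icc a' b, ∫ r in a'..r, energy (v r) ≤ L * (r - a')) {t : ℝ} (hat : a' ≤ t)
    (htb : t < b) : EnergyLE (v t) (2 * L + 4 * G) := by
  intro K
  by_contra! hlt
  -- If the energy at time `t` were larger, then by lower semicontinuity so would be its values just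
  -- after `t`, against the bound on their means.
  obtain ⟨κ, hκ1, hκ2⟩ := exists_between hlt
  have hab : a ≤ b := ha'.1.trans ha'.2
  obtain ⟨hFi, hFe, -⟩ := H.energy_integrable h0 hab
  have hcont := ((continuous_partialEnergy K).comp_continuousOn H.continuousOn) t
    ⟨ha'.1.trans hat, htb.le⟩
  have hev : ∀ᶠ r in 𝓝[Icc a b] t, κ < partialEnergy K (v r) := hcont.eventually_const_lt hκ2
  obtain ⟨ε, hε, hball⟩ := Metric.mem_nhdsWithin_iff.1 hev
  set h := min (ε / 2) (b - t) with hh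
  have hh0 : 0 < h := lt_min (by linarith) (by linarith)
  have hhb : t + h ≤ b := by linarith [min_le_right (ε / 2) (b - t)]
  have hhε : h < ε := (min_le_left _ _).trans_lt (by linarith)
  have hmain := (H.diffQuot_le h0 hL hG ha' hslope hat hh0 hhb).2
  have hta : a ≤ t := ha'.1.trans hat
  have hFsub : ∀ θ ∈ Icc 0 h, IntervalIntegrable (fun r => energy (v r)) volume t (t + θ) :=
    fun θ hθ => hFi.mono_set (by
      rw [uIcc_of_le hab, uIcc_of_le (by linarith [hθ.1])]
      exact Icc_subset_Icc hta (by linarith [hθ.2]))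
  have hlow : ∀ θ ∈ Icc 0 h, κ * θ ≤ ∫ r in t..t + θ, energy (v r) := by
    intro θ hθ
    have : ∫ r in t..t + θ, κ ≤ ∫ r in t..t + θ, energy (v r) := by
      rw [intervalIntegral.integral_of_le (by linarith [hθ.1]),
        intervalIntegral.integral_of_le (by linarith [hθ.1])]
      have hi := (hFsub θ hθ).1
      refine setIntegral_mono_ae_restrict (by simp) hi ?_
      have := ae_restrict_of_ae_restrict_of_subset
        (Ioc_subset_Ioc hta (show t + θ ≤ b by linarith [hθ.2])) hFe
      filter_upwards [this, ae_restrict_mem measurableSet_Ioc] with r hr hrm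
      refine le_trans (le_of_lt (hball ⟨?_, ?_⟩)) (hr K)
      · rw [Metric.mem_ball, Real.dist_eq, abs_lt]
        constructor <;> linarith [hrm.1, hrm.2, hθ.2]
      · exact ⟨by linarith [hrm.1], by linarith [hrm.2, hθ.2]⟩
    rw [intervalIntegral.integral_const, smul_eq_mul] at this
    linarith
  have hprim : IntervalIntegrable (fun θ => ∫ r in t..t + θ, energy (v r)) volume 0 h := by
    refine ContinuousOn.intervalIntegrable ?_
    have hF1 : IntervalIntegrable (fun r => energy (v r)) volume t (t + h) :=
      hFsub h ⟨hh0.le, le_rfl⟩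
    have := intervalIntegral.continuousOn_primitive_interval' hF1 left_mem_uIcc
    refine this.comp (Continuous.continuousOn (by fun_prop)) fun θ hθ => ?_
    rw [uIcc_of_le hh0.le] at hθ
    rw [uIcc_of_le (by linarith)]
    exact ⟨by linarith [hθ.1], by linarith [hθ.2]⟩
  have hlow2 : ∫ θ in (0 : ℝ)..h, κ * θ ≤ ∫ θ in (0 : ℝ)..h, ∫ r in t..t + θ, energy (v r) :=
    intervalIntegral.integral_mono_on hh0.le
      ((continuous_const.mul continuous_id).intervalIntegrable _ _) hprim hlow
  rw [intervalIntegral.integral_const_mul, integral_id] at hlow2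
  have : 0 < h ^ 2 := by positivity
  nlinarith

/-- A path of bounded forcing has bounded energy after an arbitrarily short time. -/
theorem IsEVI.exists_energyLE (H : IsEVI K₁ K₂ a b v g)
    (h0 : (0 : C(unitInterval, ℝ)) ∈ wallSpace K₁ K₂) (hab : a ≤ b)
    {L G δ : ℝ} (hG : ∫ p in slab a b, g p ^ 2 ≤ G) (hL0 : 0 < L) (hδ : δ < b - a)
    (hL : 2 * (wallBound K₁ K₂) ^ 2 * (1 + (b - a)) + G ≤ L * δ) :
    ∃ a' ∈ Ico a b, a' - a ≤ δ ∧ (∀ r ∈ Icc a' b, ∫ r in a'..r, energy (v r) ≤ L * (r - a')) ∧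
      ∀ t ∈ Icc a' b, EnergyLE (v t) (2 * L + 4 * G) := by
  obtain ⟨hFi, hFe, hevi⟩ := H.energy_integrable h0 hab
  have hG0 : 0 ≤ ∫ p in slab a b, g p ^ 2 := integral_nonneg fun _ => sq_nonneg _
  have hR := wallBound_nonneg K₁ K₂
  have hba : 0 ≤ b - a := by linarith
  have hFsub : ∀ s ∈ Icc a b, ∀ t ∈ Icc a b,
      IntervalIntegrable (fun r => energy (v r)) volume s t := fun s hs t ht =>
    hFi.mono_set (by rw [uIcc_of_le hab]; exact uIcc_subset_Icc hs ht)
  have hbound : ∀ r ∈ Icc a b, ‖toL2 (v r - 0)‖ ≤ wallBound K₁ K₂ := fun r hr => by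
    rw [sub_zero]
    exact (norm_toL2_le _).trans (norm_le_wallBound (H.mem_wallSpace r hr))
  -- The total energy, from the competitor `0`.
  have htotal : ∫ r in a..b, energy (v r) ≤ L * δ := by
    have e1 := hevi 0 h0 0 energyLE_zero a b le_rfl hab le_rfl
    have e2 := H.setIntegral_forcing_le le_rfl hab le_rfl 0 one_pos
    have e3 : ∫ r in a..b, ‖toL2 (v r - 0)‖ ^ 2 ≤ ∫ _ in a..b, wallBound K₁ K₂ ^ 2 := by
      refine intervalIntegral.integral_mono_on hab (ContinuousOn.intervalIntegrable ?_) (by simp)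
        fun r hr => pow_le_pow_left₀ (norm_nonneg _) (hbound r hr) 2
      rw [uIcc_of_le hab]
      exact (toL2.continuous.comp_continuousOn
        (H.continuousOn.sub continuousOn_const)).norm.pow 2
    rw [intervalIntegral.integral_const, smul_eq_mul] at e3
    have e4 := pow_le_pow_left₀ (norm_nonneg _) (hbound a ⟨le_rfl, hab⟩) 2
    have e5 := sq_nonneg ‖toL2 (v b - 0)‖
    nlinarith [mul_nonneg hba (sq_nonneg (wallBound K₁ K₂))]
  have hPc : ContinuousOn (fun s => ∫ r in a..s, energy (v r)) (Icc a b) := by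
    have := intervalIntegral.continuousOn_primitive_interval' hFi left_mem_uIcc
    rwa [uIcc_of_le hab] at this
  -- The starting time maximizes the excess of the primitive over a line of slope `L`.
  obtain ⟨a', ha', hmax⟩ := isCompact_Icc.exists_isMaxOn (nonempty_Icc.2 hab)
    (hPc.sub (Continuous.continuousOn (by fun_prop : Continuous fun s : ℝ => L * s)))
  have hmax' : ∀ r ∈ Icc a b, (∫ r in a..r, energy (v r)) - L * r
      ≤ (∫ r in a..a', energy (v r)) - L * a' := fun r hr => hmax hr
  have hslope : ∀ r ∈ Icc a' b, ∫ r in a'..r, energy (v r) ≤ L * (r - a') := by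
    intro r hr
    have hr' : r ∈ Icc a b := ⟨ha'.1.trans hr.1, hr.2⟩
    have := hmax' r hr'
    rw [← intervalIntegral.integral_interval_sub_left (hFsub _ ⟨le_rfl, hab⟩ _ hr')
      (hFsub _ ⟨le_rfl, hab⟩ _ ha')]
    linarith
  have hsmall : L * (a' - a) ≤ L * δ := by
    have h1 := hmax' a ⟨le_rfl, hab⟩
    rw [intervalIntegral.integral_same] at h1
    have h2 : ∫ r in a..a', energy (v r) ≤ ∫ r in a..b, energy (v r) :=
      intervalIntegral.integral_mono_interval le_rfl ha'.1 ha'.2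
        (Eventually.of_forall fun _ => energy_nonneg _) hFi
    linarith
  have hδ' : a' - a ≤ δ := le_of_mul_le_mul_left hsmall hL0
  have hlt : a' < b := by linarith
  have hE := fun t => H.energyLE_of_slope (t := t) h0 hL0.le hG ha' hslope
  refine ⟨a', ⟨ha'.1, hlt⟩, hδ', hslope, fun t ht => ?_⟩
  rcases ht.2.lt_or_eq with htb | rfl
  · exact hE t ht.1 htb
  · intro K
    have hcont := ((continuous_partialEnergy K).comp_continuousOn H.continuousOn) t
      ⟨hab, le_rfl⟩
    -- The final time is reached by continuity of the partial energies.
    have hne : (𝓝[Ico a' t] t).NeBot := by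
      rw [← mem_closure_iff_nhdsWithin_neBot, closure_Ico hlt.ne]
      exact ⟨hlt.le, le_rfl⟩
    exact le_of_tendsto (hcont.mono (Ico_subset_Icc_self.trans (Icc_subset_Icc ha'.1 le_rfl)))
      (eventually_mem_nhdsWithin.mono fun s hs => hE s hs.1 hs.2 K)

/-! ### Time regularity and subgradients -/

section L2

variable {X : Type*} [MeasurableSpace X] {μ : Measure X} {p q : X → ℝ}

lemma inner_toLp (hp : MemLp p 2 μ) (hq : MemLp q 2 μ) :
    inner ℝ (hp.toLp p) (hq.toLp q) = ∫ x, p x * q x ∂μ := by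
  rw [L2.inner_def]
  refine integral_congr_ae ?_
  filter_upwards [hp.coeFn_toLp, hq.coeFn_toLp] with x h1 h2
  rw [h1, h2]
  exact mul_comm _ _

lemma norm_toLp_sq (hp : MemLp p 2 μ) : ‖hp.toLp p‖ ^ 2 = ∫ x, p x ^ 2 ∂μ := by
  rw [← real_inner_self_eq_norm_sq, inner_toLp]
  simp_rw [sq]

lemma abs_integral_mul_le (hp : MemLp p 2 μ) (hq : MemLp q 2 μ) :
    |∫ x, p x * q x ∂μ| ≤ √(∫ x, p x ^ 2 ∂μ) * √(∫ x, q x ^ 2 ∂μ) := by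
  rw [← inner_toLp hp hq, ← norm_toLp_sq hp, ← norm_toLp_sq hq, Real.sqrt_sq (norm_nonneg _),
    Real.sqrt_sq (norm_nonneg _)]
  exact abs_real_inner_le_norm _ _

end L2

/-- Riesz representation of a functional on continuous functions that is bounded in `L²`. -/
lemma exists_riesz (Λ : C(unitInterval, ℝ) →ₗ[ℝ] ℝ) {C : ℝ} (hΛ : ∀ ψ, |Λ ψ| ≤ C * ‖toL2 ψ‖) :
    ∃ ζ : Lp ℝ 2 (volume : Measure unitInterval), ∀ ψ, inner ℝ ζ (toL2 ψ) = Λ ψ := by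
  have hd : DenseRange (toL2 : C(unitInterval, ℝ) →ₗ[ℝ] Lp ℝ 2 (volume : Measure unitInterval)) :=
    ContinuousMap.toLp_denseRange ℝ (volume : Measure unitInterval) ℝ (by simp)
  refine ⟨(InnerProductSpace.toDual ℝ _).symm (Λ.extendOfNorm (toL2 : _ →ₗ[ℝ] _)), fun ψ => ?_⟩
  rw [InnerProductSpace.toDual_symm_apply]
  exact LinearMap.extendOfNorm_eq hd ⟨C, hΛ⟩ ψ

variable {K₁ K₂ : C(unitInterval, ℝ)} {a b : ℝ} {v : ℝ → C(unitInterval, ℝ)}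
  {g : ℝ × unitInterval → ℝ}

/-- Hölder continuity in time, from a time at which the energy is finite. -/
lemma IsEVI.norm_sub_sq_le (H : IsEVI K₁ K₂ a b v g) {G M s t : ℝ}
    (hG : ∫ p in slab a b, g p ^ 2 ≤ G) (has : a ≤ s) (hst : s ≤ t) (htb : t ≤ b)
    (hM : EnergyLE (v s) M) :
    ‖toL2 (v t - v s)‖ ^ 2 ≤ 2 * M * (t - s) + 2 * (G + wallBound K₁ K₂ ^ 2) * √(t - s) := by
  rcases hst.eq_or_lt with rfl | hlt
  · simp
  have hts : 0 < t - s := sub_pos.2 hlt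
  have hk : 0 < √(t - s) := Real.sqrt_pos.2 hts
  have hsm : s ∈ Icc a b := ⟨has, hst.trans htb⟩
  have e1 := H.evi (v s) (H.mem_wallSpace s hsm) M hM s t has hst htb 0
  -- Young's inequality with the weight `√(t - s)`.
  have e2 := H.setIntegral_forcing_le has hst htb (v s) hk
  have e3 : 0 ≤ ∫ r in s..t, partialEnergy 0 (v r) :=
    intervalIntegral.integral_nonneg hst fun r _ => partialEnergy_nonneg _ _
  have e4 : ∫ p in slab s t, g p ^ 2 ≤ G :=
    (setIntegral_mono_set (H.integrableOn_sq.mono_set (slab_subset_strip le_rfl le_rfl))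
      (Eventually.of_forall fun _ => sq_nonneg _)
      (Eventually.of_forall (prod_mono (Ioc_subset_Ioc has htb) subset_rfl))).trans hG
  have e5 : ∫ r in s..t, ‖toL2 (v r - v s)‖ ^ 2 ≤ ∫ _ in s..t, (2 * wallBound K₁ K₂) ^ 2 := by
    refine intervalIntegral.integral_mono_on hst (ContinuousOn.intervalIntegrable ?_) (by simp)
      fun r hr => pow_le_pow_left₀ (norm_nonneg _) (norm_toL2_sub_le (H.mem_wallSpace r
        ⟨has.trans hr.1, hr.2.trans htb⟩) (H.mem_wallSpace s hsm)) 2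
    rw [uIcc_of_le hst]
    exact (toL2.continuous.comp_continuousOn ((H.continuousOn.mono
      (Icc_subset_Icc has htb)).sub continuousOn_const)).norm.pow 2
  rw [intervalIntegral.integral_const, smul_eq_mul] at e5
  rw [sub_self, map_zero, norm_zero] at e1
  have e6 : (4 * √(t - s))⁻¹ * ∫ r in s..t, ‖toL2 (v r - v s)‖ ^ 2
      ≤ wallBound K₁ K₂ ^ 2 * √(t - s) := by
    calc (4 * √(t - s))⁻¹ * ∫ r in s..t, ‖toL2 (v r - v s)‖ ^ 2
        ≤ (4 * √(t - s))⁻¹ * ((t - s) * (2 * wallBound K₁ K₂) ^ 2) :=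
          mul_le_mul_of_nonneg_left e5 (by positivity)
      _ = (4 * √(t - s))⁻¹ * ((√(t - s)) ^ 2 * (2 * wallBound K₁ K₂) ^ 2) := by
          rw [Real.sq_sqrt hts.le]
      _ = _ := by field_simp; ring
  have e7 := mul_le_mul_of_nonneg_left e4 hk.le
  linarith

/-- `ζ` is a subgradient at `u` of the energy restricted to the functions between the walls. -/
def IsSubgradient (K₁ K₂ u : C(unitInterval, ℝ)) (ζ : Lp ℝ 2 (volume : Measure unitInterval)) :
    Prop :=
  ∀ x ∈ wallSpace K₁ K₂, ∀ E, EnergyLE x E → EnergyLE u (E + inner ℝ ζ (toL2 (u - x)))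

lemma integrableOn_mul_comp_snd (hg : IntegrableOn g (strip a b)) (x : C(unitInterval, ℝ)) :
    IntegrableOn (fun p => g p * x p.2) (strip a b) :=
  hg.mul_continuousOn (Continuous.continuousOn (by fun_prop)) (isCompact_strip a b)

/-- The difference quotient of the variational inequality, as a linear functional. -/
def quotientMap (hg : IntegrableOn g (strip a b)) (h : ℝ) (w : C(unitInterval, ℝ)) :
    C(unitInterval, ℝ) →ₗ[ℝ] ℝ where
  toFun ψ := h⁻¹ * (∫ p in strip a b, g p * ψ p.2) - h⁻¹ * inner ℝ (toL2 w) (toL2 ψ)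
  map_add' ψ χ := by
    simp only [ContinuousMap.add_apply, mul_add, map_add, inner_add_right]
    rw [integral_add (integrableOn_mul_comp_snd hg ψ) (integrableOn_mul_comp_snd hg χ)]
    ring
  map_smul' c ψ := by
    simp only [ContinuousMap.smul_apply, smul_eq_mul, map_smul, inner_smul_right, RingHom.id_apply,
      mul_left_comm _ c]
    rw [integral_const_mul]
    ring

lemma memLp_comp_snd (x : C(unitInterval, ℝ)) (a b : ℝ) :
    MemLp (fun p : ℝ × unitInterval => x p.2) 2 (volume.restrict (strip a b)) :=
  MemLp.of_bound (Continuous.aestronglyMeasurable (by fun_prop)) ‖x‖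
    (Eventually.of_forall fun p => x.norm_coe_le_norm p.2)

lemma setIntegral_strip_comp_snd (x : C(unitInterval, ℝ)) {a b : ℝ} (hab : a ≤ b) :
    ∫ p in strip a b, x p.2 ^ 2 = (b - a) * ‖toL2 x‖ ^ 2 := by
  have h := (memLp_comp_snd x a b).integrable_sq
  rw [setIntegral_strip_eq, setIntegral_slab_eq hab
    (IntegrableOn.mono_set h (slab_subset_strip le_rfl le_rfl))]
  simp only
  rw [intervalIntegral.integral_const, smul_eq_mul, norm_toL2_sq]

/-- At some time the difference quotients of the path and the averages of the squared forcing are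
bounded along a sequence of time increments. -/
lemma IsEVI.exists_bounded_diffQuot (H : IsEVI K₁ K₂ a b v g)
    (h0 : (0 : C(unitInterval, ℝ)) ∈ wallSpace K₁ K₂) (hab : a < b) :
    ∃ s ∈ Ioo a b, ∃ (h : ℕ → ℝ) (C : ℝ≥0), (∀ n, 0 < h n) ∧ (∀ n, s + h n ≤ b) ∧
      Tendsto h atTop (𝓝 0) ∧ ∃ᶠ n in atTop, ‖toL2 (v (s + h n) - v s)‖ ≤ √C * h n ∧
        ∫ p in strip s (s + h n), g p ^ 2 ≤ C * h n := by
  set G := ∫ p in slab a b, g p ^ 2 with hG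
  have hG0 : 0 ≤ G := integral_nonneg fun _ => sq_nonneg _
  have hgi : IntegrableOn (fun p => g p ^ 2) (strip a b) := H.integrableOn_sq
  set δ := (b - a) / 2 with hδ
  have hδ0 : 0 < δ := by rw [hδ]; linarith
  set L := (2 * (wallBound K₁ K₂) ^ 2 * (1 + (b - a)) + G) / δ + 1 with hL
  have hba : 0 ≤ b - a := by linarith
  have hL0 : 0 < L := by positivity
  obtain ⟨a', ha', -, hslope, -⟩ := H.exists_energyLE (L := L) (δ := δ) h0 hab.le le_rfl hL0
    (by rw [hδ]; linarith) (by
      have : L * δ = 2 * (wallBound K₁ K₂) ^ 2 * (1 + (b - a)) + G + δ := by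
        rw [hL]; field_simp
      linarith)
  set t := (a' + b) / 2 with ht
  have hat : a' < t := by rw [ht]; linarith [ha'.2]
  have htb : t < b := by rw [ht]; linarith [ha'.2]
  set h : ℕ → ℝ := fun n => (b - t) / (n + 1) with hh
  have hh0 : ∀ n, 0 < h n := fun n => div_pos (by linarith) (by positivity)
  have hhb : ∀ n, t + h n ≤ b := fun n => by
    have : h n ≤ b - t := div_le_self (by linarith) (by linarith [Nat.cast_nonneg (α := ℝ) n])
    linarith
  have hhlim : Tendsto h atTop (𝓝 0) := by
    have := (tendsto_one_div_add_atTop_nhds_zero_nat (𝕜 := ℝ)).const_mul (b - t)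
    simpa [hh, div_eq_mul_inv] using this
  have hv := ContinuousOn.comp_clamp H.continuousOn hab.le
  set Q : ℝ → ℝ := fun s => ∫ p in slab a (clamp a b s), g p ^ 2 with hQ
  have hQc : Continuous Q :=
    ContinuousOn.comp_clamp (continuousOn_setIntegral_slab hab.le hgi) hab.le
  have hQ01 : ∀ s, 0 ≤ Q s ∧ Q s ≤ G := fun s =>
    ⟨integral_nonneg fun _ => sq_nonneg _, setIntegral_mono_set
      (hgi.mono_set (slab_subset_strip le_rfl le_rfl)) (Eventually.of_forall fun _ => sq_nonneg _)
      (Eventually.of_forall (prod_mono (Ioc_subset_Ioc le_rfl (clamp_mem hab.le s).2) subset_rfl))⟩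
  set q : ℕ → ℝ → ℝ := fun n s =>
    (h n ^ 2)⁻¹ * ‖toL2 (v (clamp a b (s + h n)) - v (clamp a b s))‖ ^ 2
      + (h n)⁻¹ * (Q (s + h n) - Q s) with hq
  have hqc1 : ∀ n, Continuous fun s => ‖toL2 (v (clamp a b (s + h n)) - v (clamp a b s))‖ ^ 2 :=
    fun n => (toL2.continuous.comp ((hv.comp (continuous_add_const (h n))).sub hv)).norm.pow 2
  have hqc2 : ∀ n, Continuous fun s => Q (s + h n) - Q s := fun n => by fun_prop
  have hqc : ∀ n, Continuous (q n) := fun n =>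
    ((hqc1 n).const_mul _).add ((hqc2 n).const_mul _)
  have hQsub : ∀ s ∈ Icc a b, ∀ t ∈ Icc a b, s ≤ t → Q t - Q s = ∫ p in slab s t, g p ^ 2 := by
    intro s hs t ht hst
    simp only [hQ]
    rw [clamp_eq hs, clamp_eq ht, setIntegral_slab_add hs.1 hst
      (hgi.mono_set (slab_subset_strip le_rfl ht.2))]
    ring
  have hmem : ∀ n, ∀ s ∈ Icc a' t, s ∈ Icc a b ∧ s + h n ∈ Icc a b := fun n s hs =>
    ⟨⟨ha'.1.trans hs.1, hs.2.trans htb.le⟩, by linarith [ha'.1, hs.1, hh0 n],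
      by linarith [hs.2, hhb n]⟩
  have hq0 : ∀ n, ∀ s ∈ Icc a' t, 0 ≤ q n s := by
    intro n s hs
    have h1 := hQsub s (hmem n s hs).1 _ (hmem n s hs).2 (by linarith [hh0 n])
    have h2 : 0 ≤ Q (s + h n) - Q s := by rw [h1]; exact integral_nonneg fun _ => sq_nonneg _
    have := (hh0 n).le
    positivity
  have hqint : ∀ n, ∫ s in a'..t, q n s ≤ 2 * L + 5 * G := by
    intro n
    have e1 := (H.diffQuot_le h0 hL0.le le_rfl ⟨ha'.1, ha'.2.le⟩ hslope hat.le (hh0 n) (hhb n)).1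
    have e2 : ∫ s in a'..t, (Q (s + h n) - Q s) ≤ h n * G := by
      rw [integral_shift_sub hQc]
      have hQi : ∀ c, IntervalIntegrable (fun θ => Q (c + θ)) volume 0 (h n) := fun c =>
        Continuous.intervalIntegrable (by fun_prop) _ _
      have e3 := intervalIntegral.integral_mono_on (hh0 n).le (hQi t)
        (intervalIntegrable_const (μ := volume) (c := G)) fun θ _ => (hQ01 (t + θ)).2
      have e4 : 0 ≤ ∫ θ in (0 : ℝ)..h n, Q (a' + θ) :=
        intervalIntegral.integral_nonneg (hh0 n).le fun θ _ => (hQ01 (a' + θ)).1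
      rw [intervalIntegral.integral_const, smul_eq_mul, sub_zero] at e3
      linarith
    simp only [hq]
    rw [intervalIntegral.integral_add (((hqc1 n).const_mul _).intervalIntegrable _ _)
      (((hqc2 n).const_mul _).intervalIntegrable _ _), intervalIntegral.integral_const_mul,
      intervalIntegral.integral_const_mul]
    have p := hh0 n
    have e5 := mul_le_mul_of_nonneg_left e1 (show 0 ≤ (h n ^ 2)⁻¹ by positivity)
    have e6 := mul_le_mul_of_nonneg_left e2 (show 0 ≤ (h n)⁻¹ by positivity)
    have e7 : (h n ^ 2)⁻¹ * ((2 * L + 4 * G) * h n ^ 2) = 2 * L + 4 * G := by field_simp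
    have e8 : (h n)⁻¹ * (h n * G) = G := by field_simp
    linarith
  -- By Fatou's lemma the difference quotients are bounded along a subsequence at some time.
  obtain ⟨s, hs, hslim⟩ : ∃ s ∈ Ioo a' t,
      liminf (fun n => ENNReal.ofReal (q n s)) atTop < ⊤ := by
    have hm : ∀ n, Measurable fun s => ENNReal.ofReal (q n s) := fun n =>
      (hqc n).measurable.ennreal_ofReal
    have hfatou := lintegral_liminf_le (μ := volume.restrict (Ioo a' t)) (u := atTop) hm
    have hle : ∀ n, ∫⁻ s in Ioo a' t, ENNReal.ofReal (q n s) ≤ ENNReal.ofReal (2 * L + 5 * G) := by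
      intro n
      rw [← ofReal_integral_eq_lintegral_ofReal]
      · refine ENNReal.ofReal_le_ofReal ?_
        rw [← integral_Ioc_eq_integral_Ioo, ← intervalIntegral.integral_of_le hat.le]
        exact hqint n
      · exact (hqc n).integrableOn_Icc.mono_set Ioo_subset_Icc_self
      · filter_upwards [ae_restrict_mem measurableSet_Ioo] with s hs
        exact hq0 n s (Ioo_subset_Icc_self hs)
    have hfin : ∫⁻ s in Ioo a' t, liminf (fun n => ENNReal.ofReal (q n s)) atTop ≠ ⊤ := by
      refine (lt_of_le_of_lt (hfatou.trans ?_) (ENNReal.ofReal_lt_top (r := 2 * L + 5 * G))).ne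
      exact (liminf_le_liminf (Eventually.of_forall hle)).trans (by simp)
    have hae := ae_lt_top (Measurable.liminf hm) hfin
    have hne : (ae (volume.restrict (Ioo a' t))).NeBot := by
      rw [ae_neBot, Ne, Measure.restrict_eq_zero, Real.volume_Ioo]
      simpa using hat
    obtain ⟨s, hs1, hs2⟩ := (hae.and (ae_restrict_mem measurableSet_Ioo)).exists
    exact ⟨s, hs2, hs1⟩
  obtain ⟨C, hC1, hC2⟩ := ENNReal.lt_iff_exists_nnreal_btwn.1 hslim
  have hfreq : ∃ᶠ n in atTop, q n s ≤ C := by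
    refine (frequently_lt_of_liminf_lt (by isBoundedDefault) hC1).mono fun n hn => ?_
    rw [← ENNReal.ofReal_coe_nnreal] at hn
    exact ((ENNReal.ofReal_lt_ofReal_iff_of_nonneg (hq0 n s (Ioo_subset_Icc_self hs))).1 hn).le
  have hsm := fun n => hmem n s (Ioo_subset_Icc_self hs)
  have hqs : ∀ n, q n s ≤ C → ‖toL2 (v (s + h n) - v s)‖ ≤ √C * h n ∧
      ∫ p in strip s (s + h n), g p ^ 2 ≤ C * h n := by
    intro n hn
    simp only [hq] at hn
    have p := hh0 n
    have e0 : 0 ≤ ∫ p in slab s (s + h n), g p ^ 2 := integral_nonneg fun _ => sq_nonneg _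
    rw [hQsub s (hsm n).1 _ (hsm n).2 (by linarith), clamp_eq (hsm n).1, clamp_eq (hsm n).2] at hn
    rw [setIntegral_strip_eq]
    set y := ‖toL2 (v (s + h n) - v s)‖
    have e1 : 0 ≤ (h n ^ 2)⁻¹ * y ^ 2 := by positivity
    have e2 : 0 ≤ (h n)⁻¹ * ∫ p in slab s (s + h n), g p ^ 2 := by positivity
    constructor
    · have e3 : y ^ 2 ≤ C * h n ^ 2 := by
        have : (h n ^ 2)⁻¹ * y ^ 2 ≤ C := by linarith
        rwa [inv_mul_le_iff₀ (by positivity), mul_comm] at this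
      calc y ≤ √(C * h n ^ 2) := Real.le_sqrt_of_sq_le e3
        _ = √C * h n := by rw [Real.sqrt_mul' _ (sq_nonneg _), Real.sqrt_sq p.le]
    · have : (h n)⁻¹ * ∫ p in slab s (s + h n), g p ^ 2 ≤ C := by linarith
      rwa [inv_mul_le_iff₀ p, mul_comm] at this
  exact ⟨s, ⟨ha'.1.trans_lt hs.1, hs.2.trans htb⟩, h, C, hh0,
    fun n => (hsm n).2.2, hhlim, hfreq.mono hqs⟩

/-- At some time the energy of a solution of the variational inequality has a subgradient. -/
theorem IsEVI.exists_isSubgradient (H : IsEVI K₁ K₂ a b v g)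
    (h0 : (0 : C(unitInterval, ℝ)) ∈ wallSpace K₁ K₂) (hab : a < b) :
    ∃ s ∈ Ioo a b, ∃ ζ, IsSubgradient K₁ K₂ (v s) ζ := by
  obtain ⟨s, hs, h, C, hh0, hhb, hhlim, hfreq⟩ := H.exists_bounded_diffQuot h0 hab
  set W : Set ℕ := {n | ‖toL2 (v (s + h n) - v s)‖ ≤ √C * h n ∧
    ∫ p in strip s (s + h n), g p ^ 2 ≤ C * h n}
  obtain ⟨U, hU⟩ : ∃ U : Ultrafilter ℕ, (U : Filter ℕ) ≤ atTop ⊓ 𝓟 W := by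
    have : (atTop ⊓ 𝓟 W).NeBot := frequently_mem_iff_neBot.1 hfreq
    exact ⟨Ultrafilter.of _, Ultrafilter.of_le _⟩
  have hUq : ∀ᶠ n in (U : Filter ℕ), n ∈ W := hU.trans inf_le_right (mem_principal_self _)
  have hUlim := hU.trans inf_le_left
  have hsm : ∀ n, s ∈ Icc a b ∧ s + h n ∈ Icc a b := fun n =>
    ⟨Ioo_subset_Icc_self hs, by linarith [hs.1, hh0 n], hhb n⟩
  have hgi : IntegrableOn (fun p => g p ^ 2) (strip a b) := H.integrableOn_sq
  have hgsub : ∀ n, IntegrableOn g (strip s (s + h n)) := fun n =>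
    (MemLp.integrableOn_strip H.memLp).mono_set
      (strip_subset_strip (hsm n).1.1 (hsm n).2.2)
  have hgL : ∀ n, MemLp g 2 (volume.restrict (strip s (s + h n))) := fun n =>
    H.memLp.mono_measure (Measure.restrict_mono
      (strip_subset_strip (hsm n).1.1 (hsm n).2.2) le_rfl)
  -- The subgradient is a weak limit of the averaged forcing minus the difference quotient of the
  -- path, over the intervals `[s, s + h n]`.
  set Λn : ℕ → C(unitInterval, ℝ) →ₗ[ℝ] ℝ := fun n =>
    quotientMap (hgsub n) (h n) (v (s + h n) - v s) with hΛn
  have hbound : ∀ ψ, ∀ᶠ n in (U : Filter ℕ), |Λn n ψ| ≤ 2 * √C * ‖toL2 ψ‖ := by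
    intro ψ
    filter_upwards [hUq] with n hn
    obtain ⟨e1, e2⟩ := hn
    have p := hh0 n
    have e3 := abs_integral_mul_le (hgL n) (memLp_comp_snd ψ s (s + h n))
    rw [setIntegral_strip_comp_snd ψ (by linarith), add_sub_cancel_left] at e3
    have e4 : √(∫ p in strip s (s + h n), g p ^ 2) * √(h n * ‖toL2 ψ‖ ^ 2)
        ≤ √C * ‖toL2 ψ‖ * h n := by
      calc _ ≤ √(C * h n) * √(h n * ‖toL2 ψ‖ ^ 2) :=
            mul_le_mul_of_nonneg_right (Real.sqrt_le_sqrt e2) (Real.sqrt_nonneg _)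
        _ = √C * ‖toL2 ψ‖ * (√(h n) * √(h n)) := by
            rw [Real.sqrt_mul' _ p.le, Real.sqrt_mul' _ (sq_nonneg _),
              Real.sqrt_sq (norm_nonneg _)]
            ring
        _ = _ := by rw [Real.mul_self_sqrt p.le]
    have e5 := abs_real_inner_le_norm (toL2 (v (s + h n) - v s)) (toL2 ψ)
    have e6 := mul_le_mul_of_nonneg_right e1 (norm_nonneg (toL2 ψ))
    change |(h n)⁻¹ * _ - (h n)⁻¹ * _| ≤ _
    rw [← mul_sub, abs_mul, abs_of_pos (inv_pos.2 p), inv_mul_le_iff₀ p]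
    refine (abs_sub _ _).trans ?_
    linarith
  obtain ⟨Λ, hΛ⟩ := exists_ultrafilter_limit U Λn _ hbound
  obtain ⟨ζ, hζ⟩ := exists_riesz Λ (C := 2 * √C) fun ψ =>
    le_of_tendsto (hΛ ψ).abs (hbound ψ)
  refine ⟨s, hs, ζ, fun x hx E hE K => ?_⟩
  rw [hζ]
  suffices hsuff : ∀ ε > 0, partialEnergy K (v s) - E - ε * (2 + C) ≤ Λ (v s - x) by
    by_contra! hcon
    have h2C : (0 : ℝ) < 2 + C := by positivity
    have := hsuff ((partialEnergy K (v s) - E - Λ (v s - x)) / (2 * (2 + C)))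
      (div_pos (by linarith) (by positivity))
    have e : (partialEnergy K (v s) - E - Λ (v s - x)) / (2 * (2 + C)) * (2 + C)
        = (partialEnergy K (v s) - E - Λ (v s - x)) / 2 := by field_simp
    linarith
  intro ε hε
  refine ge_of_tendsto (hΛ (v s - x)) ?_
  have hcs := H.continuousOn s (hsm 0).1
  obtain ⟨ρ₁, hρ₁, hb₁⟩ := Metric.mem_nhdsWithin_iff.1
    (hcs.eventually (Metric.ball_mem_nhds _ hε))
  obtain ⟨ρ₂, hρ₂, hb₂⟩ := Metric.mem_nhdsWithin_iff.1
    (((continuous_partialEnergy K).continuousAt.comp_continuousWithinAt hcs).eventually_const_lt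
      (show partialEnergy K (v s) - ε < _ from sub_lt_self _ hε))
  filter_upwards [hUq, hUlim (hhlim.eventually_lt_const (lt_min hρ₁ hρ₂))] with n hn hnρ
  obtain ⟨-, e2⟩ := hn
  have p := hh0 n
  have hnear : ∀ r ∈ Icc s (s + h n), r ∈ Icc a b ∧ dist r s < min ρ₁ ρ₂ := fun r hr => by
    refine ⟨⟨(hsm n).1.1.trans hr.1, hr.2.trans (hsm n).2.2⟩, ?_⟩
    rw [Real.dist_eq, abs_of_nonneg (by linarith [hr.1])]
    linarith [hr.2]
  have e1 := H.evi x hx E hE s (s + h n) (hsm n).1.1 (by linarith) (hsm n).2.2 K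
  -- the quadratic terms
  have e3 : inner ℝ (toL2 (v (s + h n) - v s)) (toL2 (v s - x))
      ≤ ‖toL2 (v (s + h n) - x)‖ ^ 2 / 2 - ‖toL2 (v s - x)‖ ^ 2 / 2 := by
    have : toL2 (v (s + h n) - x) = toL2 (v (s + h n) - v s) + toL2 (v s - x) := by
      rw [← map_add]; congr 1; abel
    rw [this, norm_add_sq_real]
    linarith [sq_nonneg ‖toL2 (v (s + h n) - v s)‖]
  -- the energy
  have e4 : h n * (partialEnergy K (v s) - ε) ≤ ∫ r in s..s + h n, partialEnergy K (v r) := by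
    have hmono := intervalIntegral.integral_mono_on (μ := volume) (show s ≤ s + h n by linarith)
      (intervalIntegrable_const (c := partialEnergy K (v s) - ε))
      (ContinuousOn.intervalIntegrable (u := fun r => partialEnergy K (v r)) (by
        rw [uIcc_of_le (by linarith)]
        exact ((continuous_partialEnergy K).comp_continuousOn H.continuousOn).mono
          (Icc_subset_Icc (hsm n).1.1 (hsm n).2.2)))
      fun r hr => (hb₂ ⟨(hnear r hr).2.trans_le (min_le_right _ _), (hnear r hr).1⟩).le
    rw [intervalIntegral.integral_const, smul_eq_mul, add_sub_cancel_left] at hmono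
    exact hmono
  -- the forcing
  have hslabsub : slab s (s + h n) ⊆ strip a b := slab_subset_strip (hsm n).1.1 (hsm n).2.2
  have e5 : ∫ p in slab s (s + h n), g p * (v p.1 p.2 - x p.2)
      ≤ (∫ p in strip s (s + h n), g p * (v s - x) p.2) + ε * (1 + C) * h n := by
    rw [setIntegral_strip_eq]
    have hgA := MemLp.integrableOn_strip H.memLp
    have i1 : IntegrableOn (fun p => g p * (v s - x) p.2) (slab s (s + h n)) :=
      (integrableOn_mul_comp_snd hgA (v s - x)).mono_set hslabsub
    have hfin : (volume : Measure (ℝ × unitInterval)) (slab s (s + h n)) ≠ ⊤ := by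
      rw [volume_slab]; exact ENNReal.ofReal_ne_top
    have i2 : IntegrableOn (fun p => ε * (1 + g p ^ 2)) (slab s (s + h n)) :=
      Integrable.const_mul ((integrableOn_const hfin).add (hgi.mono_set hslabsub)) ε
    have i3 : ∫ p in slab s (s + h n), ε * (1 + g p ^ 2) ≤ ε * (1 + C) * h n := by
      have i4 : IntegrableOn (fun _ => (1 : ℝ)) (slab s (s + h n))
        (volume : Measure (ℝ × unitInterval)) := integrableOn_const hfin
      rw [integral_const_mul, integral_add i4 (hgi.mono_set hslabsub),
        setIntegral_const, Measure.real, volume_slab, ENNReal.toReal_ofReal (by linarith)]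
      rw [setIntegral_strip_eq] at e2
      simp only [add_sub_cancel_left, smul_eq_mul, mul_one]
      nlinarith
    refine le_trans ?_ (add_le_add_right i3 _)
    rw [← integral_add i1 i2]
    refine setIntegral_mono_on ?_ (i1.add i2) (measurableSet_slab _ _) fun p hp => ?_
    · have : IntegrableOn (fun p => g p * (v p.1 p.2 - x p.2)) (strip a b) :=
        hgA.mul_continuousOn ((continuousOn_eval H.continuousOn).sub
          (Continuous.continuousOn (by fun_prop))) (isCompact_strip a b)
      exact this.mono_set hslabsub
    · have hr := hnear p.1 ⟨hp.1.1.le, hp.1.2⟩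
      have hd : dist (v p.1) (v s) < ε := hb₁ ⟨hr.2.trans_le (min_le_left _ _), hr.1⟩
      have hd' : |v p.1 p.2 - v s p.2| ≤ ε := by
        rw [dist_eq_norm] at hd
        exact ((v p.1 - v s).norm_coe_le_norm p.2).trans hd.le
      have h1 : |g p| ≤ 1 + g p ^ 2 := by
        rw [abs_le]; constructor <;> nlinarith [sq_nonneg (g p - 1), sq_nonneg (g p + 1)]
      have h2 : g p * (v p.1 p.2 - v s p.2) ≤ (1 + g p ^ 2) * ε :=
        (le_abs_self _).trans (by
          rw [abs_mul]; exact mul_le_mul h1 hd' (abs_nonneg _) (by positivity))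
      simp only [ContinuousMap.sub_apply]
      linarith
  change _ ≤ (h n)⁻¹ * _ - (h n)⁻¹ * _
  rw [← mul_sub, le_inv_mul_iff₀ p]
  rw [add_sub_cancel_left] at e1
  nlinarith

/-! ### Compactness of families of paths -/

section WeakLimit

variable {X : Type*} [MeasurableSpace X] {μ : Measure X}

/-- Weak sequential compactness of bounded sets of `L²`. -/
theorem exists_weak_limit (U : Ultrafilter ℕ) {h : ℕ → X → ℝ} (hh : ∀ i, MemLp (h i) 2 μ) {C : ℝ}
    (hC : ∀ i, ∫ x, h i x ^ 2 ∂μ ≤ C) :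
    ∃ k : X → ℝ, MemLp k 2 μ ∧ (∫ x, k x ^ 2 ∂μ ≤ C) ∧ ∀ ψ : X → ℝ, MemLp ψ 2 μ →
      Tendsto (fun i => ∫ x, h i x * ψ x ∂μ) U (𝓝 (∫ x, k x * ψ x ∂μ)) := by
  have hnorm : ∀ i, ‖(hh i).toLp (h i)‖ ≤ √C := fun i =>
    Real.le_sqrt_of_sq_le (by rw [norm_toLp_sq]; exact hC i)
  have hbound : ∀ i (ψ : Lp ℝ 2 μ), |inner ℝ ((hh i).toLp (h i)) ψ| ≤ √C * ‖ψ‖ := fun i ψ =>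
    (abs_real_inner_le_norm _ _).trans (mul_le_mul_of_nonneg_right (hnorm i) (norm_nonneg _))
  obtain ⟨Λ, hΛ⟩ := exists_ultrafilter_limit U
    (fun i => (innerSL ℝ ((hh i).toLp (h i)) : Lp ℝ 2 μ →ₗ[ℝ] ℝ)) (fun ψ => √C * ‖ψ‖)
    fun ψ => Eventually.of_forall fun i => hbound i ψ
  set Λ' := Λ.mkContinuous (√C) fun ψ => le_of_tendsto (hΛ ψ).norm
    (Eventually.of_forall fun i => hbound i ψ) with hΛ'
  set k := (InnerProductSpace.toDual ℝ (Lp ℝ 2 μ)).symm Λ' with hk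
  have hknorm : ‖k‖ ≤ √C := by
    rw [hk, LinearIsometryEquiv.norm_map]
    exact LinearMap.mkContinuous_norm_le _ (Real.sqrt_nonneg _) _
  have hC0 : 0 ≤ C := (integral_nonneg fun _ => sq_nonneg _).trans (hC 0)
  refine ⟨k, Lp.memLp k, ?_, fun ψ hψ => ?_⟩
  · rw [← norm_toLp_sq (Lp.memLp k), Lp.toLp_coeFn, ← Real.sq_sqrt hC0]
    exact pow_le_pow_left₀ (norm_nonneg _) hknorm 2
  have h1 := hΛ (hψ.toLp ψ)
  have h2 : Λ (hψ.toLp ψ) = ∫ x, k x * ψ x ∂μ := by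
    rw [← inner_toLp (Lp.memLp k) hψ, Lp.toLp_coeFn, hk, InnerProductSpace.toDual_symm_apply]
    rfl
  rw [h2] at h1
  refine h1.congr fun i => ?_
  exact inner_toLp (hh i) hψ

/-- Weak lower semicontinuity of the norm of `L²`. -/
lemma integral_sq_le_of_tendsto {U : Ultrafilter ℕ} {h : ℕ → X → ℝ} {k : X → ℝ}
    (hh : ∀ i, MemLp (h i) 2 μ) (hk : MemLp k 2 μ)
    (hlim : Tendsto (fun i => ∫ x, h i x * k x ∂μ) U (𝓝 (∫ x, k x * k x ∂μ))) {l : ℝ}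
    (hl : Tendsto (fun i => ∫ x, h i x ^ 2 ∂μ) U (𝓝 l)) : ∫ x, k x ^ 2 ∂μ ≤ l := by
  have hpos : ∀ i, 0 ≤ (∫ x, h i x ^ 2 ∂μ) - 2 * (∫ x, h i x * k x ∂μ) + ∫ x, k x ^ 2 ∂μ := by
    intro i
    have i1 := (hh i).integrable_sq
    have i2 : Integrable (fun x => h i x * k x) μ := (hh i).integrable_mul hk
    have e1 := integral_sub i1 (i2.const_mul 2)
    have e2 := integral_add (i1.sub (i2.const_mul 2)) hk.integrable_sq
    simp only [Pi.sub_apply] at e2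
    rw [← integral_const_mul, ← e1, ← e2]
    refine integral_nonneg fun x => ?_
    have : h i x ^ 2 - 2 * (h i x * k x) + k x ^ 2 = (h i x - k x) ^ 2 := by ring
    simp only [this]
    exact sq_nonneg _
  have h1 := ge_of_tendsto ((hl.sub (hlim.const_mul 2)).add_const (∫ x, k x ^ 2 ∂μ))
    (Eventually.of_forall hpos)
  simp_rw [← sq] at h1
  linarith

end WeakLimit

variable {a b : ℝ}

/-- A weakly convergent factor times a uniformly convergent factor. -/
lemma tendsto_setIntegral_mul {U : Ultrafilter ℕ} {h : ℕ → ℝ × unitInterval → ℝ}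
    {k : ℝ × unitInterval → ℝ} (hh : ∀ i, MemLp (h i) 2 (volume.restrict (strip a b))) {C : ℝ}
    (hC : ∀ i, ∫ p in strip a b, h i p ^ 2 ≤ C)
    (hweak : ∀ ψ, MemLp ψ 2 (volume.restrict (strip a b)) →
      Tendsto (fun i => ∫ p in strip a b, h i p * ψ p) U (𝓝 (∫ p in strip a b, k p * ψ p)))
    {q : ℕ → ℝ × unitInterval → ℝ} {q' : ℝ × unitInterval → ℝ}
    (hq : ∀ i, MemLp (q i) 2 (volume.restrict (strip a b)))
    (hq' : MemLp q' 2 (volume.restrict (strip a b)))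
    (hunif : ∀ ε > 0, ∀ᶠ i in (U : Filter ℕ), ∀ p ∈ strip a b, |q i p - q' p| ≤ ε)
    {A : Set (ℝ × unitInterval)} (hA : MeasurableSet A) (hAs : A ⊆ strip a b) :
    Tendsto (fun i => ∫ p in A, h i p * q i p) U (𝓝 (∫ p in A, k p * q' p)) := by
  have hind : ∀ z : ℝ × unitInterval → ℝ, ∫ p in strip a b, z p * A.indicator q' p
      = ∫ p in A, z p * q' p := by
    intro z
    have e : (fun p => z p * A.indicator q' p) = A.indicator fun p => z p * q' p := by
      funext p
      by_cases hp : p ∈ A <;> simp [hp]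
    rw [e, setIntegral_indicator hA, inter_eq_self_of_subset_right hAs]
  -- Split `q i = q' + (q i - q')`: weak convergence for the first part, smallness for the second.
  have h1 := hweak _ (hq'.indicator hA)
  simp_rw [hind] at h1
  have h2 : Tendsto (fun i => ∫ p in A, h i p * (q i p - q' p)) U (𝓝 0) := by
    set V := √(∫ p in strip a b, (1 : ℝ) ^ 2) with hV
    rw [Metric.tendsto_nhds]
    intro ε hε
    set D := √C * V + 1 with hD
    have hD0 : 0 < D := by positivity
    filter_upwards [hunif (ε / (2 * D)) (by positivity)] with i hi
    have hone : MemLp (fun _ : ℝ × unitInterval => (1 : ℝ)) 2 (volume.restrict (strip a b)) :=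
      memLp_const 1
    have habs : MemLp (fun p => |h i p|) 2 (volume.restrict (strip a b)) := (hh i).abs
    have e1 := abs_integral_mul_le habs hone
    simp only [mul_one, sq_abs] at e1
    have e2 : √(∫ p in strip a b, h i p ^ 2) ≤ √C := Real.sqrt_le_sqrt (hC i)
    have e3 : ∫ p in strip a b, |h i p| ≤ √C * V :=
      (le_abs_self _).trans (e1.trans (mul_le_mul_of_nonneg_right e2 (Real.sqrt_nonneg _)))
    have hi1 : IntegrableOn (fun p => |h i p|) (strip a b) :=
      (MemLp.integrableOn_strip (hh i)).abs
    rw [Real.dist_eq, sub_zero]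
    calc |∫ p in A, h i p * (q i p - q' p)|
        ≤ ∫ p in A, |h i p * (q i p - q' p)| := abs_integral_le_integral_abs
      _ ≤ ∫ p in A, ε / (2 * D) * |h i p| := by
          refine setIntegral_mono_on ?_ ((hi1.mono_set hAs).const_mul _) hA fun p hp => ?_
          · exact IntegrableOn.mono_set ((hh i).integrable_mul ((hq i).sub hq')).abs hAs
          · rw [abs_mul, mul_comm]
            exact mul_le_mul_of_nonneg_right (hi p (hAs hp)) (abs_nonneg _)
      _ = ε / (2 * D) * ∫ p in A, |h i p| := integral_const_mul _ _
      _ ≤ ε / (2 * D) * ∫ p in strip a b, |h i p| := by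
          refine mul_le_mul_of_nonneg_left (setIntegral_mono_set hi1
            (Eventually.of_forall fun _ => abs_nonneg _) (Eventually.of_forall hAs)) (by positivity)
      _ ≤ ε / (2 * D) * D := mul_le_mul_of_nonneg_left (by linarith) (by positivity)
      _ = ε / 2 := by field_simp
      _ < ε := by linarith
  have h3 := h1.add h2
  rw [add_zero] at h3
  refine h3.congr fun i => ?_
  have i1 : IntegrableOn (fun p => h i p * q' p) A :=
    IntegrableOn.mono_set ((hh i).integrable_mul hq') hAs
  have i2 : IntegrableOn (fun p => h i p * (q i p - q' p)) A :=
    IntegrableOn.mono_set ((hh i).integrable_mul ((hq i).sub hq')) hAs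
  rw [← integral_add i1 i2]
  exact integral_congr_ae (Eventually.of_forall fun p => by ring)

/-- The Arzelà–Ascoli theorem along an ultrafilter, for paths in a compact set of continuous
functions with a modulus of continuity in `L²` up to a vanishing error. -/
theorem exists_uniform_limit {U : Ultrafilter ℕ} {S : Set C(unitInterval, ℝ)} (hS : IsCompact S)
    {v : ℕ → ℝ → C(unitInterval, ℝ)} (hv : ∀ i, ∀ t ∈ Icc a b, v i t ∈ S) {κ : ℝ → ℝ}
    (hκ : Continuous κ) (hκ0 : κ 0 = 0) {e : ℕ → ℝ} (he : Tendsto e U (𝓝 0))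
    (hmod : ∀ i, ∀ s ∈ Icc a b, ∀ t ∈ Icc a b, s ≤ t →
      ‖toL2 (v i t - v i s)‖ ^ 2 ≤ κ (t - s) + e i) :
    ∃ w : ℝ → C(unitInterval, ℝ), ContinuousOn w (Icc a b) ∧ (∀ t ∈ Icc a b, w t ∈ S) ∧
      ∀ ε > 0, ∀ᶠ i in (U : Filter ℕ), ∀ t ∈ Icc a b, ‖v i t - w t‖ < ε := by
  have hmod' : ∀ i, ∀ s ∈ Icc a b, ∀ t ∈ Icc a b,
      ‖toL2 (v i t - v i s)‖ ^ 2 ≤ κ |t - s| + e i := by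
    intro i s hs t ht
    rcases le_total s t with hst | hst
    · rw [abs_of_nonneg (sub_nonneg.2 hst)]
      exact hmod i s hs t ht hst
    · rw [abs_sub_comm, abs_of_nonneg (sub_nonneg.2 hst), ← norm_neg, ← map_neg, neg_sub]
      exact hmod i t ht s hs hst
  -- The pointwise limits exist by compactness of `S`, on which closeness in `L²` implies closeness.
  have hex : ∀ t, ∃ w, t ∈ Icc a b → w ∈ S ∧ Tendsto (fun i => v i t) U (𝓝 w) := by
    intro t
    by_cases ht : t ∈ Icc a b
    · obtain ⟨w, hw, hl⟩ := hS.ultrafilter_le_nhds' (U.map fun i => v i t)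
        (Ultrafilter.mem_map.2 (Eventually.of_forall fun i => hv i t ht))
      exact ⟨w, fun _ => ⟨hw, hl⟩⟩
    · exact ⟨0, fun h => absurd h ht⟩
  choose w hw using hex
  have hwmod : ∀ s ∈ Icc a b, ∀ t ∈ Icc a b, ‖toL2 (w t - w s)‖ ^ 2 ≤ κ |t - s| := by
    intro s hs t ht
    have h1 : Tendsto (fun i => ‖toL2 (v i t - v i s)‖ ^ 2) U (𝓝 (‖toL2 (w t - w s)‖ ^ 2)) :=
      ((toL2.continuous.tendsto _).comp ((hw t ht).2.sub (hw s hs).2)).norm.pow 2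
    have h2 := he.const_add (κ |t - s|)
    rw [add_zero] at h2
    exact le_of_tendsto_of_tendsto' h1 h2 fun i => hmod' i s hs t ht
  have hsmall : ∀ δ > 0, ∃ ρ > 0, ∀ s t : ℝ, dist t s < ρ → κ |t - s| < δ := by
    intro δ hδ
    obtain ⟨ρ, hρ, h⟩ := Metric.continuousAt_iff.1 hκ.continuousAt δ hδ
    refine ⟨ρ, hρ, fun s t hst => ?_⟩
    have := h (x := |t - s|) (by rwa [Real.dist_eq, sub_zero, abs_abs, ← Real.dist_eq])
    rw [hκ0, Real.dist_eq, sub_zero] at this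
    exact (le_abs_self _).trans_lt this
  refine ⟨w, ?_, fun t ht => (hw t ht).1, ?_⟩
  · rw [Metric.continuousOn_iff]
    intro s hs ε hε
    obtain ⟨δ, hδ, hS'⟩ := exists_norm_lt_of_toL2 hS hε
    obtain ⟨ρ, hρ, h⟩ := hsmall (δ ^ 2) (by positivity)
    refine ⟨ρ, hρ, fun t ht hts => ?_⟩
    rw [dist_eq_norm]
    exact hS' _ (hw t ht).1 _ (hw s hs).1
      (lt_of_pow_lt_pow_left₀ 2 hδ.le ((hwmod s hs t ht).trans_lt (h s t hts)))
  · intro ε hε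
    obtain ⟨δ, hδ, hS'⟩ := exists_norm_lt_of_toL2 hS hε
    obtain ⟨ρ, hρ, h⟩ := hsmall ((δ / 3) ^ 2 / 2) (by positivity)
    -- Convergence at the points of a finite net is uniform convergence.
    obtain ⟨N, hNsub, hNfin, hcov⟩ := (isCompact_Icc (a := a) (b := b)).finite_cover_balls hρ
    have hev : ∀ᶠ i in (U : Filter ℕ), ∀ s ∈ N, ‖toL2 (v i s - w s)‖ < δ / 3 := by
      refine (eventually_all_finite hNfin).2 fun s hs => ?_
      have h1 := ((toL2.continuous.tendsto _).comp
        ((hw s (hNsub hs)).2.sub_const (w s))).norm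
      rw [sub_self, map_zero, norm_zero] at h1
      exact h1.eventually_lt_const (by positivity)
    filter_upwards [hev, he.eventually_lt_const (show 0 < (δ / 3) ^ 2 / 2 by positivity)]
      with i hi hei t ht
    obtain ⟨s, hs, hts⟩ := mem_iUnion₂.1 (hcov ht)
    have hsm := hNsub hs
    refine hS' _ (hv i t ht) _ (hw t ht).1 ?_
    have e1 : ‖toL2 (v i t - v i s)‖ < δ / 3 := lt_of_pow_lt_pow_left₀ 2 (by positivity)
      (by linarith [hmod' i s hsm t ht, h s t hts])
    have e2 : ‖toL2 (w s - w t)‖ < δ / 3 := lt_of_pow_lt_pow_left₀ 2 (by positivity) (by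
      have := h t s (by rw [dist_comm]; exact hts)
      have h4 : 0 < (δ / 3) ^ 2 := by positivity
      linarith [hwmod t ht s hsm])
    have e3 : toL2 (v i t - w t)
        = toL2 (v i t - v i s) + toL2 (v i s - w s) + toL2 (w s - w t) := by
      rw [← map_add, ← map_add]; congr 1; abel
    rw [e3]
    have := norm_add₃_le (a := toL2 (v i t - v i s)) (b := toL2 (v i s - w s))
      (c := toL2 (w s - w t))
    linarith [hi s hs]

variable {K₁ K₂ : C(unitInterval, ℝ)}

/-- Uniform limits of approximate solutions of the variational inequality are solutions. -/
theorem isEVI_of_tendsto {U : Ultrafilter ℕ} {v : ℕ → ℝ → C(unitInterval, ℝ)}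
    {g : ℕ → ℝ × unitInterval → ℝ} {w : ℝ → C(unitInterval, ℝ)} {k : ℝ × unitInterval → ℝ}
    (hw : ContinuousOn w (Icc a b)) (hwall : ∀ t ∈ Icc a b, w t ∈ wallSpace K₁ K₂)
    (hk : MemLp k 2 (volume.restrict (strip a b)))
    (hconv : ∀ ε > 0, ∀ᶠ i in (U : Filter ℕ), ∀ t ∈ Icc a b, ‖v i t - w t‖ < ε)
    (hint : ∀ i K, IntervalIntegrable (fun r => partialEnergy K (v i r)) volume a b)
    (hforce : ∀ x : C(unitInterval, ℝ), ∀ s t, a ≤ s → s ≤ t → t ≤ b →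
      Tendsto (fun i => ∫ p in slab s t, g i p * (v i p.1 p.2 - x p.2)) U
        (𝓝 (∫ p in slab s t, k p * (w p.1 p.2 - x p.2))))
    (hevi : ∀ x ∈ wallSpace K₁ K₂, ∀ E, EnergyLE x E → ∀ s t, a ≤ s → s ≤ t → t ≤ b → ∀ K,
      ∃ e : ℕ → ℝ, Tendsto e U (𝓝 0) ∧ ∀ i,
        ‖toL2 (v i t - x)‖ ^ 2 / 2 - ‖toL2 (v i s - x)‖ ^ 2 / 2
          + ∫ r in s..t, partialEnergy K (v i r)
          ≤ (t - s) * E + (∫ p in slab s t, g i p * (v i p.1 p.2 - x p.2)) + e i) :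
    IsEVI K₁ K₂ a b w k := by
  refine ⟨hw, hwall, hk, fun x hx E hE s t has hst htb K => ?_⟩
  obtain ⟨e, he, hle⟩ := hevi x hx E hE s t has hst htb K
  have hpt : ∀ r ∈ Icc a b, Tendsto (fun i => ‖toL2 (v i r - x)‖ ^ 2 / 2) U
      (𝓝 (‖toL2 (w r - x)‖ ^ 2 / 2)) := by
    intro r hr
    have : Tendsto (fun i => v i r) U (𝓝 (w r)) := by
      rw [Metric.tendsto_nhds]
      intro ε hε
      filter_upwards [hconv ε hε] with i hi
      rw [dist_eq_norm]; exact hi r hr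
    exact (((toL2.continuous.tendsto _).comp (this.sub_const x)).norm.pow 2).div_const 2
  have hsubI : uIcc s t ⊆ Icc a b := by rw [uIcc_of_le hst]; exact Icc_subset_Icc has htb
  have hen : Tendsto (fun i => ∫ r in s..t, partialEnergy K (v i r)) U
      (𝓝 (∫ r in s..t, partialEnergy K (w r))) := by
    rw [Metric.tendsto_nhds]
    intro ε hε
    set c := ε / (2 * (t - s + 1)) with hc
    have hts : 0 ≤ t - s := by linarith
    have hc0 : 0 < c := by positivity
    have huc := ((isCompact_Icc (a := a) (b := b)).image_of_continuousOn
      hw).uniformContinuousAt_of_continuousAt (partialEnergy K)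
        (fun u _ => (continuous_partialEnergy K).continuousAt) (Metric.dist_mem_uniformity hc0)
    obtain ⟨δ, hδ, hδ'⟩ := Metric.mem_uniformity_dist.1 huc
    filter_upwards [hconv δ hδ] with i hi
    have i1 : IntervalIntegrable (fun r => partialEnergy K (v i r)) volume s t :=
      (hint i K).mono_set (by rw [uIcc_of_le (has.trans (hst.trans htb))]; exact hsubI)
    have i2 : IntervalIntegrable (fun r => partialEnergy K (w r)) volume s t :=
      (((continuous_partialEnergy K).comp_continuousOn hw).mono hsubI).intervalIntegrable
    rw [dist_eq_norm, ← intervalIntegral.integral_sub i1 i2]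
    have hb := intervalIntegral.norm_integral_le_of_norm_le_const (a := s) (b := t) (C := c)
      (f := fun r => partialEnergy K (v i r) - partialEnergy K (w r)) fun r hr => by
        have hr' : r ∈ Icc a b := hsubI (uIoc_subset_uIcc hr)
        have := hδ' (a := w r) (b := v i r) (by
          rw [dist_comm, dist_eq_norm]; exact hi r hr') (mem_image_of_mem w hr')
        rw [← dist_eq_norm, dist_comm]
        exact le_of_lt this
    refine hb.trans_lt ?_
    rw [abs_of_nonneg hts, hc, div_mul_eq_mul_div, div_lt_iff₀ (by positivity)]
    nlinarith
  have hs : s ∈ Icc a b := ⟨has, hst.trans htb⟩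
  have ht : t ∈ Icc a b := ⟨has.trans hst, htb⟩
  have hR := ((hforce x s t has hst htb).const_add ((t - s) * E)).add he
  rw [add_zero] at hR
  exact le_of_tendsto_of_tendsto' (((hpt t ht).sub (hpt s hs)).add hen) hR hle

/-! ### The implicit Euler scheme -/

variable {K₁ K₂ : C(unitInterval, ℝ)}

lemma wallSpace_convex {u x : C(unitInterval, ℝ)} (hu : u ∈ wallSpace K₁ K₂)
    (hx : x ∈ wallSpace K₁ K₂) {θ : ℝ} (h0 : 0 ≤ θ) (h1 : θ ≤ 1) :
    u + θ • (x - u) ∈ wallSpace K₁ K₂ := by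
  intro y
  simp only [ContinuousMap.add_apply, ContinuousMap.smul_apply, ContinuousMap.sub_apply,
    smul_eq_mul]
  have h2 := hu y
  have h3 := hx y
  constructor <;> nlinarith

/-- The resolvent of the subdifferential: the regularized energy has a minimizer between the
walls. -/
lemma exists_resolvent (h0 : (0 : C(unitInterval, ℝ)) ∈ wallSpace K₁ K₂) {c : ℝ} (hc : 0 ≤ c)
    (l : Lp ℝ 2 (volume : Measure unitInterval)) :
    ∃ u ∈ wallSpace K₁ K₂, IsSubgradient K₁ K₂ u (l - c • toL2 u) := by
  set M := ‖l‖ * wallBound K₁ K₂ with hM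
  have hM0 : 0 ≤ M := mul_nonneg (norm_nonneg _) (wallBound_nonneg _ _)
  -- The minimum is sought over the pairs of a function and a bound for its energy, a compact set on
  -- which the functional is continuous, although the energy is only lower semicontinuous.
  set S : Set (C(unitInterval, ℝ) × ℝ) :=
    ({u | u ∈ wallSpace K₁ K₂ ∧ EnergyLE u M} ×ˢ Icc 0 M) ∩ {p | EnergyLE p.1 p.2} with hS
  have hclosed : IsClosed {p : C(unitInterval, ℝ) × ℝ | EnergyLE p.1 p.2} := by
    simp only [EnergyLE, ofPred_forall]
    exact isClosed_iInter fun k => isClosed_le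
      ((continuous_partialEnergy k).comp continuous_fst) continuous_snd
  have hScomp : IsCompact S :=
    ((isCompact_energyLE M).prod isCompact_Icc).inter_right hclosed
  set F : C(unitInterval, ℝ) × ℝ → ℝ :=
    fun p => p.2 + c / 2 * ‖toL2 p.1‖ ^ 2 - inner ℝ l (toL2 p.1) with hF
  have hFc : Continuous F := by
    have h1 : Continuous fun p : C(unitInterval, ℝ) × ℝ => toL2 p.1 :=
      toL2.continuous.comp continuous_fst
    exact (continuous_snd.add ((h1.norm.pow 2).const_mul _)).sub (continuous_const.inner h1)
  have h0S : ((0 : C(unitInterval, ℝ)), (0 : ℝ)) ∈ S :=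
    ⟨⟨⟨h0, energyLE_zero.mono hM0⟩, le_rfl, hM0⟩, energyLE_zero⟩
  obtain ⟨⟨u, Eu⟩, huS, humin⟩ := hScomp.exists_isMinOn ⟨_, h0S⟩ hFc.continuousOn
  have hu : u ∈ wallSpace K₁ K₂ := huS.1.1.1
  have hEu : EnergyLE u Eu := huS.2
  have hmin : ∀ x ∈ wallSpace K₁ K₂, ∀ E, EnergyLE x E → F (u, Eu) ≤ F (x, E) := by
    intro x hx E hE
    by_cases hEM : E ≤ M
    · exact humin ⟨⟨⟨hx, hE.mono hEM⟩, hE.nonneg, hEM⟩, hE⟩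
    · have h1 : F (u, Eu) ≤ F (0, 0) := humin h0S
      refine h1.trans ?_
      have h2 : inner ℝ l (toL2 x) ≤ M := (real_inner_le_norm _ _).trans
        (mul_le_mul_of_nonneg_left ((norm_toL2_le x).trans (norm_le_wallBound hx))
          (norm_nonneg _))
      have h3 : 0 ≤ c / 2 * ‖toL2 x‖ ^ 2 := by positivity
      simp only [hF, map_zero, norm_zero, inner_zero_right]
      push Not at hEM
      linarith
  refine ⟨u, hu, fun x hx E hE => hEu.mono ?_⟩
  set y := toL2 (u - x) with hy
  suffices hsuff : ∀ θ ∈ Ioc (0 : ℝ) 1,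
      Eu ≤ E + inner ℝ (l - c • toL2 u) y + θ * (c / 2 * ‖y‖ ^ 2) by
    have hlim : Tendsto (fun θ : ℝ => E + inner ℝ (l - c • toL2 u) y + θ * (c / 2 * ‖y‖ ^ 2))
        (𝓝[>] 0) (𝓝 (E + inner ℝ (l - c • toL2 u) y + 0 * (c / 2 * ‖y‖ ^ 2))) :=
      (Continuous.tendsto (by fun_prop) 0).mono_left nhdsWithin_le_nhds
    rw [zero_mul, add_zero] at hlim
    refine ge_of_tendsto hlim ?_
    filter_upwards [Ioc_mem_nhdsGT one_pos] with θ hθ using hsuff θ hθ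
  -- Compare with a convex combination, divide by `θ` and let `θ → 0`.
  intro θ hθ
  have h1 := hmin _ (wallSpace_convex hu hx hθ.1.le hθ.2) _ (hEu.convex hE hθ.1.le hθ.2)
  have e : toL2 (u + θ • (x - u)) = toL2 u - θ • y := by
    rw [hy, map_add, map_smul, ← neg_sub u x, map_neg, smul_neg]
    exact (sub_eq_add_neg _ _).symm
  simp only [hF, e] at h1
  rw [norm_sub_sq_real, inner_sub_right, inner_smul_right, inner_smul_right, norm_smul,
    mul_pow, Real.norm_eq_abs, sq_abs] at h1
  rw [inner_sub_left, inner_smul_left, RCLike.conj_to_real]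
  have h2 : θ * Eu ≤ θ * (E + (inner ℝ l y - c * inner ℝ (toL2 u) y) + θ * (c / 2 * ‖y‖ ^ 2)) := by
    nlinarith
  exact le_of_mul_le_mul_left h2 hθ.1

lemma IsSubgradient.energyLE {u : C(unitInterval, ℝ)}
    {ζ : Lp ℝ 2 (volume : Measure unitInterval)} (h : IsSubgradient K₁ K₂ u ζ)
    (h0 : (0 : C(unitInterval, ℝ)) ∈ wallSpace K₁ K₂) : EnergyLE u (energy u) :=
  (h 0 h0 0 energyLE_zero).energyLE_energy

/-- The subdifferential is monotone. -/
lemma IsSubgradient.monotone {u w : C(unitInterval, ℝ)}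
    {ζ χ : Lp ℝ 2 (volume : Measure unitInterval)} (hu : IsSubgradient K₁ K₂ u ζ)
    (hw : IsSubgradient K₁ K₂ w χ) (h0 : (0 : C(unitInterval, ℝ)) ∈ wallSpace K₁ K₂)
    (hu' : u ∈ wallSpace K₁ K₂) (hw' : w ∈ wallSpace K₁ K₂) :
    0 ≤ inner ℝ (ζ - χ) (toL2 (u - w)) := by
  have h1 := (hu w hw' _ (hw.energyLE h0)).energy_le
  have h2 := (hw u hu' _ (hu.energyLE h0)).energy_le
  have h3 : toL2 (w - u) = -toL2 (u - w) := by rw [← map_neg, neg_sub]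
  rw [h3, inner_neg_right] at h2
  rw [inner_sub_left]
  linarith

/-- The implicit Euler scheme with step `τ` for the gradient flow of the energy, started at `A`,
with forcing `ζ + c j (B - u)` in the `j`-th step. -/
structure IsEuler (K₁ K₂ A B : C(unitInterval, ℝ)) (ζ : Lp ℝ 2 (volume : Measure unitInterval))
    (τ : ℝ) (c : ℕ → ℝ) (u : ℕ → C(unitInterval, ℝ)) : Prop where
  zero : u 0 = A
  mem_wallSpace : ∀ j, u j ∈ wallSpace K₁ K₂
  isSubgradient : ∀ j, IsSubgradient K₁ K₂ (u (j + 1))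
    (ζ + c j • toL2 (B - u (j + 1)) - τ⁻¹ • toL2 (u (j + 1) - u j))

variable {A B : C(unitInterval, ℝ)} {ζ : Lp ℝ 2 (volume : Measure unitInterval)} {τ : ℝ}
  {c : ℕ → ℝ} {u : ℕ → C(unitInterval, ℝ)}

lemma exists_isEuler (h0 : (0 : C(unitInterval, ℝ)) ∈ wallSpace K₁ K₂)
    (hA : A ∈ wallSpace K₁ K₂) (ζ : Lp ℝ 2 (volume : Measure unitInterval)) (hτ : 0 < τ)
    (hc : ∀ j, 0 ≤ c j) : ∃ u, IsEuler K₁ K₂ A B ζ τ c u := by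
  choose R hR using fun (j : ℕ) (w : C(unitInterval, ℝ)) =>
    exists_resolvent (K₁ := K₁) (K₂ := K₂) h0 (c := c j + τ⁻¹)
      (add_nonneg (hc j) (inv_nonneg.2 hτ.le)) (ζ + c j • toL2 B + τ⁻¹ • toL2 w)
  refine ⟨fun j => Nat.rec A (fun j w => R j w) j, rfl, fun j => ?_, fun j => ?_⟩
  · cases j with
    | zero => exact hA
    | succ j => exact (hR _ _).1
  · have h := (hR j (Nat.rec A (fun j w => R j w) j)).2
    convert h using 1
    simp only [map_sub, smul_sub, add_smul]
    abel

namespace IsEuler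

/-- The feedback contracts the distance to the target. -/
lemma norm_sub_le (h : IsEuler K₁ K₂ A B ζ τ c u)
    (h0 : (0 : C(unitInterval, ℝ)) ∈ wallSpace K₁ K₂)
    (hτ : 0 < τ) (hB : B ∈ wallSpace K₁ K₂) (hζ : IsSubgradient K₁ K₂ B ζ)
    (j : ℕ) : (1 + τ * c j) * ‖toL2 (u (j + 1) - B)‖ ≤ ‖toL2 (u j - B)‖ := by
  have h1 := (h.isSubgradient j).monotone hζ h0 (h.mem_wallSpace _) hB
  set y := toL2 (u (j + 1) - B) with hy
  have e1 : toL2 (B - u (j + 1)) = -y := by rw [hy, ← map_neg, neg_sub]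
  have e2 : toL2 (u (j + 1) - u j) = y - toL2 (u j - B) := by
    rw [hy, ← map_sub]; congr 1; abel
  have e3 : ζ + c j • toL2 (B - u (j + 1)) - τ⁻¹ • toL2 (u (j + 1) - u j) - ζ
      = τ⁻¹ • toL2 (u j - B) - (c j + τ⁻¹) • y := by
    rw [e1, e2, smul_sub, smul_neg, add_smul]; abel
  rw [e3, inner_sub_left, inner_smul_left, inner_smul_left, RCLike.conj_to_real,
    RCLike.conj_to_real, real_inner_self_eq_norm_sq] at h1
  have h2 := real_inner_le_norm (toL2 (u j - B)) y
  have h3 : (c j + τ⁻¹) * ‖y‖ ^ 2 ≤ τ⁻¹ * (‖toL2 (u j - B)‖ * ‖y‖) := by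
    have := mul_le_mul_of_nonneg_left h2 (inv_pos.2 hτ).le
    linarith
  have h4 : τ * ((c j + τ⁻¹) * ‖y‖ ^ 2) ≤ τ * (τ⁻¹ * (‖toL2 (u j - B)‖ * ‖y‖)) :=
    mul_le_mul_of_nonneg_left h3 hτ.le
  rw [mul_inv_cancel_left₀ hτ.ne'] at h4
  have h5 : τ * ((c j + τ⁻¹) * ‖y‖ ^ 2) = (1 + τ * c j) * ‖y‖ * ‖y‖ := by
    field_simp; ring
  rw [h5] at h4
  rcases (norm_nonneg y).eq_or_lt with hy0 | hy0
  · rw [← hy0, mul_zero]; exact norm_nonneg _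
  · exact le_of_mul_le_mul_right h4 hy0

/-- One step of the scheme: the discrete energy estimate. -/
lemma energyLE_succ (h : IsEuler K₁ K₂ A B ζ τ c u) (hτ : 0 < τ)
    {Γ : ℝ} {j : ℕ} (hΓ : ‖ζ + c j • toL2 (B - u (j + 1))‖ ≤ Γ)
    {E : ℝ} (hE : EnergyLE (u j) E) :
    EnergyLE (u (j + 1)) (E + τ * Γ ^ 2 / 2 - ‖toL2 (u (j + 1) - u j)‖ ^ 2 / (2 * τ)) := by
  refine (h.isSubgradient j (u j) (h.mem_wallSpace j) E hE).mono ?_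
  rw [inner_sub_left, inner_smul_left, RCLike.conj_to_real, real_inner_self_eq_norm_sq]
  set y := toL2 (u (j + 1) - u j)
  set G := ζ + c j • toL2 (B - u (j + 1))
  have h1 : inner ℝ G y ≤ Γ * ‖y‖ := (real_inner_le_norm _ _).trans
    (mul_le_mul_of_nonneg_right hΓ (norm_nonneg _))
  have h2 : Γ * ‖y‖ ≤ τ * Γ ^ 2 / 2 + ‖y‖ ^ 2 / (2 * τ) := by
    have : τ * Γ ^ 2 / 2 + ‖y‖ ^ 2 / (2 * τ) - Γ * ‖y‖ = (τ * Γ - ‖y‖) ^ 2 / (2 * τ) := by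
      field_simp; ring
    have h3 : 0 ≤ (τ * Γ - ‖y‖) ^ 2 / (2 * τ) := by positivity
    linarith
  have h3 : τ⁻¹ * ‖y‖ ^ 2 = ‖y‖ ^ 2 / (2 * τ) + ‖y‖ ^ 2 / (2 * τ) := by field_simp; ring
  linarith

lemma energyLE (h : IsEuler K₁ K₂ A B ζ τ c u) (hτ : 0 < τ)
    {Γ E : ℝ} (hΓ : ∀ j, ‖ζ + c j • toL2 (B - u (j + 1))‖ ≤ Γ)
    (hE : EnergyLE A E) (j : ℕ) : EnergyLE (u j) (E + j * (τ * Γ ^ 2 / 2)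
      - (∑ i ∈ Finset.range j, ‖toL2 (u (i + 1) - u i)‖ ^ 2) / (2 * τ)) := by
  induction j with
  | zero => rw [h.zero]; simpa using hE
  | succ j ih =>
    refine (h.energyLE_succ hτ (hΓ j) ih).mono (le_of_eq ?_)
    rw [Finset.sum_range_succ, add_div]
    push_cast
    ring

/-- The discrete Hölder estimate. -/
lemma norm_sub_sq_le (h : IsEuler K₁ K₂ A B ζ τ c u) (hτ : 0 < τ)
    {Γ E : ℝ} (hΓ : ∀ j, ‖ζ + c j • toL2 (B - u (j + 1))‖ ≤ Γ)
    (hE : EnergyLE A E) {i j : ℕ} (hij : i ≤ j) {M : ℝ} (hM : E + j * (τ * Γ ^ 2 / 2) ≤ M) :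
    ‖toL2 (u j - u i)‖ ^ 2 ≤ 2 * M * ((j - i) * τ) := by
  have h1 := (h.energyLE hτ hΓ hE j).nonneg
  have h2 : ∑ k ∈ Finset.range j, ‖toL2 (u (k + 1) - u k)‖ ^ 2 ≤ 2 * τ * M := by
    have : (∑ k ∈ Finset.range j, ‖toL2 (u (k + 1) - u k)‖ ^ 2) / (2 * τ) ≤ M := by linarith
    rwa [div_le_iff₀ (by positivity), mul_comm] at this
  have h3 := dist_le_Ico_sum_dist (fun k => toL2 (u k)) hij
  have h4 : ∀ k l, dist (toL2 (u k)) (toL2 (u l)) = ‖toL2 (u l - u k)‖ := fun k l => by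
    rw [dist_comm, dist_eq_norm, ← map_sub]
  simp_rw [h4] at h3
  calc ‖toL2 (u j - u i)‖ ^ 2 ≤ (∑ k ∈ Finset.Ico i j, ‖toL2 (u (k + 1) - u k)‖) ^ 2 :=
        pow_le_pow_left₀ (norm_nonneg _) h3 2
    _ ≤ (Finset.Ico i j).card * ∑ k ∈ Finset.Ico i j, ‖toL2 (u (k + 1) - u k)‖ ^ 2 :=
        sq_sum_le_card_mul_sum_sq
    _ ≤ (Finset.Ico i j).card * (2 * τ * M) := by
        refine mul_le_mul_of_nonneg_left (le_trans ?_ h2) (Nat.cast_nonneg _)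
        exact Finset.sum_le_sum_of_subset_of_nonneg
          (fun k hk => Finset.mem_range.2 (Finset.mem_Ico.1 hk).2) fun _ _ _ => sq_nonneg _
    _ = 2 * M * ((j - i) * τ) := by
        rw [Nat.card_Ico, Nat.cast_sub hij]; ring

/-- The discrete variational inequality. -/
lemma evi (h : IsEuler K₁ K₂ A B ζ τ c u) (hτ : 0 < τ)
    (j : ℕ) {x : C(unitInterval, ℝ)} (hx : x ∈ wallSpace K₁ K₂) {E : ℝ}
    (hE : EnergyLE x E) (K : ℕ) :
    ‖toL2 (u (j + 1) - x)‖ ^ 2 / 2 - ‖toL2 (u j - x)‖ ^ 2 / 2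
      ≤ -(τ * (partialEnergy K (u (j + 1)) - E
        - inner ℝ (ζ + c j • toL2 (B - u (j + 1))) (toL2 (u (j + 1) - x)))) := by
  have h1 := h.isSubgradient j x hx E hE K
  rw [inner_sub_left, inner_smul_left, RCLike.conj_to_real] at h1
  set y := toL2 (u (j + 1) - x)
  have e : toL2 (u j - x) = y - toL2 (u (j + 1) - u j) := by
    rw [← map_sub]; congr 1; abel
  rw [e, norm_sub_sq_real, real_inner_comm]
  have h2 := mul_le_mul_of_nonneg_left h1 hτ.le
  rw [mul_add, mul_sub, mul_inv_cancel_left₀ hτ.ne'] at h2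
  have h3 := sq_nonneg ‖toL2 (u (j + 1) - u j)‖
  linarith

end IsEuler

/-! ### Piecewise constant interpolation -/

/-- The index of the step of length `τ` that contains the time `r`. -/
def stepIndex (τ r : ℝ) : ℕ := ⌈r / τ⌉₊

variable {τ : ℝ}

lemma measurable_stepIndex (τ : ℝ) : Measurable (stepIndex τ) :=
  Nat.measurable_ceil.comp (measurable_id.div_const τ)

lemma stepIndex_zero (τ : ℝ) : stepIndex τ 0 = 0 := by simp [stepIndex]

lemma stepIndex_mono (hτ : 0 < τ) : Monotone (stepIndex τ) := fun _ _ h =>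
  Nat.ceil_mono (div_le_div_of_nonneg_right h hτ.le)

lemma stepIndex_mul (hτ : 0 < τ) (n : ℕ) : stepIndex τ (n * τ) = n := by
  rw [stepIndex, mul_div_cancel_right₀ _ hτ.ne', Nat.ceil_natCast]

lemma le_stepIndex_mul (hτ : 0 < τ) (r : ℝ) : r ≤ stepIndex τ r * τ := by
  rw [← div_le_iff₀ hτ]; exact Nat.le_ceil _

lemma stepIndex_mul_lt (hτ : 0 < τ) {r : ℝ} (hr : 0 ≤ r) : stepIndex τ r * τ < r + τ := by
  have := Nat.ceil_lt_add_one (div_nonneg hr hτ.le)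
  rw [stepIndex]
  calc (⌈r / τ⌉₊ : ℝ) * τ < (r / τ + 1) * τ := mul_lt_mul_of_pos_right this hτ
    _ = r + τ := by field_simp

lemma stepIndex_eq (hτ : 0 < τ) {k : ℕ} {r : ℝ} (hr : r ∈ Ioc (k * τ) ((k + 1) * τ)) :
    stepIndex τ r = k + 1 := by
  rw [stepIndex, Nat.ceil_eq_iff (Nat.succ_ne_zero k)]
  rw [lt_div_iff₀ hτ, div_le_iff₀ hτ]
  simpa using hr

lemma intervalIntegrable_stepIndex (hτ : 0 < τ) (F : ℕ → ℝ) (s t : ℝ) :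
    IntervalIntegrable (fun r => F (stepIndex τ r)) volume s t := by
  have hm : Measurable fun r => F (stepIndex τ r) :=
    (measurable_of_countable F).comp (measurable_stepIndex τ)
  refine (intervalIntegrable_const (c := ∑ k ∈ Finset.range (stepIndex τ (max s t) + 1),
    |F k|)).mono_fun' hm.aestronglyMeasurable ?_
  filter_upwards [ae_restrict_mem measurableSet_uIoc] with r hr
  rw [Real.norm_eq_abs]
  exact Finset.single_le_sum (f := fun k => |F k|) (fun _ _ => abs_nonneg _)
    (Finset.mem_range.2 (Nat.lt_succ_of_le (stepIndex_mono hτ hr.2)))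

lemma integral_stepIndex (hτ : 0 < τ) (F : ℕ → ℝ) {i j : ℕ} (hij : i ≤ j) :
    ∫ r in i * τ..j * τ, F (stepIndex τ r) = τ * ∑ k ∈ Finset.Ico i j, F (k + 1) := by
  induction j, hij using Nat.le_induction with
  | base => simp
  | succ j hij ih =>
    rw [← intervalIntegral.integral_add_adjacent_intervals
      (intervalIntegrable_stepIndex hτ F _ (j * τ)) (intervalIntegrable_stepIndex hτ F _ _), ih,
      Finset.sum_Ico_succ_top hij, mul_add]
    congr 1
    have h1 : (j : ℝ) * τ ≤ ((j + 1 : ℕ) : ℝ) * τ := by push_cast; nlinarith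
    rw [intervalIntegral.integral_of_le h1, setIntegral_congr_fun measurableSet_Ioc
      (g := fun _ => F (j + 1)) fun r hr => ?_]
    · rw [setIntegral_const, Measure.real, Real.volume_Ioc, ENNReal.toReal_ofReal (by linarith)]
      push_cast
      rw [smul_eq_mul]
      ring
    · push_cast at hr
      simp only [stepIndex_eq hτ hr]

/-- A telescoping inequality between grid points, at arbitrary times. -/
lemma stepIndex_telescope (hτ : 0 < τ) {N : ℕ} {Y R : ℕ → ℝ} {C : ℝ}
    (hstep : ∀ k, Y (k + 1) - Y k ≤ -(τ * R (k + 1)))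
    (hR : ∀ k, k < N → |R (k + 1)| ≤ C) (hC : 0 ≤ C) {s t : ℝ} (hs : 0 ≤ s) (hst : s ≤ t)
    (ht : t ≤ N * τ) :
    Y (stepIndex τ t) - Y (stepIndex τ s) + ∫ r in s..t, R (stepIndex τ r) ≤ 2 * τ * C := by
  set i := stepIndex τ s with hi
  set j := stepIndex τ t with hj
  have hij : i ≤ j := stepIndex_mono hτ hst
  have htel : Y j - Y i ≤ -∫ r in i * τ..j * τ, R (stepIndex τ r) := by
    rw [integral_stepIndex hτ R hij]
    clear_value i j
    clear hi hj
    induction j, hij using Nat.le_induction with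
    | base => simp
    | succ j hij ih =>
      rw [Finset.sum_Ico_succ_top hij, mul_add]
      linarith [hstep j]
  have hint := fun x y => intervalIntegrable_stepIndex hτ R x y
  have e1 := intervalIntegral.integral_interval_sub_interval_comm (hint s t)
    (hint (i * τ) (j * τ)) (hint s (i * τ))
  have hiN : s ≤ N * τ := hst.trans ht
  -- Moving an end point to the grid costs at most one step.
  have hbd : ∀ x, 0 ≤ x → x ≤ N * τ →
      |∫ r in x..stepIndex τ x * τ, R (stepIndex τ r)| ≤ τ * C := by
    intro x hx hxN
    have hle := le_stepIndex_mul hτ x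
    have hlt := stepIndex_mul_lt hτ hx
    have hxN' : stepIndex τ x ≤ N := by
      have := stepIndex_mono hτ hxN
      rwa [stepIndex_mul hτ] at this
    have hb := intervalIntegral.norm_integral_le_of_norm_le_const (a := x)
      (b := stepIndex τ x * τ) (C := C) (f := fun r => R (stepIndex τ r)) fun r hr => by
        rw [uIoc_of_le hle] at hr
        have h1 : 0 < stepIndex τ r := Nat.ceil_pos.2 (div_pos (hx.trans_lt hr.1) hτ)
        have h2 : stepIndex τ r ≤ N := by
          have := stepIndex_mono hτ hr.2
          rw [stepIndex_mul hτ] at this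
          exact this.trans hxN'
        obtain ⟨k, hk⟩ := Nat.exists_eq_succ_of_ne_zero h1.ne'
        rw [hk] at h2 ⊢
        exact hR k h2
    rw [abs_of_nonneg (by linarith)] at hb
    rw [← Real.norm_eq_abs]
    refine hb.trans ?_
    rw [mul_comm]
    exact mul_le_mul_of_nonneg_right (by linarith) hC
  have e2 := hbd s hs hiN
  have e3 := hbd t (hs.trans hst) ht
  rw [abs_le] at e2 e3
  linarith [e2.2, e3.1]

section StepForcing

variable {G : ℕ → unitInterval → ℝ} {u : ℕ → C(unitInterval, ℝ)}

lemma measurable_step (hG : ∀ k, Measurable (G k)) :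
    Measurable fun p : ℝ × unitInterval => G (stepIndex τ p.1) p.2 := by
  have h : Measurable fun p : unitInterval × ℕ => G p.2 p.1 :=
    measurable_from_prod_countable_left hG
  exact h.comp (measurable_snd.prodMk ((measurable_stepIndex τ).comp measurable_fst))

lemma memLp_step (hτ : 0 < τ) (hG : ∀ k, Measurable (G k)) (hG2 : ∀ k, MemLp (G k) 2 volume)
    (a b : ℝ) : MemLp (fun p : ℝ × unitInterval => G (stepIndex τ p.1) p.2) 2
      (volume.restrict (strip a b)) := by
  have hμ : (volume : Measure (ℝ × unitInterval)).restrict (strip a b)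
      = ((volume : Measure ℝ).restrict (Icc a b)).prod (volume : Measure unitInterval) := by
    rw [strip, Measure.volume_eq_prod, ← Measure.prod_restrict, Measure.restrict_univ]
  have h1 : ∀ k, MemLp (fun p : ℝ × unitInterval => |G k p.2|) 2
      (volume.restrict (strip a b)) := fun k => by
    rw [hμ]; exact ((hG2 k).comp_snd _).abs
  refine (memLp_finsetSum (Finset.range (stepIndex τ b + 1)) fun k _ => h1 k).mono
    (measurable_step hG).aestronglyMeasurable ?_
  filter_upwards [ae_restrict_mem (measurableSet_strip a b)] with p hp
  rw [Real.norm_eq_abs, Real.norm_eq_abs]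
  refine le_trans ?_ (le_abs_self _)
  exact Finset.single_le_sum (f := fun k => |G k p.2|) (fun _ _ => abs_nonneg _)
    (Finset.mem_range.2 (Nat.lt_succ_of_le (stepIndex_mono hτ hp.1.2)))

lemma setIntegral_step_sq_le (hτ : 0 < τ) (hG : ∀ k, Measurable (G k))
    (hG2 : ∀ k, MemLp (G k) 2 volume) {Γ : ℝ} (hΓ : ∀ k, ∫ x, G k x ^ 2 ≤ Γ) {a b : ℝ}
    (hab : a ≤ b) : ∫ p in strip a b, G (stepIndex τ p.1) p.2 ^ 2 ≤ (b - a) * Γ := by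
  have hi : IntegrableOn (fun p : ℝ × unitInterval => G (stepIndex τ p.1) p.2 ^ 2) (strip a b) :=
    (memLp_step hτ hG hG2 a b).integrable_sq
  rw [setIntegral_strip_eq, setIntegral_slab_eq hab
    (hi.mono_set (slab_subset_strip le_rfl le_rfl))]
  have h := intervalIntegral.integral_mono_on hab
    (intervalIntegrable_stepIndex hτ (fun k => ∫ x, G k x ^ 2) a b)
    (intervalIntegrable_const (μ := volume) (c := Γ)) fun r _ => hΓ _
  rwa [intervalIntegral.integral_const, smul_eq_mul] at h

lemma setIntegral_step_mul (hτ : 0 < τ) (hG : ∀ k, Measurable (G k))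
    (hG2 : ∀ k, MemLp (G k) 2 volume) (x : C(unitInterval, ℝ)) {s t : ℝ} (hst : s ≤ t) :
    ∫ p in slab s t, G (stepIndex τ p.1) p.2 * (u (stepIndex τ p.1) p.2 - x p.2)
      = ∫ r in s..t, ∫ y, G (stepIndex τ r) y * (u (stepIndex τ r) - x) y := by
  have h1 := memLp_step hτ hG hG2 s t
  have h2 := memLp_step (G := fun k y => u k y - x y) hτ
    (fun k => Continuous.measurable (by fun_prop))
    (fun k => MemLp.of_bound (Continuous.aestronglyMeasurable (by fun_prop)) ‖u k - x‖
      (Eventually.of_forall fun y => (u k - x).norm_coe_le_norm y)) s t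
  have h3 : IntegrableOn (fun p : ℝ × unitInterval =>
      G (stepIndex τ p.1) p.2 * (u (stepIndex τ p.1) p.2 - x p.2)) (strip s t) :=
    h1.integrable_mul h2
  rw [setIntegral_slab_eq hst (h3.mono_set (slab_subset_strip le_rfl le_rfl))]
  rfl

end StepForcing

/-! ### Connecting two states -/

lemma toLp_toL2 (u : C(unitInterval, ℝ)) :
    ∃ h : MemLp (fun x => u x) 2 (volume : Measure unitInterval), h.toLp (fun x => u x) = toL2 u :=
  ⟨MemLp.of_bound (Continuous.aestronglyMeasurable (by fun_prop)) ‖u‖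
    (Eventually.of_forall fun y => u.norm_coe_le_norm y), rfl⟩

/-- A pointwise representative of the forcing in one step of the Euler scheme. -/
lemma exists_repr (ζ : Lp ℝ 2 (volume : Measure unitInterval)) (c : ℝ) (w : C(unitInterval, ℝ)) :
    Measurable (fun x => ζ x + c * w x) ∧ MemLp (fun x => ζ x + c * w x) 2 volume ∧
      (∫ x, (ζ x + c * w x) ^ 2 = ‖ζ + c • toL2 w‖ ^ 2) ∧
      ∀ ψ : C(unitInterval, ℝ),
        ∫ x, (ζ x + c * w x) * ψ x = inner ℝ (ζ + c • toL2 w) (toL2 ψ) := by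
  obtain ⟨hw, hw'⟩ := toLp_toL2 w
  have hm : MemLp (fun x => ζ x + c * w x) 2 volume := (Lp.memLp ζ).add (hw.const_mul c)
  have he : hm.toLp _ = ζ + c • toL2 w := by
    rw [← hw']
    have e1 := MemLp.toLp_add (Lp.memLp ζ) (hw.const_mul c)
    have e2 := MemLp.toLp_const_smul c hw
    rw [Lp.toLp_coeFn] at e1
    exact e1.trans (congrArg _ e2)
  refine ⟨?_, hm, ?_, fun ψ => ?_⟩
  · exact (Lp.stronglyMeasurable ζ).measurable.add (Continuous.measurable (by fun_prop))
  · rw [← he, norm_toLp_sq]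
  · obtain ⟨hψ, hψ'⟩ := toLp_toL2 ψ
    rw [← he, ← hψ', inner_toLp]

variable {K₁ K₂ A B : C(unitInterval, ℝ)} {ζ : Lp ℝ 2 (volume : Measure unitInterval)} {T E : ℝ}

/-- An Euler scheme with `N = n + 1` steps whose feedback gain `1 / (T - t)` drives it to the target
at time `T`, with a bounded forcing. -/
lemma exists_isEuler_target (h0 : (0 : C(unitInterval, ℝ)) ∈ wallSpace K₁ K₂)
    (hA : A ∈ wallSpace K₁ K₂) (hB : B ∈ wallSpace K₁ K₂) (hζ : IsSubgradient K₁ K₂ B ζ)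
    (hT : 0 < T) (n : ℕ) :
    ∃ (c : ℕ → ℝ) (u : ℕ → C(unitInterval, ℝ)), IsEuler K₁ K₂ A B ζ (T / (n + 1)) c u ∧
      (∀ j, ‖ζ + c j • toL2 (B - u (j + 1))‖ ≤ ‖ζ‖ + ‖toL2 (A - B)‖ / T) ∧
      ‖toL2 (u (n + 1) - B)‖ * (n + 2) ≤ ‖toL2 (A - B)‖ := by
  set τ := T / (n + 1) with hτ
  have hn : (0 : ℝ) < n + 1 := by positivity
  have hτ0 : 0 < τ := by positivity
  have hτT : τ * (n + 1) = T := by rw [hτ]; field_simp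
  -- The gain is `1 / (T - j τ)`; after the last step, the truncated subtraction and `0⁻¹ = 0` make it
  -- vanish.
  set c : ℕ → ℝ := fun j => (τ * ((n + 1 - j : ℕ) : ℝ))⁻¹ with hc
  have hc0 : ∀ j, 0 ≤ c j := fun j => by positivity
  obtain ⟨u, hu⟩ := exists_isEuler (B := B) h0 hA ζ hτ0 hc0
  set d := ‖toL2 (A - B)‖
  have hd : 0 ≤ d := norm_nonneg _
  -- The contraction factors `(n + 1 - j) / (n + 2 - j)` telescope, so that the distance to the
  -- target decreases linearly in time.
  have hcontr : ∀ j : ℕ, j ≤ n + 1 → ‖toL2 (u j - B)‖ * (n + 2) ≤ d * (n + 2 - j) := by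
    intro j
    induction j with
    | zero => intro _; simp [hu.zero, d]
    | succ j ih =>
      intro hj
      have ih := ih (by omega)
      have h1 := hu.norm_sub_le h0 hτ0 hB hζ j
      have hk : (0 : ℝ) < n + 1 - j := by
        have : (j : ℝ) + 1 ≤ n + 1 := by exact_mod_cast hj
        linarith
      have hcast : ((n + 1 - j : ℕ) : ℝ) = n + 1 - j := by
        rw [Nat.cast_sub (by omega)]; push_cast; ring
      have h2 : 1 + τ * c j = (n + 2 - j) / (n + 1 - j) := by
        simp only [hc, hcast]
        field_simp
        ring
      rw [h2, div_mul_eq_mul_div, div_le_iff₀ hk] at h1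
      have hk2 : (0 : ℝ) < n + 2 - j := by linarith
      have h3 : (n + 2 - j) * (‖toL2 (u (j + 1) - B)‖ * (n + 2))
          ≤ (n + 2 - j) * (d * (n + 2 - (j + 1))) := by
        calc (n + 2 - j) * (‖toL2 (u (j + 1) - B)‖ * (n + 2))
            = ((n + 2 - j) * ‖toL2 (u (j + 1) - B)‖) * (n + 2) := by ring
          _ ≤ (‖toL2 (u j - B)‖ * (n + 1 - j)) * (n + 2) :=
              mul_le_mul_of_nonneg_right h1 (by linarith)
          _ = (‖toL2 (u j - B)‖ * (n + 2)) * (n + 1 - j) := by ring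
          _ ≤ d * (n + 2 - j) * (n + 1 - j) := mul_le_mul_of_nonneg_right ih hk.le
          _ = _ := by ring
      push_cast
      exact le_of_mul_le_mul_left h3 hk2
  refine ⟨c, u, hu, fun j => ?_, ?_⟩
  · refine (norm_add_le _ _).trans (add_le_add_right ?_ _)
    rw [norm_smul, Real.norm_eq_abs, abs_of_nonneg (hc0 j)]
    have e : ‖toL2 (B - u (j + 1))‖ = ‖toL2 (u (j + 1) - B)‖ := by
      rw [← norm_neg, ← map_neg, neg_sub]
    rw [e]
    by_cases hj : j < n + 1
    · have h1 := hcontr (j + 1) hj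
      have hcast : ((n + 1 - j : ℕ) : ℝ) = n + 1 - j := by
        rw [Nat.cast_sub (by omega)]; push_cast; ring
      have hk : (0 : ℝ) < n + 1 - j := by
        have : (j : ℝ) + 1 ≤ n + 1 := by exact_mod_cast hj
        linarith
      simp only [hc, hcast]
      rw [inv_mul_le_iff₀ (by positivity), ← mul_div_assoc, le_div_iff₀ hT, ← hτT]
      push_cast at h1
      have h2 := mul_le_mul_of_nonneg_left h1 hτ0.le
      have h3 : 0 ≤ τ * ‖toL2 (u (j + 1) - B)‖ := by positivity
      nlinarith
    · have : c j = 0 := by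
        simp only [hc]
        rw [Nat.sub_eq_zero_of_le (by omega)]; simp
      rw [this, zero_mul]; positivity
  · have := hcontr (n + 1) le_rfl
    push_cast at this
    linarith

/-- A state of finite energy can be steered, in any time, to a state at which the energy has a
subgradient. -/
theorem exists_connecting_path (h0 : (0 : C(unitInterval, ℝ)) ∈ wallSpace K₁ K₂)
    (hA : A ∈ wallSpace K₁ K₂) (hE : EnergyLE A E) (hB : B ∈ wallSpace K₁ K₂)
    (hζ : IsSubgradient K₁ K₂ B ζ) (hT : 0 < T) :
    ∃ w g, IsEVI K₁ K₂ 0 T w g ∧ w 0 = A ∧ w T = B ∧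
      ∫ p in slab 0 T, g p ^ 2 ≤ T * (‖ζ‖ + ‖toL2 (A - B)‖ / T) ^ 2 := by
  choose c u hu hΓ hlast using exists_isEuler_target h0 hA hB hζ hT
  set Γ := ‖ζ‖ + ‖toL2 (A - B)‖ / T with hΓdef
  have hΓ0 : 0 ≤ Γ := by positivity
  set τ : ℕ → ℝ := fun n => T / (n + 1) with hτ
  have hτ0 : ∀ n, 0 < τ n := fun n => by simp only [hτ]; positivity
  have hτT : ∀ n, ((n + 1 : ℕ) : ℝ) * τ n = T := fun n => by simp only [hτ]; push_cast; field_simp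
  have hτlim : Tendsto τ atTop (𝓝 0) := by
    have := (tendsto_one_div_add_atTop_nhds_zero_nat (𝕜 := ℝ)).const_mul T
    simpa [hτ, div_eq_mul_inv] using this
  set U : Ultrafilter ℕ := hyperfilter ℕ
  have hU : (U : Filter ℕ) ≤ atTop := Nat.hyperfilter_le_atTop
  set M := E + T * (Γ ^ 2 / 2) with hM
  have hE0 := hE.nonneg
  have hM0 : 0 ≤ M := by positivity
  set v : ℕ → ℝ → C(unitInterval, ℝ) := fun n r => u n (stepIndex (τ n) r) with hv
  -- The forcing on the `k`-th interval, which ends with the state `u n k`; the value at `k = 0`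
  -- only matters on a null set.
  set γ : ℕ → ℕ → unitInterval → ℝ := fun n k x =>
    ζ x + c n (k - 1) * (B - u n (k - 1 + 1)) x with hγ
  have hγm : ∀ n k, Measurable (γ n k) := fun n k => (exists_repr ζ _ _).1
  have hγ2 : ∀ n k, MemLp (γ n k) 2 volume := fun n k => (exists_repr ζ _ _).2.1
  have hγΓ : ∀ n k, ∫ x, γ n k x ^ 2 ≤ Γ ^ 2 := fun n k => by
    have := (exists_repr ζ (c n (k - 1)) (B - u n (k - 1 + 1))).2.2.1
    simp only [hγ]
    rw [this]
    exact pow_le_pow_left₀ (norm_nonneg _) (hΓ n _) 2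
  set gn : ℕ → ℝ × unitInterval → ℝ := fun n p => γ n (stepIndex (τ n) p.1) p.2 with hgn
  have hidx : ∀ n, ∀ r ∈ Icc 0 T, stepIndex (τ n) r ≤ n + 1 := fun n r hr => by
    have := stepIndex_mono (hτ0 n) hr.2
    rwa [← hτT n, stepIndex_mul (hτ0 n)] at this
  have hjM : ∀ n j : ℕ, j ≤ n + 1 → E + j * (τ n * Γ ^ 2 / 2) ≤ M := by
    intro n j hj
    have h1 : (j : ℝ) ≤ ((n + 1 : ℕ) : ℝ) := by exact_mod_cast hj
    have h2 : 0 ≤ τ n * Γ ^ 2 / 2 := by have := (hτ0 n).le; positivity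
    have h3 := mul_le_mul_of_nonneg_right h1 h2
    have h4 : ((n + 1 : ℕ) : ℝ) * (τ n * Γ ^ 2 / 2) = T * (Γ ^ 2 / 2) := by
      rw [← hτT n]; ring
    linarith
  have huM : ∀ n j : ℕ, j ≤ n + 1 → EnergyLE (u n j) M := by
    intro n j hj
    refine ((hu n).energyLE (hτ0 n) (hΓ n) hE j).mono ?_
    have h1 : 0 ≤ (∑ i ∈ Finset.range j, ‖toL2 (u n (i + 1) - u n i)‖ ^ 2) / (2 * τ n) :=
      div_nonneg (Finset.sum_nonneg fun _ _ => sq_nonneg _) (by linarith [hτ0 n])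
    linarith [hjM n j hj]
  have hvS : ∀ n, ∀ r ∈ Icc 0 T, v n r ∈ {u | u ∈ wallSpace K₁ K₂ ∧ EnergyLE u M} :=
    fun n r hr => ⟨(hu n).mem_wallSpace _, huM n _ (hidx n r hr)⟩
  obtain ⟨w, hw, hwS, hconv⟩ := exists_uniform_limit (U := U) (isCompact_energyLE M) hvS
    (κ := fun r => 2 * M * r) (by fun_prop) (by simp) (e := fun n => 2 * M * τ n)
    (by simpa using (hτlim.mono_left hU).const_mul (2 * M)) (by
      intro n s hs t ht hst
      have h1 := (hu n).norm_sub_sq_le (hτ0 n) (hΓ n) hE (stepIndex_mono (hτ0 n) hst)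
        (hjM n _ (hidx n t ht))
      refine h1.trans ?_
      rw [← mul_add]
      refine mul_le_mul_of_nonneg_left ?_ (by positivity)
      have h2 := le_stepIndex_mul (hτ0 n) s
      have h3 := stepIndex_mul_lt (hτ0 n) ht.1
      rw [sub_mul]
      linarith)
  have hpt : ∀ r ∈ Icc 0 T, Tendsto (fun n => v n r) U (𝓝 (w r)) := by
    intro r hr
    rw [Metric.tendsto_nhds]
    intro ε hε
    filter_upwards [hconv ε hε] with i hi
    rw [dist_eq_norm]; exact hi r hr
  have hgn2 : ∀ n, MemLp (gn n) 2 (volume.restrict (strip 0 T)) := fun n =>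
    memLp_step (hτ0 n) (hγm n) (hγ2 n) 0 T
  have hgnC : ∀ n, ∫ p in strip 0 T, gn n p ^ 2 ≤ T * Γ ^ 2 := fun n => by
    have := setIntegral_step_sq_le (hτ0 n) (hγm n) (hγ2 n) (hγΓ n) hT.le
    rwa [sub_zero] at this
  obtain ⟨g, hg, hgC, hweak⟩ := exists_weak_limit U hgn2 hgnC
  refine ⟨w, g, ?_, ?_, ?_, ?_⟩
  · refine isEVI_of_tendsto (U := U) (v := v) (g := gn) hw (fun t ht => (hwS t ht).1) hg hconv
      (fun n K => intervalIntegrable_stepIndex (hτ0 n) (fun k => partialEnergy K (u n k)) 0 T)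
      (fun x s t hs hst ht => ?_) (fun x hx Ex hEx s t hs hst ht K => ?_)
    · refine tendsto_setIntegral_mul hgn2 hgnC hweak
        (q := fun n p => v n p.1 p.2 - x p.2) (q' := fun p => w p.1 p.2 - x p.2) (fun n => ?_) ?_
        (fun ε hε => ?_) (measurableSet_slab s t) (slab_subset_strip hs ht)
      · exact memLp_step (G := fun k y => u n k y - x y) (hτ0 n)
          (fun k => Continuous.measurable (by fun_prop))
          (fun k => MemLp.of_bound (Continuous.aestronglyMeasurable (by fun_prop)) ‖u n k - x‖
            (Eventually.of_forall fun y => (u n k - x).norm_coe_le_norm y)) 0 T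
      · exact (memLp_eval hw fun t ht => (hwS t ht).1).sub (memLp_comp_snd x 0 T)
      · filter_upwards [hconv ε hε] with n hn p hp
        rw [sub_sub_sub_cancel_right]
        exact ((v n p.1 - w p.1).norm_coe_le_norm p.2).trans (hn p.1 hp.1).le
    -- The discrete variational inequalities, with an error that vanishes with the step.
    · set C := M + Ex + Γ * (2 * wallBound K₁ K₂) with hC
      have hR := wallBound_nonneg K₁ K₂
      have hEx0 := hEx.nonneg
      refine ⟨fun n => 2 * τ n * C, ?_, fun n => ?_⟩
      · simpa using ((hτlim.mono_left hU).const_mul 2).mul_const C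
      · have htel := stepIndex_telescope (hτ0 n) (N := n + 1)
          (Y := fun k => ‖toL2 (u n k - x)‖ ^ 2 / 2)
          (R := fun k => partialEnergy K (u n k) - Ex - ∫ y, γ n k y * (u n k - x) y) (C := C)
          (fun k => ?_) (fun k hk => ?_) (by positivity) hs hst (by rw [hτT n]; exact ht)
        · have hi1 := intervalIntegrable_stepIndex (hτ0 n) (fun k => partialEnergy K (u n k)) s t
          have hi2 := intervalIntegrable_stepIndex (hτ0 n)
            (fun k => ∫ y, γ n k y * (u n k - x) y) s t
          have e1 := setIntegral_step_mul (u := u n) (hτ0 n) (hγm n) (hγ2 n) x hst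
          rw [intervalIntegral.integral_sub (hi1.sub intervalIntegrable_const) hi2,
            intervalIntegral.integral_sub hi1 intervalIntegrable_const,
            intervalIntegral.integral_const, smul_eq_mul, ← e1] at htel
          simp only [hv, hgn]
          linarith
        · have h1 := (hu n).evi (hτ0 n) k hx hEx K
          have h2 := (exists_repr ζ (c n k) (B - u n (k + 1))).2.2.2 (u n (k + 1) - x)
          simp only [hγ, Nat.add_sub_cancel]
          rw [h2]
          exact h1
        · have h2 := (exists_repr ζ (c n k) (B - u n (k + 1))).2.2.2 (u n (k + 1) - x)
          simp only [hγ, Nat.add_sub_cancel]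
          rw [h2]
          have h3 := huM n (k + 1) hk K
          have h4 := partialEnergy_nonneg K (u n (k + 1))
          have h5 : |inner ℝ (ζ + c n k • toL2 (B - u n (k + 1))) (toL2 (u n (k + 1) - x))|
              ≤ Γ * (2 * wallBound K₁ K₂) := (abs_real_inner_le_norm _ _).trans
            (mul_le_mul (hΓ n k) (norm_toL2_sub_le ((hu n).mem_wallSpace _) hx)
              (norm_nonneg _) hΓ0)
          rw [abs_le] at h5 ⊢
          constructor <;> linarith [h5.1, h5.2]
  · refine tendsto_nhds_unique (hpt 0 ⟨le_rfl, hT.le⟩) ?_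
    have : ∀ n, v n 0 = A := fun n => by simp only [hv, stepIndex_zero, (hu n).zero]
    simp_rw [this]
    exact tendsto_const_nhds
  · have h1 : ∀ n, v n T = u n (n + 1) := fun n => by
      simp only [hv]
      congr 1
      conv_lhs => rw [← hτT n]
      exact stepIndex_mul (hτ0 n) (n + 1)
    have h2 : Tendsto (fun n => ‖toL2 (v n T - B)‖) U (𝓝 0) := by
      refine squeeze_zero (fun _ => norm_nonneg _) (g := fun n : ℕ => ‖toL2 (A - B)‖ *
        (1 / ((n : ℝ) + 1))) (fun n => ?_) ?_
      · rw [h1, mul_one_div, le_div_iff₀ (by positivity)]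
        have := norm_nonneg (toL2 (u n (n + 1) - B))
        linarith [hlast n]
      · have := ((tendsto_one_div_add_atTop_nhds_zero_nat (𝕜 := ℝ)).mono_left hU).const_mul
          ‖toL2 (A - B)‖
        simpa using this
    have h3 : Tendsto (fun n => ‖toL2 (v n T - B)‖) U (𝓝 ‖toL2 (w T - B)‖) :=
      ((toL2.continuous.tendsto _).comp ((hpt T ⟨hT.le, le_rfl⟩).sub_const B)).norm
    have h4 := tendsto_nhds_unique h3 h2
    rw [norm_eq_zero, map_sub, sub_eq_zero] at h4
    exact toL2_injective h4
  · rw [← setIntegral_strip_eq]; exact hgC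

/-! ### Restriction, translation and concatenation of paths -/

variable {K₁ K₂ : C(unitInterval, ℝ)} {a b c : ℝ} {v v' : ℝ → C(unitInterval, ℝ)}
  {g g' : ℝ × unitInterval → ℝ}

lemma IsEVI.restrict (H : IsEVI K₁ K₂ a b v g) {c d : ℝ} (hac : a ≤ c) (hdb : d ≤ b) :
    IsEVI K₁ K₂ c d v g where
  continuousOn := H.continuousOn.mono (Icc_subset_Icc hac hdb)
  mem_wallSpace t ht := H.mem_wallSpace t ⟨hac.trans ht.1, ht.2.trans hdb⟩
  memLp := H.memLp.mono_measure (Measure.restrict_mono (strip_subset_strip hac hdb) le_rfl)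
  evi x hx E hE s t hs hst ht K := H.evi x hx E hE s t (hac.trans hs) hst (ht.trans hdb) K

lemma IsEVI.congr (H : IsEVI K₁ K₂ a b v g) (hv : ∀ t ∈ Icc a b, v' t = v t)
    (hg : ∀ p ∈ slab a b, g' p = g p) : IsEVI K₁ K₂ a b v' g' where
  continuousOn := H.continuousOn.congr hv
  mem_wallSpace t ht := by rw [hv t ht]; exact H.mem_wallSpace t ht
  memLp := by
    refine H.memLp.ae_eq ?_
    rw [Measure.restrict_congr_set (strip_ae_eq_slab a b)]
    filter_upwards [ae_restrict_mem (measurableSet_slab a b)] with p hp using (hg p hp).symm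
  evi x hx E hE s t hs hst ht K := by
    have h := H.evi x hx E hE s t hs hst ht K
    have e1 : ∫ r in s..t, partialEnergy K (v' r) = ∫ r in s..t, partialEnergy K (v r) := by
      refine intervalIntegral.integral_congr fun r hr => ?_
      rw [uIcc_of_le hst] at hr
      simp only [hv r ⟨hs.trans hr.1, hr.2.trans ht⟩]
    have e2 : ∫ p in slab s t, g' p * (v' p.1 p.2 - x p.2)
        = ∫ p in slab s t, g p * (v p.1 p.2 - x p.2) := by
      refine setIntegral_congr_fun (measurableSet_slab s t) fun p hp => ?_
      have hp' : p ∈ slab a b := prod_mono (Ioc_subset_Ioc hs ht) subset_rfl hp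
      simp only [hg p hp', hv p.1 ⟨hp'.1.1.le, hp'.1.2⟩]
    rw [e1, e2, hv t ⟨hs.trans hst, ht⟩, hv s ⟨hs, hst.trans ht⟩]
    exact h

lemma IsEVI.glue (H₁ : IsEVI K₁ K₂ a b v g) (H₂ : IsEVI K₁ K₂ b c v g) (hab : a ≤ b)
    (hbc : b ≤ c) : IsEVI K₁ K₂ a c v g := by
  have hcont : ContinuousOn v (Icc a c) := by
    rw [← Icc_union_Icc_eq_Icc hab hbc]
    exact H₁.continuousOn.union_of_isClosed H₂.continuousOn isClosed_Icc isClosed_Icc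
  have hstrip : strip a c = strip a b ∪ strip b c := by
    rw [strip, strip, strip, ← union_prod, Icc_union_Icc_eq_Icc hab hbc]
  have hmem : MemLp g 2 (volume.restrict (strip a c)) := by
    have hm : AEStronglyMeasurable g (volume.restrict (strip a c)) := by
      rw [hstrip, aestronglyMeasurable_union_iff]
      exact ⟨H₁.memLp.aestronglyMeasurable, H₂.memLp.aestronglyMeasurable⟩
    rw [memLp_two_iff_integrable_sq hm]
    have : IntegrableOn (fun p => g p ^ 2) (strip a c) := by
      rw [hstrip]
      exact H₁.integrableOn_sq.union H₂.integrableOn_sq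
    exact this
  refine ⟨hcont, fun t ht => ?_, hmem, fun x hx E hE s t hs hst ht K => ?_⟩
  · rcases le_total t b with h | h
    · exact H₁.mem_wallSpace t ⟨ht.1, h⟩
    · exact H₂.mem_wallSpace t ⟨h, ht.2⟩
  · rcases le_total t b with h | h
    · exact H₁.evi x hx E hE s t hs hst h K
    rcases le_total b s with h' | h'
    · exact H₂.evi x hx E hE s t h' hst ht K
    have e1 := H₁.evi x hx E hE s b hs h' le_rfl K
    have e2 := H₂.evi x hx E hE b t le_rfl h ht K
    have hi : ∀ x y, a ≤ x → x ≤ y → y ≤ c →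
        IntervalIntegrable (fun r => partialEnergy K (v r)) volume x y := fun x y h1 h2 h3 =>
      ContinuousOn.intervalIntegrable (by
        rw [uIcc_of_le h2]
        exact ((continuous_partialEnergy K).comp_continuousOn hcont).mono (Icc_subset_Icc h1 h3))
    have e3 := intervalIntegral.integral_add_adjacent_intervals (hi s b hs h' hbc) (hi b t hab h ht)
    have e4 : IntegrableOn (fun p => g p * (v p.1 p.2 - x p.2)) (strip a c) :=
      (MemLp.integrableOn_strip hmem).mul_continuousOn ((continuousOn_eval hcont).sub
        (Continuous.continuousOn (by fun_prop))) (isCompact_strip a c)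
    rw [← e3, setIntegral_slab_add h' h (e4.mono_set (slab_subset_strip hs ht))]
    linarith

/-- Translation in time. -/
def timeShift (s : ℝ) : ℝ × unitInterval ≃ᵐ ℝ × unitInterval :=
  (MeasurableEquiv.subRight s).prodCongr (MeasurableEquiv.refl _)

lemma timeShift_apply (s : ℝ) (p : ℝ × unitInterval) : timeShift s p = (p.1 - s, p.2) := rfl

lemma measurePreserving_timeShift (s : ℝ) : MeasurePreserving (timeShift s) :=
  (measurePreserving_sub_right volume s).prod (MeasurePreserving.id _)

lemma timeShift_preimage_slab (s x y : ℝ) :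
    timeShift s ⁻¹' slab (x - s) (y - s) = slab x y := by
  ext p
  simp [slab, timeShift_apply]

lemma timeShift_preimage_strip (s x y : ℝ) :
    timeShift s ⁻¹' strip (x - s) (y - s) = strip x y := by
  ext p
  simp [strip, timeShift_apply]

lemma setIntegral_timeShift (q : ℝ × unitInterval → ℝ) (s x y : ℝ) :
    ∫ p in slab x y, q (timeShift s p) = ∫ p in slab (x - s) (y - s), q p := by
  rw [← timeShift_preimage_slab s x y]
  exact (measurePreserving_timeShift s).setIntegral_preimage_emb
    (timeShift s).measurableEmbedding q _

lemma IsEVI.shift (s : ℝ) (H : IsEVI K₁ K₂ (a - s) (b - s) v g) :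
    IsEVI K₁ K₂ a b (fun t => v (t - s)) (fun p => g (timeShift s p)) where
  continuousOn := H.continuousOn.comp (Continuous.continuousOn (by fun_prop)) fun t ht =>
    ⟨by linarith [ht.1], by linarith [ht.2]⟩
  mem_wallSpace t ht := H.mem_wallSpace _ ⟨by linarith [ht.1], by linarith [ht.2]⟩
  memLp := by
    rw [← timeShift_preimage_strip s]
    exact H.memLp.comp_measurePreserving
      ((measurePreserving_timeShift s).restrict_preimage (measurableSet_strip _ _))
  evi x hx E hE r t hr hrt ht K := by
    have h := H.evi x hx E hE (r - s) (t - s) (by linarith) (by linarith) (by linarith) K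
    have e1 := setIntegral_timeShift (fun p => g p * (v p.1 p.2 - x p.2)) s r t
    have e2 := intervalIntegral.integral_comp_sub_right (a := r) (b := t)
      (fun r => partialEnergy K (v r)) s
    simp only [timeShift_apply] at e1
    simp only [timeShift_apply]
    rw [e1, e2]
    have e3 : t - s - (r - s) = t - r := by ring
    rwa [e3] at h

variable {α : ℝ} {f σ : unitInterval → ℝ → ℝ} {B m : ℝ}

lemma cost_shift (s : ℝ) :
    cost α f σ a b (fun t => v (t - s)) (fun p => g (timeShift s p))
      = cost α f σ (a - s) (b - s) v g := by
  rw [cost, cost, ← setIntegral_timeShift]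
  rfl

lemma cost_congr (hv : ∀ t ∈ Icc a b, v' t = v t) (hg : ∀ p ∈ slab a b, g' p = g p) :
    cost α f σ a b v' g' = cost α f σ a b v g := by
  rw [cost, cost]
  congr 1
  refine setIntegral_congr_fun (measurableSet_slab a b) fun p hp => ?_
  simp only [control, hg p hp, hv p.1 ⟨hp.1.1.le, hp.1.2⟩]

/-- The state `y` can be reached from the state `x` in time `T` at the cost `r`. -/
def Reaches (α : ℝ) (f σ : unitInterval → ℝ → ℝ) (K₁ K₂ x y : C(unitInterval, ℝ)) (T r : ℝ) :
    Prop :=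
  ∃ v g, IsEVI K₁ K₂ 0 T v g ∧ v 0 = x ∧ v T = y ∧ cost α f σ 0 T v g ≤ r

lemma IsEVI.reaches (H : IsEVI K₁ K₂ a b v g) :
    Reaches α f σ K₁ K₂ (v a) (v b) (b - a) (cost α f σ a b v g) := by
  have H' : IsEVI K₁ K₂ (0 - -a) (b - a - -a) v g := by simpa using H
  refine ⟨_, _, H'.shift, by simp, by simp, ?_⟩
  rw [cost_shift]
  simp

lemma Reaches.trans (hc : IsCoefficient f σ B m) {x y z : C(unitInterval, ℝ)} {T T' r r' : ℝ}
    (hT : 0 ≤ T) (hT' : 0 ≤ T') (h : Reaches α f σ K₁ K₂ x y T r)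
    (h' : Reaches α f σ K₁ K₂ y z T' r') : Reaches α f σ K₁ K₂ x z (T + T') (r + r') := by
  obtain ⟨v, g, H, hx, hy, hr⟩ := h
  obtain ⟨w, k, H', hy', hz, hr'⟩ := h'
  have H'' : IsEVI K₁ K₂ (T - T) (T + T' - T) w k := by simpa using H'
  set u : ℝ → C(unitInterval, ℝ) := fun t => if t ≤ T then v t else w (t - T) with hu
  set q : ℝ × unitInterval → ℝ := fun p => if p.1 ≤ T then g p else k (timeShift T p) with hq
  have u1 : ∀ t ∈ Icc 0 T, u t = v t := fun t ht => if_pos ht.2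
  have q1 : ∀ p ∈ slab 0 T, q p = g p := fun p hp => if_pos hp.1.2
  have u2 : ∀ t ∈ Icc T (T + T'), u t = w (t - T) := fun t ht => by
    rcases ht.1.eq_or_lt with h | h
    · rw [← h, sub_self, hy', ← hy]; exact if_pos le_rfl
    · exact if_neg (not_le.2 h)
  have q2 : ∀ p ∈ slab T (T + T'), q p = k (timeShift T p) := fun p hp =>
    if_neg (not_le.2 hp.1.1)
  have Hu : IsEVI K₁ K₂ 0 (T + T') u q :=
    (H.congr u1 q1).glue ((H''.shift T).congr u2 q2) hT (by linarith)
  refine ⟨u, q, Hu, ?_, ?_, ?_⟩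
  · rw [u1 0 ⟨le_rfl, hT⟩, hx]
  · rw [u2 _ ⟨by linarith, le_rfl⟩, add_sub_cancel_left, hz]
  · rw [Hu.cost_add hc hT (by linarith), cost_congr u1 q1,
      cost_congr (a := T) (v := fun t => w (t - T)) (g := fun p => k (timeShift T p)) u2 q2,
      cost_shift, sub_self, add_sub_cancel_left]
    exact add_le_add hr hr'

lemma Reaches.mono {x y : C(unitInterval, ℝ)} {T r r' : ℝ} (h : Reaches α f σ K₁ K₂ x y T r)
    (hr : r ≤ r') : Reaches α f σ K₁ K₂ x y T r' := by
  obtain ⟨v, g, H, hx, hy, hle⟩ := h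
  exact ⟨v, g, H, hx, hy, hle.trans hr⟩

/-- The cost per unit time of keeping the total forcing equal to zero. -/
def idleRate (α : ℝ) (K₁ K₂ : C(unitInterval, ℝ)) (B m : ℝ) : ℝ :=
  3 / (2 * m ^ 2) * ((α * wallBound K₁ K₂) ^ 2 + B ^ 2)

/-- The path can rest at `0`, at a cost proportional to the time spent there. -/
lemma reaches_zero (hc : IsCoefficient f σ B m)
    (h0 : (0 : C(unitInterval, ℝ)) ∈ wallSpace K₁ K₂) {T : ℝ} (hT : 0 ≤ T) :
    Reaches α f σ K₁ K₂ 0 0 T (idleRate α K₁ K₂ B m * T) := by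
  have H : IsEVI K₁ K₂ 0 T (fun _ => 0) (fun _ => 0) := by
    refine ⟨continuousOn_const, fun _ _ => h0, MemLp.zero, fun x hx E hE s t hs hst ht K => ?_⟩
    have e : partialEnergy K 0 = 0 := le_antisymm (energyLE_zero K) (partialEnergy_nonneg _ _)
    have := mul_nonneg (sub_nonneg.2 hst) hE.nonneg
    simpa [e] using this
  refine ⟨_, _, H, rfl, rfl, (H.cost_le hc hT).trans (le_of_eq ?_)⟩
  rw [idleRate]
  simp
  ring

lemma Reaches.quasipotential_le (hc : IsCoefficient f σ B m) (hK : ∀ x, K₁ x < 0 ∧ 0 < K₂ x)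
    {T r : ℝ} (hT : 0 < T) {z : wallSpace K₁ K₂} (h : Reaches α f σ K₁ K₂ 0 z T r) :
    quasipotential α f σ K₁ K₂ z ≤ ENNReal.ofReal r := by
  obtain ⟨v, g, H, hx, hy, hle⟩ := h
  exact (ReflectedSPDE.quasipotential_le hc hK hT H hx hy).trans (ENNReal.ofReal_le_ofReal hle)

/-- A state of low quasipotential is reached by a path of a prescribed minimal duration. -/
lemma exists_isEVI_of_quasipotential_lt (hc : IsCoefficient f σ B m)
    (h0 : (0 : C(unitInterval, ℝ)) ∈ wallSpace K₁ K₂) {z : wallSpace K₁ K₂} {r : ℝ}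
    (hr : quasipotential α f σ K₁ K₂ z < ENNReal.ofReal r) {δ : ℝ} (hδ : 0 ≤ δ) :
    ∃ (a : ℝ) (v : ℝ → C(unitInterval, ℝ)) (g : ℝ × unitInterval → ℝ), a < -δ ∧
      IsEVI K₁ K₂ a 0 v g ∧ v a = 0 ∧ v 0 = z ∧
      cost α f σ a 0 v g ≤ r + idleRate α K₁ K₂ B m * δ := by
  obtain ⟨T, v, g, hT, H, hv0, hvT, hcost⟩ := exists_of_quasipotential_lt hc hr
  obtain ⟨w, k, H', h1, h2, h3⟩ := (reaches_zero (α := α) hc h0 hδ).trans hc hδ hT.le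
    ⟨v, g, H, hv0, hvT, hcost.le⟩
  have H'' : IsEVI K₁ K₂ (-(δ + T) - -(δ + T)) (0 - -(δ + T)) w k := by simpa using H'
  refine ⟨-(δ + T), _, _, by linarith, H''.shift, by simpa using h1, by simpa using h2, ?_⟩
  rw [cost_shift]
  simpa [add_comm] using h3

/-! ### Compactness of the level sets -/

variable {K₁ K₂ : C(unitInterval, ℝ)} {a b : ℝ} {α : ℝ} {f σ : unitInterval → ℝ → ℝ} {B m : ℝ}

/-- Uniformly convergent paths with weakly convergent controls: the forcings converge in the sense
needed for the variational inequality. -/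
lemma tendsto_setIntegral_forcing (hc : IsCoefficient f σ B m) {C : ℝ}
    (hLip : ∀ x y y', |f x y - f x y'| + |σ x y - σ x y'| ≤ C * |y - y'|) {U : Ultrafilter ℕ}
    {v : ℕ → ℝ → C(unitInterval, ℝ)} {h : ℕ → ℝ × unitInterval → ℝ}
    {w : ℝ → C(unitInterval, ℝ)} {k : ℝ × unitInterval → ℝ}
    (hv : ∀ n, ContinuousOn (v n) (Icc a b)) (hvw : ∀ n, ∀ t ∈ Icc a b, v n t ∈ wallSpace K₁ K₂)
    (hw : ContinuousOn w (Icc a b)) (hww : ∀ t ∈ Icc a b, w t ∈ wallSpace K₁ K₂)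
    (hconv : ∀ ε > 0, ∀ᶠ i in (U : Filter ℕ), ∀ t ∈ Icc a b, ‖v i t - w t‖ < ε)
    (hh : ∀ n, MemLp (h n) 2 (volume.restrict (strip a b))) {D : ℝ}
    (hD : ∀ n, ∫ p in strip a b, h n p ^ 2 ≤ D) (hk : MemLp k 2 (volume.restrict (strip a b)))
    (hweak : ∀ ψ, MemLp ψ 2 (volume.restrict (strip a b)) →
      Tendsto (fun i => ∫ p in strip a b, h i p * ψ p) U (𝓝 (∫ p in strip a b, k p * ψ p)))
    (x : C(unitInterval, ℝ)) {s t : ℝ} (hs : a ≤ s) (ht : t ≤ b) :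
    Tendsto (fun i => ∫ p in slab s t, forcing α f σ (v i) (h i) p * (v i p.1 p.2 - x p.2)) U
      (𝓝 (∫ p in slab s t, forcing α f σ w k p * (w p.1 p.2 - x p.2))) := by
  have hsub := slab_subset_strip hs ht
  set R := wallBound K₁ K₂ + ‖x‖ with hR
  have hR0 : 0 ≤ R := add_nonneg (wallBound_nonneg _ _) (norm_nonneg _)
  have hB := hc.nonneg
  have hC : 0 ≤ C := by
    have h1 := hLip 0 0 1
    have h2 := abs_nonneg (f 0 0 - f 0 1)
    have h3 := abs_nonneg (σ 0 0 - σ 0 1)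
    norm_num at h1
    linarith
  have hx : ∀ y, |x y| ≤ ‖x‖ := fun y => x.norm_coe_le_norm y
  -- the two factors
  set q : (ℝ → C(unitInterval, ℝ)) → ℝ × unitInterval → ℝ := fun u p =>
    σ p.2 (u p.1 p.2) * (u p.1 p.2 - x p.2) with hq
  set l : (ℝ → C(unitInterval, ℝ)) → ℝ × unitInterval → ℝ := fun u p =>
    (-α * u p.1 p.2 + f p.2 (u p.1 p.2)) * (u p.1 p.2 - x p.2) with hl
  have hdiff : ∀ u : ℝ → C(unitInterval, ℝ), (∀ t ∈ Icc a b, u t ∈ wallSpace K₁ K₂) →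
      ∀ p ∈ strip a b, |u p.1 p.2 - x p.2| ≤ R := fun u hu p hp =>
    (abs_sub _ _).trans (add_le_add (abs_le_wallBound (hu p.1 hp.1) p.2) (hx p.2))
  have hmemdiff : ∀ u : ℝ → C(unitInterval, ℝ), ContinuousOn u (Icc a b) →
      (∀ t ∈ Icc a b, u t ∈ wallSpace K₁ K₂) →
      MemLp (fun p : ℝ × unitInterval => u p.1 p.2 - x p.2) 2 (volume.restrict (strip a b)) :=
    fun u hu hu' => (memLp_eval hu hu').sub (memLp_comp_snd x a b)
  have hmemq : ∀ u : ℝ → C(unitInterval, ℝ), ContinuousOn u (Icc a b) →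
      (∀ t ∈ Icc a b, u t ∈ wallSpace K₁ K₂) → MemLp (q u) 2 (volume.restrict (strip a b)) :=
    fun u hu hu' => hc.memLp_σ_mul hu (hmemdiff u hu hu')
  have hmeml : ∀ u : ℝ → C(unitInterval, ℝ), ContinuousOn u (Icc a b) →
      (∀ t ∈ Icc a b, u t ∈ wallSpace K₁ K₂) → MemLp (l u) 2 (volume.restrict (strip a b)) := by
    intro u hu hu'
    have h1 := ((memLp_eval hu hu').const_mul (-α)).add (hc.memLp_f hu)
    refine MemLp.of_le_mul (c := R) h1
      (h1.aestronglyMeasurable.mul (hmemdiff u hu hu').aestronglyMeasurable) ?_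
    filter_upwards [ae_restrict_mem (measurableSet_strip a b)] with p hp
    rw [hl, norm_mul, mul_comm]
    exact mul_le_mul_of_nonneg_right (hdiff u hu' p hp) (norm_nonneg _)
  -- Lipschitz bounds
  have hlipq : ∀ n, ∀ p ∈ strip a b,
      |q (v n) p - q w p| ≤ (B + C * R) * |v n p.1 p.2 - w p.1 p.2| := by
    intro n p hp
    have e : q (v n) p - q w p = σ p.2 (v n p.1 p.2) * (v n p.1 p.2 - w p.1 p.2)
        + (σ p.2 (v n p.1 p.2) - σ p.2 (w p.1 p.2)) * (w p.1 p.2 - x p.2) := by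
      simp only [hq]; ring
    have h1 := hLip p.2 (v n p.1 p.2) (w p.1 p.2)
    have h2 := abs_nonneg (f p.2 (v n p.1 p.2) - f p.2 (w p.1 p.2))
    rw [e]
    refine (abs_add_le _ _).trans ?_
    rw [abs_mul, abs_mul]
    have h3 := mul_le_mul_of_nonneg_right (hc.abs_σ_le p.2 (v n p.1 p.2))
      (abs_nonneg (v n p.1 p.2 - w p.1 p.2))
    have h4 := mul_le_mul (show |σ p.2 (v n p.1 p.2) - σ p.2 (w p.1 p.2)|
      ≤ C * |v n p.1 p.2 - w p.1 p.2| by linarith) (hdiff w hww p hp) (abs_nonneg _)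
      (mul_nonneg hC (abs_nonneg _))
    linarith
  have hlipl : ∀ n, ∀ p ∈ strip a b, |l (v n) p - l w p|
      ≤ (|α| * wallBound K₁ K₂ + B + (|α| + C) * R) * |v n p.1 p.2 - w p.1 p.2| := by
    intro n p hp
    have e : l (v n) p - l w p
        = (-α * v n p.1 p.2 + f p.2 (v n p.1 p.2)) * (v n p.1 p.2 - w p.1 p.2)
        + (-α * (v n p.1 p.2 - w p.1 p.2) + (f p.2 (v n p.1 p.2) - f p.2 (w p.1 p.2)))
          * (w p.1 p.2 - x p.2) := by
      simp only [hl]; ring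
    have h1 := hLip p.2 (v n p.1 p.2) (w p.1 p.2)
    have h2 := abs_nonneg (σ p.2 (v n p.1 p.2) - σ p.2 (w p.1 p.2))
    have h3 : |-α * v n p.1 p.2 + f p.2 (v n p.1 p.2)| ≤ |α| * wallBound K₁ K₂ + B := by
      refine (abs_add_le _ _).trans (add_le_add ?_ (hc.abs_f_le _ _))
      rw [abs_mul, abs_neg]
      exact mul_le_mul_of_nonneg_left (abs_le_wallBound (hvw n p.1 hp.1) p.2) (abs_nonneg _)
    have h4 : |-α * (v n p.1 p.2 - w p.1 p.2) + (f p.2 (v n p.1 p.2) - f p.2 (w p.1 p.2))|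
        ≤ (|α| + C) * |v n p.1 p.2 - w p.1 p.2| := by
      refine (abs_add_le _ _).trans ?_
      rw [abs_mul, abs_neg, add_mul]
      linarith
    rw [e]
    refine (abs_add_le _ _).trans ?_
    rw [abs_mul, abs_mul]
    have h5 := mul_le_mul_of_nonneg_right h3 (abs_nonneg (v n p.1 p.2 - w p.1 p.2))
    have h6 := mul_le_mul h4 (hdiff w hww p hp) (abs_nonneg _)
      (mul_nonneg (add_nonneg (abs_nonneg _) hC) (abs_nonneg _))
    linarith
  -- The control enters the forcing through `σ(·,v)`, multiplied by a weakly convergent factor; the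
  -- other terms converge uniformly.
  have hunif : ∀ (Q : (ℝ → C(unitInterval, ℝ)) → ℝ × unitInterval → ℝ) (Λ : ℝ), 0 ≤ Λ →
      (∀ n, ∀ p ∈ strip a b, |Q (v n) p - Q w p| ≤ Λ * |v n p.1 p.2 - w p.1 p.2|) →
      ∀ ε > 0, ∀ᶠ i in (U : Filter ℕ), ∀ p ∈ strip a b, |Q (v i) p - Q w p| ≤ ε := by
    intro Q Λ hΛ hQ ε hε
    filter_upwards [hconv (ε / (Λ + 1)) (by positivity)] with n hn p hp
    have h1 : |v n p.1 p.2 - w p.1 p.2| ≤ ε / (Λ + 1) :=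
      ((v n p.1 - w p.1).norm_coe_le_norm p.2).trans (hn p.1 hp.1).le
    calc |Q (v n) p - Q w p| ≤ Λ * |v n p.1 p.2 - w p.1 p.2| := hQ n p hp
      _ ≤ (Λ + 1) * (ε / (Λ + 1)) := mul_le_mul (by linarith) h1 (abs_nonneg _) (by positivity)
      _ = ε := mul_div_cancel₀ _ (by positivity)
  have t1 := tendsto_setIntegral_mul hh hD hweak (q := fun n => q (v n)) (q' := q w)
    (fun n => hmemq _ (hv n) (hvw n)) (hmemq w hw hww)
    (hunif q _ (by positivity) hlipq) (measurableSet_slab s t) hsub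
  have t2 := tendsto_setIntegral_mul (U := U) (h := fun _ _ => (1 : ℝ)) (k := fun _ => 1)
    (fun _ => memLp_const 1) (fun _ => le_rfl) (fun ψ _ => tendsto_const_nhds)
    (q := fun n => l (v n)) (q' := l w)
    (fun n => hmeml _ (hv n) (hvw n)) (hmeml w hw hww)
    (hunif l _ (by have := wallBound_nonneg K₁ K₂; positivity) hlipl) (measurableSet_slab s t) hsub
  have hsplit : ∀ (u : ℝ → C(unitInterval, ℝ)) (κ : ℝ × unitInterval → ℝ),
      ContinuousOn u (Icc a b) → (∀ t ∈ Icc a b, u t ∈ wallSpace K₁ K₂) →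
      MemLp κ 2 (volume.restrict (strip a b)) →
      ∫ p in slab s t, forcing α f σ u κ p * (u p.1 p.2 - x p.2)
        = (∫ p in slab s t, κ p * q u p) + ∫ p in slab s t, 1 * l u p := by
    intro u κ hu hu' hκ
    have i1 : IntegrableOn (fun p => κ p * q u p) (slab s t) :=
      IntegrableOn.mono_set (hκ.integrable_mul (hmemq u hu hu')) hsub
    have i2 : IntegrableOn (fun p => 1 * l u p) (slab s t) := by
      simp only [one_mul]
      exact IntegrableOn.mono_set (MemLp.integrableOn_strip (hmeml u hu hu')) hsub
    rw [← integral_add i1 i2]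
    refine integral_congr_ae (Eventually.of_forall fun p => ?_)
    simp only [forcing, hq, hl]
    ring
  simp_rw [hsplit _ _ (hv _) (hvw _) (hh _)]
  rw [hsplit w k hw hww hk]
  exact t1.add t2

/-- The limit along an ultrafilter of states of quasipotential at most `r` exists in the maximum norm
and has quasipotential at most `r`, up to an error. -/
lemma exists_limit_quasipotential_le (hc : IsCoefficient f σ B m) {C : ℝ}
    (hLip : ∀ x y y', |f x y - f x y'| + |σ x y - σ x y'| ≤ C * |y - y'|)
    (hK : ∀ x, K₁ x < 0 ∧ 0 < K₂ x) {r : ℝ} (hr : 0 ≤ r) {z : ℕ → wallSpace K₁ K₂}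
    (hz : ∀ n, quasipotential α f σ K₁ K₂ (z n) ≤ ENNReal.ofReal r) {ε : ℝ} (hε : 0 < ε) :
    ∃ y : wallSpace K₁ K₂, Tendsto z (hyperfilter ℕ) (𝓝 y) ∧
      quasipotential α f σ K₁ K₂ y ≤ ENNReal.ofReal (r + ε) := by
  have h0 := zero_mem_wallSpace hK
  have hm := hc.pos
  have hR0 := wallBound_nonneg K₁ K₂
  set U : Ultrafilter ℕ := hyperfilter ℕ with hU
  set c₀ := idleRate α K₁ K₂ B m with hc₀
  have hc₀0 : 0 ≤ c₀ := by rw [hc₀, idleRate]; positivity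
  set δ := ε / (8 * (c₀ + 1)) with hδ
  have hδ0 : 0 < δ := by positivity
  have hδε : c₀ * δ ≤ ε / 8 := by
    rw [hδ, mul_div_assoc', div_le_div_iff₀ (by positivity) (by positivity)]
    nlinarith
  choose a v g ha H hva hv0 hcost using fun n => exists_isEVI_of_quasipotential_lt (α := α) hc h0
    (r := r + ε / 8) ((hz n).trans_lt ((ENNReal.ofReal_lt_ofReal_iff (by linarith)).2
      (by linarith))) hδ0.le
  have hcost' : ∀ n, cost α f σ (a n) 0 (v n) (g n) ≤ r + ε / 4 := fun n => by
    linarith [hcost n]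
  -- the last piece of the paths
  have H₁ : ∀ n, IsEVI K₁ K₂ (-δ) 0 (v n) (g n) := fun n => (H n).restrict (ha n).le le_rfl
  have hcost₁ : ∀ n, cost α f σ (-δ) 0 (v n) (g n) ≤ r + ε / 4 := fun n => by
    have h1 := (H n).cost_add (α := α) hc (ha n).le (by linarith : -δ ≤ 0)
    have h2 : 0 ≤ cost α f σ (a n) (-δ) (v n) (g n) := cost_nonneg
    linarith [hcost' n]
  set G := 3 * ((0 - -δ) * ((α * wallBound K₁ K₂) ^ 2 + B ^ 2) + B ^ 2 * (2 * (r + ε / 4))) with hG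
  have hG0 : 0 ≤ G := by
    have : 0 ≤ 0 - -δ := by linarith
    positivity
  have hforce : ∀ n, ∫ p in slab (-δ) 0, g n p ^ 2 ≤ G := fun n => by
    refine ((H₁ n).forcing_sq_le (α := α) hc (by linarith)).trans ?_
    rw [hG]
    have := mul_le_mul_of_nonneg_left (hcost₁ n) (show 0 ≤ B ^ 2 * 2 by positivity)
    linarith
  set L := (2 * (wallBound K₁ K₂) ^ 2 * (1 + (0 - -δ)) + G) / (δ / 4) + 1 with hL
  have hL0 : 0 < L := by
    have : 0 ≤ 0 - -δ := by linarith
    positivity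
  set M := 2 * L + 4 * G with hM
  have hM0 : 0 ≤ M := by positivity
  set a₁ := -(3 * δ / 4) with ha₁
  have ha₁0 : a₁ ≤ 0 := by rw [ha₁]; linarith
  have ha₁δ : -δ ≤ a₁ := by rw [ha₁]; linarith
  -- After a short time the energies are bounded uniformly in `n`.
  have hen : ∀ n, ∀ t ∈ Icc a₁ 0, EnergyLE (v n t) M := by
    intro n t ht
    obtain ⟨a', ha', hd, -, hE⟩ := (H₁ n).exists_energyLE (L := L) (δ := δ / 4) h0 (by linarith)
      (hforce n) hL0 (by linarith) (by
        have : L * (δ / 4) = 2 * (wallBound K₁ K₂) ^ 2 * (1 + (0 - -δ)) + G + δ / 4 := by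
          rw [hL]; field_simp
        linarith)
    exact hE t ⟨by rw [ha₁] at ht; linarith [ht.1], ht.2⟩
  have H₂ : ∀ n, IsEVI K₁ K₂ a₁ 0 (v n) (g n) := fun n => (H₁ n).restrict ha₁δ le_rfl
  -- the uniform limit of the paths
  obtain ⟨w, hw, hwS, hconv⟩ := exists_uniform_limit (U := U) (a := a₁) (b := 0)
    (isCompact_energyLE (K₁ := K₁) (K₂ := K₂) M)
    (fun n t ht => ⟨(H₂ n).mem_wallSpace t ht, hen n t ht⟩)
    (κ := fun s => 2 * M * s + 2 * (G + wallBound K₁ K₂ ^ 2) * √s) (by fun_prop) (by simp)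
    (e := fun _ => 0) tendsto_const_nhds (fun n s hs t ht hst => by
      rw [add_zero]
      exact (H₁ n).norm_sub_sq_le (hforce n) (ha₁δ.trans hs.1) hst ht.2 (hen n s hs))
  have hww : ∀ t ∈ Icc a₁ 0, w t ∈ wallSpace K₁ K₂ := fun t ht => (hwS t ht).1
  have hpt : ∀ t ∈ Icc a₁ 0, Tendsto (fun n => v n t) U (𝓝 (w t)) := by
    intro t ht
    rw [Metric.tendsto_nhds]
    intro ε' hε'
    filter_upwards [hconv ε' hε'] with n hn
    rw [dist_eq_norm]; exact hn t ht
  -- the weak limit of the controls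
  set h : ℕ → ℝ × unitInterval → ℝ := fun n => control α f σ (v n) (g n) with hh
  have hh2 : ∀ n, MemLp (h n) 2 (volume.restrict (strip a₁ 0)) := fun n =>
    hc.memLp_control (H₂ n).continuousOn (H₂ n).mem_wallSpace (H₂ n).memLp
  have hcost₂ : ∀ n, ∀ s ∈ Icc a₁ 0, cost α f σ s 0 (v n) (g n) ≤ r + ε / 4 := fun n s hs => by
    have h1 := (H₁ n).cost_add (α := α) hc (ha₁δ.trans hs.1) hs.2
    have h2 : 0 ≤ cost α f σ (-δ) s (v n) (g n) := cost_nonneg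
    linarith [hcost₁ n]
  have hD : ∀ n, ∫ p in strip a₁ 0, h n p ^ 2 ≤ 2 * (r + ε / 4) := fun n => by
    have := hcost₂ n a₁ ⟨le_rfl, ha₁0⟩
    rw [cost] at this
    rw [setIntegral_strip_eq]
    linarith
  obtain ⟨k, hk, -, hweak⟩ := exists_weak_limit U hh2 hD
  have Hw : IsEVI K₁ K₂ a₁ 0 w (forcing α f σ w k) := by
    refine isEVI_of_tendsto (U := U) (v := v) (g := g) hw hww (hc.memLp_forcing hw hww hk) hconv
      (fun n K => ?_) (fun x s t hs hst ht => ?_) (fun x hx E hE s t hs hst ht K => ?_)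
    · refine ContinuousOn.intervalIntegrable ?_
      rw [uIcc_of_le ha₁0]
      exact (continuous_partialEnergy K).comp_continuousOn (H₂ n).continuousOn
    · have := tendsto_setIntegral_forcing (α := α) hc hLip (fun n => (H₂ n).continuousOn)
        (fun n => (H₂ n).mem_wallSpace) hw hww hconv hh2 hD hk hweak x hs ht
      simpa only [hh, forcing_control hc] using this
    · exact ⟨fun _ => 0, tendsto_const_nhds, fun n => by
        rw [add_zero]; exact (H₂ n).evi x hx E hE s t hs hst ht K⟩
  -- a time at which the limit path can be entered
  obtain ⟨s, hs, ζ, hζ⟩ := (Hw.restrict le_rfl (show -(δ / 2) ≤ 0 by linarith)).exists_isSubgradient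
    h0 (by rw [ha₁]; linarith)
  have hsm : s ∈ Icc a₁ 0 := ⟨hs.1.le, by linarith [hs.2]⟩
  have hs0 : s < 0 := by linarith [hs.2]
  -- lower semicontinuity of the cost of the final piece
  obtain ⟨l, -, hl⟩ := (isCompact_Icc (a := 0) (b := r + ε / 4)).ultrafilter_le_nhds'
    (U.map fun n => cost α f σ s 0 (v n) (g n))
    (Ultrafilter.mem_map.2 (Eventually.of_forall fun n => ⟨cost_nonneg, hcost₂ n s hsm⟩))
  have hl' : Tendsto (fun n => cost α f σ s 0 (v n) (g n)) U (𝓝 l) := hl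
  have hsub : slab s 0 ⊆ strip a₁ 0 := slab_subset_strip hsm.1 le_rfl
  have hμ := Measure.restrict_mono hsub (le_refl (volume : Measure (ℝ × unitInterval)))
  have hcostw : cost α f σ s 0 w (forcing α f σ w k) ≤ l := by
    rw [cost, control_forcing hc]
    have h1 := tendsto_setIntegral_mul hh2 hD hweak (q := fun _ => k) (q' := k) (fun _ => hk) hk
      (fun ε' hε' => Eventually.of_forall fun _ _ _ => by simpa using hε'.le)
      (measurableSet_slab s 0) hsub
    have h2 := integral_sq_le_of_tendsto (l := 2 * l) (fun n => (hh2 n).mono_measure hμ)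
      (hk.mono_measure hμ) h1 (by
        refine (hl'.const_mul 2).congr fun n => ?_
        rw [cost]; ring)
    linarith
  -- the connecting path
  set c₁ := 3 / (2 * m ^ 2) * ((‖ζ‖ + 1) ^ 2 + ((α * wallBound K₁ K₂) ^ 2 + B ^ 2)) with hc₁
  have hc₁0 : 0 < c₁ := by
    have := norm_nonneg ζ
    positivity
  set τ := ε / (8 * c₁) with hτ
  have hτ0 : 0 < τ := by positivity
  have hd : Tendsto (fun n => ‖toL2 (v n s - w s)‖) U (𝓝 0) := by
    have := ((toL2.continuous.tendsto _).comp ((hpt s hsm).sub_const (w s))).norm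
    simpa using this
  obtain ⟨n, hn1, hn2⟩ := ((hd.eventually_lt_const hτ0).and
    (hl'.eventually_const_lt (show l - ε / 8 < l by linarith))).exists
  obtain ⟨u, q, Hu, hu0, huT, hq⟩ := exists_connecting_path h0 ((H₂ n).mem_wallSpace s hsm)
    (hen n s hsm) (hww s hsm) hζ hτ0
  have hcostu : cost α f σ 0 τ u q ≤ ε / 8 := by
    refine (Hu.cost_le hc hτ0.le).trans ?_
    have h1 : (‖ζ‖ + ‖toL2 (v n s - w s)‖ / τ) ^ 2 ≤ (‖ζ‖ + 1) ^ 2 := by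
      refine pow_le_pow_left₀ (by positivity) (add_le_add_right ?_ _) 2
      rw [div_le_one hτ0]; exact hn1.le
    have h2 := mul_le_mul_of_nonneg_left h1 hτ0.le
    calc _ ≤ 3 / (2 * m ^ 2) * (τ * (‖ζ‖ + 1) ^ 2
          + (τ - 0) * ((α * wallBound K₁ K₂) ^ 2 + B ^ 2)) :=
          mul_le_mul_of_nonneg_left (by linarith) (by positivity)
      _ = c₁ * τ := by rw [hc₁]; ring
      _ = ε / 8 := by rw [hτ]; field_simp
  have han : a n ≤ s := (ha n).le.trans (ha₁δ.trans hsm.1)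
  have r1 : Reaches α f σ K₁ K₂ 0 (v n s) (s - a n) (cost α f σ (a n) s (v n) (g n)) := by
    have := ((H n).restrict le_rfl hs0.le).reaches (α := α) (f := f) (σ := σ) (a := a n)
    rwa [hva n] at this
  have r2 : Reaches α f σ K₁ K₂ (v n s) (w s) τ (ε / 8) := ⟨u, q, Hu, hu0, huT, hcostu⟩
  have r3 := (Hw.restrict hsm.1 le_rfl).reaches (α := α) (f := f) (σ := σ) (a := s)
  have hr3 := ((r1.trans hc (by linarith) hτ0.le r2).trans hc (by linarith) (by linarith) r3)
  have hadd := (H n).cost_add (α := α) hc han hs0.le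
  refine ⟨⟨w 0, hww 0 ⟨ha₁0, le_rfl⟩⟩, ?_, ?_⟩
  · rw [tendsto_subtype_rng]
    refine (hpt 0 ⟨ha₁0, le_rfl⟩).congr fun n => hv0 n
  · refine Reaches.quasipotential_le hc hK (by linarith) (hr3.mono ?_)
    linarith [hcost' n]

end ReflectedSPDE

theorem proposition4p2 (α : ℝ) (f σ : unitInterval → ℝ → ℝ) (K₁ K₂ : C(unitInterval, ℝ))
    -- the walls
    (hK : ∀ x, K₁ x < 0 ∧ 0 < K₂ x)
    (hK₁ : ReflectedSPDE.HasL2SecondDeriv K₁) (hK₂ : ReflectedSPDE.HasL2SecondDeriv K₂)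
    -- the coefficients
    (hf_meas : Measurable (Function.uncurry f))
    (hf_bdd : ∃ M : ℝ, ∀ x y, |f x y| ≤ M) (hσ_bdd : ∃ M : ℝ, ∀ x y, |σ x y| ≤ M)
    (hLip : ∃ C : ℝ, 0 < C ∧ ∀ x y y', |f x y - f x y'| + |σ x y - σ x y'| ≤ C * |y - y'|)
    (hσ_cont : Continuous (Function.uncurry σ))
    (hσ_lower : ∃ m : ℝ, 0 < m ∧ ∀ x y, m ≤ |σ x y|) :
    LowerSemicontinuous (ReflectedSPDE.quasipotential α f σ K₁ K₂) ∧
      ∀ r : ℝ≥0, IsCompact {z : ReflectedSPDE.wallSpace K₁ K₂ |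
        ReflectedSPDE.quasipotential α f σ K₁ K₂ z ≤ r} := by
  open ReflectedSPDE Filter Topology in
  obtain ⟨Bf, hBf⟩ := hf_bdd
  obtain ⟨Bσ, hBσ⟩ := hσ_bdd
  obtain ⟨C, -, hLip⟩ := hLip
  obtain ⟨m, hm, hσm⟩ := hσ_lower
  have hc : IsCoefficient f σ (max Bf Bσ) m := ⟨hf_meas, hσ_cont,
    fun x y => (hBf x y).trans (le_max_left _ _), fun x y => (hBσ x y).trans (le_max_right _ _),
    hm, hσm⟩
  have hcomp : ∀ r : ℝ≥0, IsCompact {z : wallSpace K₁ K₂ | quasipotential α f σ K₁ K₂ z ≤ r} := by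
    intro r
    refine IsSeqCompact.isCompact fun z hz => ?_
    have hz' : ∀ n, quasipotential α f σ K₁ K₂ (z n) ≤ ENNReal.ofReal r := fun n => by
      rw [ENNReal.ofReal_coe_nnreal]; exact hz n
    obtain ⟨y, hy, -⟩ := exists_limit_quasipotential_le (r := r) hc hLip hK r.coe_nonneg hz' one_pos
    refine ⟨y, ?_, ?_⟩
    · refine ENNReal.le_of_forall_pos_le_add fun ε hε _ => ?_
      obtain ⟨y', hy', hle⟩ := exists_limit_quasipotential_le (r := r) hc hLip hK r.coe_nonneg hz'
        (NNReal.coe_pos.2 hε)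
      rw [tendsto_nhds_unique hy hy']
      refine hle.trans (le_of_eq ?_)
      rw [ENNReal.ofReal_add r.coe_nonneg ε.coe_nonneg, ENNReal.ofReal_coe_nnreal,
        ENNReal.ofReal_coe_nnreal]
    · have hcl : MapClusterPt y atTop z :=
        (hy.mapClusterPt).mono Nat.hyperfilter_le_atTop
      exact hcl.tendsto_subseq
  refine ⟨lowerSemicontinuous_iff_isClosed_preimage.2 fun r => ?_, hcomp⟩
  induction r with
  | top => simp
  | coe r => exact (hcomp r).isClosed

end
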